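/- **Setting.** Let $d>1$, $\kappa\in(0,\frac1{4d}]$, let $\mathcal P_\kappa$ be the set of probability vectors on the $2d$ unit vectors $\pm e_i$ of $\mathbb Z^d$ with all entries at least $2\kappa$, let $\Omega=(\mathcal P_\kappa)^{\mathbb Z^d}$ with the product $\sigma$-algebra, and let $\mathbb P$ be a translation-invariant probability measure on $\Omega$. For $\omega\in\Omega$, $P_{x,\omega}$ is the law of the Markov chain $(X_n)_{n\ge0}$ on $\mathbb Z^d$ with $X_0=x$ and transition probabilities $P_{x,\omega}[X_{n+1}=X_n+e\mid X_n]=\omega(X_n,e)$, and $P_x=\mathbb P\otimes P_{x,\omega}$. For $V\subset\mathbb Z^d$ put $\partial^rV=\{z\notin V:\exists y\in V,\ |z-y|_1\le r\}$, $\partial V=\partial^1V$, and $\mathfrak F_\Lambda=\sigma(\omega_x,x\in\Lambda)$. **Mixing.** Let $r>1$ and $C,g>0$. $\mathbb P$ is $r$-Markovian if for every finite $V\subset\mathbb Z^d$ the conditional laws of $(\omega_x)_{x\in V}$ given $\mathfrak F_{V^c}$ and given $\mathfrak F_{\partial^rV}$ coincide a.s. An $r$-Markovian $\mathbb P$ satisfies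 $(\mathrm{SM})_{C,g}$ if for all finite $\Delta\subset V\subset\mathbb Z^d$ with $d_1(\Delta,V^c)\ge r$ and all $A\subset V^c$, $$\frac{d\mathbb P[(\omega_x)_{x\in\Delta}\in\cdot\mid\eta]}{d\mathbb P[(\omega_x)_{x\in\Delta}\in\cdot\mid\eta']}\le\exp\Big(C\sum_{x\in\partial^r\Delta,\ y\in\partial^rA}e^{-g|x-y|_1}\Big)$$ for all $\eta,\eta'$ outside a $\mathbb P$-null set that agree on $V^c\setminus A$, where $\mathbb P[\,\cdot\mid\eta]$ is the regular conditional law given $\mathfrak F_{V^c}$, evaluated at $\eta$. It satisfies $(\mathrm{SMG})_{C,g}$ if the same holds with the sum over $x\in\Delta,\ y\in A$ instead. **Condition (T).** Let $\ell$ be a unit vector of $\mathbb R^d$ such that $l:=h\ell\in\mathbb Z^d$ for some $h>0$. Condition $(\mathrm T)_\ell$ is taken in its box form: for some $\mathfrak r>0$ and some linear isometry $R$ of $\mathbb R^d$ with $R(e_1)=\ell$, $$\limsup_{M\to\infty}M^{-1}\log P_0\big[X_{T_{B_M}}\notin\partial^+B_M\big]<0,$$ where $B_M=R\big((-M,M)\times(-\mathfrak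 rM,\mathfrak rM)^{d-1}\big)\cap\mathbb Z^d$, $\partial^+B_M=\partial B_M\cap\{y:y\cdot\ell\ge M\}$ and $T_{B}=\inf\{n\ge0:X_n\notin B\}$. Fix such $\mathfrak r$ and $R$. **Cone.** Let $C(x,l,\zeta)=\{y\in\mathbb Z^d:(y-x)\cdot l\ge\zeta|l|_2|y-x|_2\}$. Let $\bar\varepsilon$ be the sequence of length $|l|_1$ made of $|l_1|$ copies of $\mathrm{sign}(l_1)e_1$, then $|l_2|$ copies of $\mathrm{sign}(l_2)e_2$, and so on up to $|l_d|$ copies of $\mathrm{sign}(l_d)e_d$. Fix $\zeta>0$ with $\zeta<\min\{\frac1{9d},\frac1{3d\mathfrak r},\cos(\frac\pi2-\arctan(3\mathfrak r))\}$ and such that all partial sums $\bar\varepsilon_1+\dots+\bar\varepsilon_m$, $1\le m\le|l|_1$, lie in $C(0,l,\zeta)$. **Regeneration time.** Let $Q$ be the product law of a sequence $\varepsilon=(\varepsilon_0,\varepsilon_1,\dots)$ with $Q[\varepsilon_n=\pm e_i]=\kappa$ and $Q[\varepsilon_n=0]=1-2d\kappa$. Let $P^0_{\omega,\varepsilon}$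 be the law of the Markov chain started at $0$ that jumps from $X_n$ to $X_n+e$ with probability $\mathbf 1_{\{\varepsilon_n=e\}}+\frac{\mathbf 1_{\{\varepsilon_n=0\}}}{1-2d\kappa}(\omega(X_n,e)-\kappa)$, and let $\overline P_0=\mathbb P\otimes Q\otimes P^0_{\omega,\varepsilon}$, with expectation $\overline E_0$. For $L\in|l|_1\mathbb N$ let $\bar\varepsilon^{(L)}$ be the concatenation of $L/|l|_1$ copies of $\bar\varepsilon$. Call $n\ge L$ a candidate if $X_{n-L}\cdot l>X_j\cdot l$ for all $0\le j<n-L$ and $(\varepsilon_{n-L},\dots,\varepsilon_{n-1})=\bar\varepsilon^{(L)}$. With $\inf\varnothing=\infty$, let $S_1$ be the first candidate, $R_k=\inf\{n\ge S_k:X_n\notin C(X_{S_k},l,\zeta)\}$, let $S_{k+1}$ be the first candidate $n>R_k$ (both being $\infty$ once a previous time is), $K=\inf\{k\ge1:S_k<\infty,R_k=\infty\}$, $\tau_1=S_K$ ($=\infty$ if $K=\infty$), and $Y=\sup_{0\le n\le\tau_1}|X_n|_2$. **Statement.** Assume $(\mathrm T)_\ell$ and either $(\mathrm{SM})_{C,g}$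 or $(\mathrm{SMG})_{C,g}$. 1. There are constants $c_2,c_3,L_0>0$ such that for all $L\in|l|_1\mathbb N$ with $L\ge L_0$: $\tau_1<\infty$ holds $\overline P_0$-a.s. and $$\overline E_0\big[\exp(c_2\,\kappa^L\,X_{\tau_1}\cdot l)\big]<c_3 .$$ 2. There are constants $c_6,c_7,L_0>0$ such that for all $L\in|l|_1\mathbb N$ with $L\ge L_0$: $$\overline E_0\big[\exp(c_6\,\kappa^L\,Y)\big]\le c_7 .$$ -/

import Mathlib

open MeasureTheory ProbabilityTheory Filter
open scoped ENNReal RealInnerProductSpace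

noncomputable section

namespace RWRE

/-! ### Lattice, norms, boundaries -/

/-- The lattice `ℤ^d`. -/
abbrev Site (d : ℕ) : Type := Fin d → ℤ

/-- The Euclidean space `ℝ^d`. -/
abbrev Space (d : ℕ) : Type := EuclideanSpace ℝ (Fin d)

/-- The inclusion of `ℤ^d` in `ℝ^d`. -/
def toSpace {d : ℕ} (x : Site d) : Space d := WithLp.toLp 2 (fun i => (x i : ℝ))

/-- The `ℓ¹` norm `|x|₁` on `ℤ^d`. -/
def l1 {d : ℕ} (x : Site d) : ℕ := ∑ i, (x i).natAbs

/-- The Euclidean norm `|x|₂` on `ℤ^d`. -/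
def l2 {d : ℕ} (x : Site d) : ℝ := ‖toSpace x‖

/-- The `r`-boundary `∂^r V` of a set of sites. -/
def rBoundary {d : ℕ} (r : ℝ) (V : Set (Site d)) : Set (Site d) :=
  {z | z ∉ V ∧ ∃ y ∈ V, (l1 (z - y) : ℝ) ≤ r}

/-- The `2d` nearest neighbour directions; `(i, true)` stands for `e_i` and `(i, false)` for
`-e_i`. -/
abbrev Dir (d : ℕ) : Type := Fin d × Bool

/-- The unit vector of `ℤ^d` with the given direction. -/
def Dir.vec {d : ℕ} (e : Dir d) : Site d :=
  if e.2 then Pi.single e.1 1 else -Pi.single e.1 1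

/-! ### Environments -/

/-- The range `(0, 1/(4d)]` of the ellipticity constant. -/
abbrev Ellipticity (d : ℕ) : Type := Set.Ioc (0 : ℝ) (1 / (4 * (d : ℝ)))

/-- The simplex `𝒫_κ` of probability vectors on the `2d` directions with entries at least `2κ`. -/
abbrev Simplex (d : ℕ) (κ : Ellipticity d) : Type :=
  {z : Dir d → ℝ // ∑ e, z e = 1 ∧ ∀ e, 2 * (κ : ℝ) ≤ z e}

/-- The space `Ω = 𝒫_κ^{ℤ^d}` of environments, with its product `σ`-algebra. -/
abbrev Env (d : ℕ) (κ : Ellipticity d) : Type := Site d → Simplex d κ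

theorem measurableSet_simplex (d : ℕ) (κ : Ellipticity d) :
    MeasurableSet {z : Dir d → ℝ | ∑ e, z e = 1 ∧ ∀ e, 2 * (κ : ℝ) ≤ z e} := by
  apply MeasurableSet.inter
  · exact measurableSet_eq_fun (by fun_prop) measurable_const
  · have : {z : Dir d → ℝ | ∀ e, 2 * (κ : ℝ) ≤ z e} = ⋂ e, {z | 2 * (κ : ℝ) ≤ z e} := by
      ext z; simp
    change MeasurableSet {z : Dir d → ℝ | ∀ e, 2 * (κ : ℝ) ≤ z e}
    rw [this]
    exact MeasurableSet.iInter fun e =>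
      measurableSet_le measurable_const (measurable_pi_apply e)

instance instStandardBorelSimplex (d : ℕ) (κ : Ellipticity d) :
    StandardBorelSpace (Simplex d κ) :=
  (measurableSet_simplex d κ).standardBorel

/-- Invariance of the law of the environment under the translations of `ℤ^d`. -/
def IsStationary {d : ℕ} {κ : Ellipticity d} (P : Measure (Env d κ)) : Prop :=
  ∀ y : Site d, P.map (fun ω x => ω (x + y)) = P

/-- The random environment is `r`-Markovian: for finite `V`, the conditional law of
`(ω_x)_{x ∈ V}` given `(ω_x)_{x ∉ V}` only depends on `(ω_x)_{x ∈ ∂^r V}`. Here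
`cylinderEvents Λ` is the `σ`-algebra `σ(ω_x, x ∈ Λ)`. -/
def IsMarkovian {d : ℕ} {κ : Ellipticity d} (r : ℝ) (P : Measure (Env d κ)) : Prop :=
  ∀ V : Set (Site d), V.Finite → ∀ B : Set (Env d κ), MeasurableSet[cylinderEvents V] B →
    P⟦B | cylinderEvents Vᶜ⟧ =ᵐ[P] P⟦B | cylinderEvents (rBoundary r V)⟧

/-- The common part of the two mixing conditions, with the exponent of the bound as a parameter.
For finite `Δ ⊆ V` with `d₁(Δ, V^c) ≥ r` and for `A ⊆ V^c`, off a null set of configurations,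
any two configurations `η, η'` that agree on `V^c \ A` satisfy
`P[(ω_x)_{x ∈ Δ} ∈ · | η] ≤ exp(S Δ A) P[(ω_x)_{x ∈ Δ} ∈ · | η']` as measures, that is, the density
of the first one with respect to the second one exists and is at most `exp(S Δ A)`. -/
def MixingWith {d : ℕ} {κ : Ellipticity d} (r : ℝ) (S : Set (Site d) → Set (Site d) → ℝ)
    (P : Measure (Env d κ)) [IsProbabilityMeasure P] : Prop :=
  ∀ Δ V A : Set (Site d), V.Finite → Δ ⊆ V → (∀ x ∈ Δ, ∀ y ∈ Vᶜ, r ≤ (l1 (x - y) : ℝ)) →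
    A ⊆ Vᶜ →
    ∃ G : Set (Env d κ), P Gᶜ = 0 ∧ ∀ η ∈ G, ∀ η' ∈ G, (∀ x ∈ Vᶜ \ A, η x = η' x) →
      ∀ B : Set (Env d κ), MeasurableSet[cylinderEvents Δ] B →
        condExpKernel P (cylinderEvents Vᶜ) η B ≤
          ENNReal.ofReal (Real.exp (S Δ A)) * condExpKernel P (cylinderEvents Vᶜ) η' B

/-- The strong mixing condition `(SM)_{C,g}` for an `r`-Markovian field. -/
def SM {d : ℕ} {κ : Ellipticity d} (r C g : ℝ)
    (P : Measure (Env d κ)) [IsProbabilityMeasure P] : Prop :=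
  IsMarkovian r P ∧
    MixingWith r (fun Δ A => C * ∑' p : rBoundary r Δ × rBoundary r A,
      Real.exp (-g * (l1 ((p.1 : Site d) - (p.2 : Site d)) : ℝ))) P

/-- Guo's strong mixing condition `(SMG)_{C,g}` for an `r`-Markovian field. -/
def SMG {d : ℕ} {κ : Ellipticity d} (r C g : ℝ)
    (P : Measure (Env d κ)) [IsProbabilityMeasure P] : Prop :=
  IsMarkovian r P ∧
    MixingWith r (fun Δ A => C * ∑' p : Δ × A,
      Real.exp (-g * (l1 ((p.1 : Site d) - (p.2 : Site d)) : ℝ))) P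

/-! ### Nearest neighbour Markov chains on `ℤ^d` in a random medium -/

/-- Transition probabilities of a (possibly time-inhomogeneous) nearest neighbour walk on `ℤ^d` in
a medium with values in `E`: `prob n η x e` is the probability of the jump `e` between the times
`n` and `n + 1`, from the site `x`, when the medium is `η`. -/
structure Transition (E : Type) [MeasurableSpace E] (d : ℕ) where
  prob : ℕ → E → Site d → Dir d → ℝ≥0∞
  measurable_prob : ∀ n x e, Measurable fun η => prob n η x e
  sum_prob : ∀ n η x, ∑ e, prob n η x e = 1

/-- One step of the walk, as a kernel on pairs (medium, site) which keeps the medium fixed. -/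
def Transition.step {E : Type} [MeasurableSpace E] {d : ℕ} (p : Transition E d) (n : ℕ) :
    Kernel (E × Site d) (E × Site d) where
  toFun s := ∑ e, p.prob n s.1 s.2 e • Measure.dirac (s.1, s.2 + e.vec)
  measurable' := by
    refine Measure.measurable_of_measurable_coe _ fun B hB => ?_
    refine measurable_from_prod_countable_left fun x => ?_
    simp only [Measure.coe_finsetSum, Finset.sum_apply, Measure.smul_apply, smul_eq_mul]
    refine Finset.measurable_sum _ fun e _ => (p.measurable_prob n x e).mul ?_
    exact (Measure.measurable_coe hB).comp
      (Measure.measurable_dirac.comp (measurable_id.prodMk measurable_const))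

instance Transition.isMarkovKernel_step {E : Type} [MeasurableSpace E] {d : ℕ}
    (p : Transition E d) (n : ℕ) : IsMarkovKernel (p.step n) :=
  ⟨fun s => ⟨by
    change (∑ e, p.prob n s.1 s.2 e • Measure.dirac (s.1, s.2 + e.vec)) Set.univ = 1
    simp [p.sum_prob]⟩⟩

/-- The law on paths `(X_n)_{n ≥ 0}` of the walk started at `x`, as a function of the medium. -/
def Transition.law {E : Type} [MeasurableSpace E] {d : ℕ} (p : Transition E d) (x : Site d) :
    Kernel E (ℕ → Site d) :=
  ((Kernel.traj (X := fun _ => E × Site d)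
    (fun n => (p.step n).comap (fun s => s ⟨n, Finset.mem_Iic.2 le_rfl⟩)
      (measurable_pi_apply _)) 0).comap
    (fun η _ => (η, x)) (by fun_prop)).map (fun s n => (s n).2)

instance Transition.isMarkovKernel_law {E : Type} [MeasurableSpace E] {d : ℕ}
    (p : Transition E d) (x : Site d) : IsMarkovKernel (p.law x) := by
  unfold Transition.law
  exact Kernel.IsMarkovKernel.map _ (by fun_prop)

/-- The transition probabilities of the walk in the environment `ω`. -/
def quenchedTransition (d : ℕ) (κ : Ellipticity d) : Transition (Env d κ) d where
  prob _ ω x e := ENNReal.ofReal ((ω x).1 e)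
  measurable_prob _ x e := ENNReal.measurable_ofReal.comp
    ((measurable_pi_apply e).comp (measurable_subtype_coe.comp (measurable_pi_apply x)))
  sum_prob _ ω x := by
    rw [← ENNReal.ofReal_sum_of_nonneg
      fun e _ => (by have := κ.2.1; linarith [(ω x).2.2 e]), (ω x).2.1, ENNReal.ofReal_one]

/-- The quenched law `P_{x,ω}` of the walk, as a function of `ω`. -/
def quenchedLaw (d : ℕ) (κ : Ellipticity d) (x : Site d) : Kernel (Env d κ) (ℕ → Site d) :=
  (quenchedTransition d κ).law x

/-- The annealed law `P_x`, the semidirect product of `P` and `P_{x,ω}`. -/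
def annealedLaw {d : ℕ} {κ : Ellipticity d} (P : Measure (Env d κ)) (x : Site d) :
    Measure (Env d κ × (ℕ → Site d)) :=
  P ⊗ₘ quenchedLaw d κ x

/-! ### Stopping times and condition (T) -/

/-- The infimum in `ℕ ∪ {∞}` of a set of times, with `inf ∅ = ∞`. -/
def firstTime (s : Set ℕ) : ℕ∞ := sInf ((fun n : ℕ => (n : ℕ∞)) '' s)

/-- The exit time `T_A = inf {n ≥ 0 : X_n ∉ A}`. -/
def exitTime {d : ℕ} (A : Set (Site d)) (X : ℕ → Site d) : ℕ∞ := firstTime {n | X n ∉ A}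

/-- The box `B_{L,L',ℓ}(x) = (x + R((-L,L) × (-L',L')^{d-1})) ∩ ℤ^d`, where `R e₁ = ℓ`. -/
def box {d : ℕ} (R : Space d ≃ₗᵢ[ℝ] Space d) (L L' : ℝ) (x : Site d) : Set (Site d) :=
  {y | ∃ u : Space d, (∀ i : Fin d, i.val = 0 → |u i| < L) ∧ (∀ i : Fin d, i.val ≠ 0 → |u i| < L') ∧
    toSpace y = toSpace x + R u}

/-- The positive boundary `∂⁺B_{L,L',ℓ}(x)` of the box. -/
def boxPosBoundary {d : ℕ} (R : Space d ≃ₗᵢ[ℝ] Space d) (ℓ : Space d) (L L' : ℝ) (x : Site d) :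
    Set (Site d) :=
  rBoundary 1 (box R L L' x) ∩ {y | L ≤ ⟪toSpace (y - x), ℓ⟫}

/-- Condition `(T)_ℓ`, with the aspect ratio `ρ` of the boxes and the rotation `R` with `R e₁ = ℓ`
made explicit: `limsup_{M → ∞} M⁻¹ log P₀[X_{T_B} ∉ ∂⁺B] < 0` for `B = B_{M,ρM,ℓ}(0)`. -/
def ConditionT {d : ℕ} {κ : Ellipticity d} (P : Measure (Env d κ)) (ℓ : Space d)
    (R : Space d ≃ₗᵢ[ℝ] Space d) (ρ : ℝ) : Prop :=
  (∀ i : Fin d, i.val = 0 → R (EuclideanSpace.single i 1) = ℓ) ∧ 0 < ρ ∧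
  limsup (fun M : ℝ => ((M⁻¹ : ℝ) : EReal) * ENNReal.log (annealedLaw P 0
    {z | ¬ (exitTime (box R M (ρ * M) 0) z.2 ≠ ⊤ ∧
      z.2 (exitTime (box R M (ρ * M) 0) z.2).toNat ∈ boxPosBoundary R ℓ M (ρ * M) 0)})) atTop < 0

/-! ### The enlarged probability space -/

/-- The set `𝒲 = {±e_i} ∪ {0}`; `none` stands for `0` and `some e` for the unit vector `e`. -/
abbrev Push (d : ℕ) : Type := Option (Dir d)

instance instMeasurableSpacePush (d : ℕ) : MeasurableSpace (Push d) := ⊤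

instance instDiscretePush (d : ℕ) : DiscreteMeasurableSpace (Push d) := ⟨fun _ => trivial⟩

/-- The one-coordinate marginal of `Q`: mass `κ` at each `±e_i` and mass `1 - 2dκ` at `0`. -/
def pushMarginal (d : ℕ) (κ : Ellipticity d) : Measure (Push d) :=
  (∑ e : Dir d, ENNReal.ofReal κ • Measure.dirac (some e)) +
    ENNReal.ofReal (1 - 2 * d * κ) • Measure.dirac none

theorem two_mul_kappa_lt_one {d : ℕ} (κ : Ellipticity d) : 0 < 1 - 2 * d * (κ : ℝ) := by
  obtain ⟨κ, h0, h1⟩ := κ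
  rcases Nat.eq_zero_or_pos d with rfl | hd
  · simp at h1; linarith
  · have hd' : (0 : ℝ) < 4 * d := by positivity
    rw [le_div_iff₀ hd'] at h1
    change 0 < 1 - 2 * d * κ
    nlinarith

instance instIsProbabilityMeasurePushMarginal (d : ℕ) (κ : Ellipticity d) :
    IsProbabilityMeasure (pushMarginal d κ) := by
  refine ⟨?_⟩
  have h1 := two_mul_kappa_lt_one κ
  have h0 : (0 : ℝ) < κ := κ.2.1
  simp only [pushMarginal, Measure.add_apply, Measure.coe_finsetSum, Finset.sum_apply,
    Measure.smul_apply, measure_univ, smul_eq_mul, mul_one, Finset.sum_const, Finset.card_univ,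
    Fintype.card_prod, Fintype.card_fin, Fintype.card_bool]
  rw [← ENNReal.ofReal_nsmul, ← ENNReal.ofReal_add (by positivity) h1.le]
  simp only [nsmul_eq_mul, Nat.cast_mul, Nat.cast_ofNat]
  rw [show (d : ℝ) * 2 * κ + (1 - 2 * d * κ) = 1 by ring, ENNReal.ofReal_one]

/-- The product measure `Q` on sequences `ε = (ε_0, ε_1, …)`. -/
def pushLaw (d : ℕ) (κ : Ellipticity d) : Measure (ℕ → Push d) :=
  Measure.infinitePi fun _ => pushMarginal d κ

instance instIsProbabilityMeasurePushLaw (d : ℕ) (κ : Ellipticity d) :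
    IsProbabilityMeasure (pushLaw d κ) := by
  unfold pushLaw; infer_instance

/-- The probability that the walk jumps by `e` when it sees the transition vector `z` and the
symbol `w`, namely `1_{w = e} + 1_{w = 0} (z(e) - κ) / (1 - 2dκ)`. -/
def pushedProb {d : ℕ} (κ : Ellipticity d) (z : Dir d → ℝ) (w : Push d) (e : Dir d) : ℝ :=
  (if w = some e then 1 else 0) +
    (if w = none then 1 else 0) / (1 - 2 * d * (κ : ℝ)) * (z e - κ)

theorem pushedProb_nonneg {d : ℕ} (κ : Ellipticity d) (z : Simplex d κ) (w : Push d) (e : Dir d) :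
    0 ≤ pushedProb κ z.1 w e := by
  have h1 := two_mul_kappa_lt_one κ
  have h0 : (0 : ℝ) < κ := κ.2.1
  have h2 : 0 ≤ z.1 e - κ := by linarith [z.2.2 e]
  unfold pushedProb
  refine add_nonneg (by split_ifs <;> norm_num) (mul_nonneg (div_nonneg ?_ h1.le) h2)
  split_ifs <;> norm_num

theorem sum_pushedProb {d : ℕ} (κ : Ellipticity d) (z : Simplex d κ) (w : Push d) :
    ∑ e, pushedProb κ z.1 w e = 1 := by
  have h1 := two_mul_kappa_lt_one κ
  unfold pushedProb
  rw [Finset.sum_add_distrib, ← Finset.mul_sum, Finset.sum_sub_distrib, z.2.1]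
  cases w with
  | some e => simp
  | none =>
    simp only [reduceCtorEq, if_false, if_true, Finset.sum_const_zero, zero_add, Finset.sum_const,
      Finset.card_univ, Fintype.card_prod, Fintype.card_fin, Fintype.card_bool, nsmul_eq_mul,
      Nat.cast_mul, Nat.cast_ofNat]
    rw [show (1 : ℝ) - d * 2 * κ = 1 - 2 * d * κ by ring]
    field_simp

/-- The transition probabilities of the walk in the environment `ω` driven by `ε`; the symbol
`ε_n` acts on the step from time `n` to time `n + 1`. -/
def pushedTransition (d : ℕ) (κ : Ellipticity d) : Transition (Env d κ × (ℕ → Push d)) d where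
  prob n η x e := ENNReal.ofReal (pushedProb κ (η.1 x).1 (η.2 n) e)
  measurable_prob n x e := by
    refine ENNReal.measurable_ofReal.comp ?_
    have hz : Measurable fun η : Env d κ × (ℕ → Push d) => (η.1 x).1 e :=
      (measurable_pi_apply e).comp (measurable_subtype_coe.comp
        ((measurable_pi_apply x).comp measurable_fst))
    have hw : Measurable fun η : Env d κ × (ℕ → Push d) => η.2 n :=
      (measurable_pi_apply n).comp measurable_snd
    exact ((measurable_from_top (f := fun w : Push d => if w = some e then (1 : ℝ) else 0)).comp
      hw).add ((((measurable_from_top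
        (f := fun w : Push d => if w = none then (1 : ℝ) else 0)).comp hw).div_const _).mul
          (hz.sub_const _))
  sum_prob n η x := by
    rw [← ENNReal.ofReal_sum_of_nonneg fun e _ => pushedProb_nonneg κ (η.1 x) (η.2 n) e,
      sum_pushedProb, ENNReal.ofReal_one]

/-- The law `P̄₀ = P ⊗ Q ⊗ P_{ω,ε}^0` of `((ω, ε), (X_n)_{n ≥ 0})`. -/
def enlargedLaw {d : ℕ} {κ : Ellipticity d} (P : Measure (Env d κ)) :
    Measure ((Env d κ × (ℕ → Push d)) × (ℕ → Site d)) :=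
  (P.prod (pushLaw d κ)) ⊗ₘ (pushedTransition d κ).law 0

/-! ### The approximate regeneration time -/

/-- The cone `C(x, l, ζ)`. -/
def cone {d : ℕ} (l : Site d) (ζ : ℝ) (x : Site d) : Set (Site d) :=
  {y | ζ * l2 l * l2 (y - x) ≤ (((y - x) ⬝ᵥ l : ℤ) : ℝ)}

/-- The sequence `ε̄` of length `|l|₁`: first `|l_1|` steps `sign(l_1) e_1`, then `|l_2|` steps
`sign(l_2) e_2`, and so on. -/
def barSeq {d : ℕ} (l : Site d) : List (Dir d) :=
  (List.finRange d).flatMap fun i => List.replicate (l i).natAbs (i, decide (0 < l i))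

/-- The sequence `ε̄^{(L)}`, the concatenation of `L / |l|₁` copies of `ε̄`. -/
def barSeqL {d : ℕ} (l : Site d) (L : ℕ) : List (Dir d) :=
  (List.replicate (L / l1 l) (barSeq l)).flatten

/-- `D' = inf {n ≥ 0 : X_n ∉ C(X_0, l, ζ)}`. -/
def coneExit {d : ℕ} (l : Site d) (ζ : ℝ) (X : ℕ → Site d) : ℕ∞ :=
  exitTime (cone l ζ (X 0)) X

/-- The times `n ≥ L` such that the walk reaches at time `n - L` a strict record level in direction
`l` and `(ε_{n-L}, …, ε_{n-1}) = ε̄^{(L)}`. -/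
def candidateTimes {d : ℕ} (l : Site d) (L : ℕ) (ε : ℕ → Push d) (X : ℕ → Site d) : Set ℕ :=
  {n | L ≤ n ∧ (∀ j < n - L, X j ⬝ᵥ l < X (n - L) ⬝ᵥ l) ∧
    List.ofFn (fun j : Fin L => ε (n - L + j)) = (barSeqL l L).map some}

/-- `D' ∘ θ_S + S`, which is `∞` when `S = ∞`. -/
def coneExitAfter {d : ℕ} (l : Site d) (ζ : ℝ) (X : ℕ → Site d) (S : ℕ∞) : ℕ∞ :=
  if S = ⊤ then ⊤ else coneExit l ζ (fun m => X (S.toNat + m)) + S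

/-- The times `S_k`, with `S_0 = 0`. -/
def timeS {d : ℕ} (l : Site d) (ζ : ℝ) (L : ℕ) (ε : ℕ → Push d) (X : ℕ → Site d) : ℕ → ℕ∞
  | 0 => 0
  | 1 => firstTime (candidateTimes l L ε X)
  | k + 2 => firstTime {n | coneExitAfter l ζ X (timeS l ζ L ε X (k + 1)) < (n : ℕ∞) ∧
      n ∈ candidateTimes l L ε X}

/-- The times `R_k = D' ∘ θ_{S_k} + S_k`. -/
def timeR {d : ℕ} (l : Site d) (ζ : ℝ) (L : ℕ) (ε : ℕ → Push d) (X : ℕ → Site d) (k : ℕ) : ℕ∞ :=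
  coneExitAfter l ζ X (timeS l ζ L ε X k)

/-- `K = inf {k ≥ 1 : S_k < ∞, R_k = ∞}`. -/
def indexK {d : ℕ} (l : Site d) (ζ : ℝ) (L : ℕ) (ε : ℕ → Push d) (X : ℕ → Site d) : ℕ∞ :=
  firstTime {k | 1 ≤ k ∧ timeS l ζ L ε X k < ⊤ ∧ timeR l ζ L ε X k = ⊤}

/-- The approximate regeneration time `τ₁ = S_K`, which is `∞` when `K = ∞`. -/
def tau1 {d : ℕ} (l : Site d) (ζ : ℝ) (L : ℕ) (ε : ℕ → Push d) (X : ℕ → Site d) : ℕ∞ :=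
  if indexK l ζ L ε X = ⊤ then ⊤ else timeS l ζ L ε X (indexK l ζ L ε X).toNat

/-- The maximal excursion `Y = sup_{0 ≤ n ≤ τ₁} |X_n|₂`, meaningful when `τ₁ < ∞`. -/
def maxExcursion {d : ℕ} (l : Site d) (ζ : ℝ) (L : ℕ) (ε : ℕ → Push d) (X : ℕ → Site d) : ℝ :=
  ⨆ n : {n : ℕ // (n : ℕ∞) ≤ tau1 l ζ L ε X}, l2 (X n)

end RWRE

end

/-!
The proof follows the walk together with the symbols that drive it, as one sequence of letters
`(ε_n, X_{n+1} - X_n)`. In a fixed environment the probability `wt ω x w` that the walk from `x`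
follows a word `w` is a product over the sites visited, and the strong Markov property
`strong_markov` is a sum over the words at the end of which a stopping time occurs. Everything is
reduced to such sums, and the law of the environment enters only through expectations of weights
of words. Conditional laws given the past of a regeneration never appear.

Let `R_0 = 0` and let `J_k` be the maximum of `exp(c κ^L X_n·l)` over the times `n ≤ S_{k+1}`. The
heart of the matter is that `E[J_k; R_k < ∞]` decays geometrically in `k`, at a rate that does not
depend on `L` (`attemptMoment_le`). Three estimates give the factor lost at each step.

* The wait for the next candidate (`lintegral_sup_until_cand_le`): at each record the walk starts to
  read `ε̄^{(L)}`, and each further symbol is matched with probability `κ`. Weighting the running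
  maximum by the number of symbols already matched gives a supermartingale in every environment.
  This is where the factor `κ^L` in the exponent comes from. The cost is a factor close to `1` for
  small `c`.
* The decoupling (`exists_decoupling`, `lintegral_wt_mul_wt_le`): the last `L` steps of an attempt
  have a deterministic weight, so that the environment seen before them and the one seen in the cone
  after them are at distance of order `L`. Either mixing condition bounds the expectation of the
  product of two weights by `exp(S L)` times the product of the expectations, with `S L → 0`.
* The excursion in the cone (`exists_coneMoment_le`): the moment of the maximal level before the
  exit from the cone, on the event that the walk exits, is less than `1`. It is close to the
  probability of this event when the exponent is small, and this probability is less than `1`.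

Condition (T) enters through `ConditionT.exists_scale`. By a Borel–Cantelli bound with exponential
moments, there is a random scale `m₀` beyond which every box around a site not too far from the
origin is left through its positive boundary after the first visit to this site. Chaining such boxes
shows that the path stays in the cone once it has left the box of size `4 m₀`
(`ExitsWell.confined`). So the levels before the exit from the cone are of order `m₀`, and following
`ε̄` for a long while first makes the exit impossible with positive probability.

The sum `W` of the terms `J_k` over the attempts with `R_k < ∞` is then integrable, hence finite.
As `J_k ≥ 1`, there are finitely many failures, and as the levels are unbounded, no wait is endless.
So `τ₁` is finite and `exp(c κ^L X_n·l) ≤ W` for `n ≤ τ₁` (`exists_tau1_eq_attempt`), which is the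
first part. For the second part, levels below `log W / (c κ^L)` keep the path in a box of a size
linear in `m₀` and `log W` (`Confined.l2_le_of_supTo_le`).
-/

namespace RWRE

/-! ### Cylinder probabilities of a nearest neighbour walk -/

/-- The site reached at time `n` from `x` by a sequence of directions. -/
def dirPos {d : ℕ} (x : Site d) (D : ℕ → Dir d) (n : ℕ) : Site d :=
  x + ∑ i ∈ Finset.range n, (D i).vec

theorem dirPos_zero {d : ℕ} (x : Site d) (D : ℕ → Dir d) : dirPos x D 0 = x := by
  simp [dirPos]

theorem dirPos_succ {d : ℕ} (x : Site d) (D : ℕ → Dir d) (n : ℕ) :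
    dirPos x D (n + 1) = dirPos x D n + (D n).vec := by
  simp [dirPos, Finset.sum_range_succ, add_assoc]

theorem dirPos_congr {d : ℕ} {x : Site d} {D D' : ℕ → Dir d} {n : ℕ} (h : ∀ i < n, D i = D' i) :
    dirPos x D n = dirPos x D' n := by
  unfold dirPos
  congr 1
  exact Finset.sum_congr rfl fun i hi => by rw [h i (Finset.mem_range.1 hi)]

theorem Dir.vec_apply {d : ℕ} (e : Dir d) (j : Fin d) :
    e.vec j = if j = e.1 then (if e.2 then 1 else -1) else 0 := by
  obtain ⟨i, b⟩ := e
  rcases eq_or_ne j i with rfl | hj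
  · cases b <;> simp [Dir.vec]
  · cases b <;> simp [Dir.vec, hj]

theorem Dir.vec_injective {d : ℕ} : Function.Injective (Dir.vec (d := d)) := by
  rintro ⟨i, b⟩ ⟨j, c⟩ h
  have hi := congrFun h i
  rw [Dir.vec_apply, Dir.vec_apply, if_pos rfl] at hi
  by_cases hij : i = j
  · subst hij
    cases b <;> cases c <;> simp at hi ⊢
  · exfalso
    rw [if_neg hij] at hi
    cases b <;> cases c
    all_goals simp at hi ⊢

section Law

variable {E : Type} [MeasurableSpace E] {d : ℕ}

/-- The law of the trajectory of the pairs (medium, site). -/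
noncomputable def Transition.pairLaw (p : Transition E d) (η : E) (x : Site d) :
    Measure (ℕ → E × Site d) :=
  Kernel.traj (X := fun _ => E × Site d)
    (fun n => (p.step n).comap (fun s => s ⟨n, Finset.mem_Iic.2 le_rfl⟩)
      (measurable_pi_apply _)) 0 (fun _ => (η, x))

theorem Transition.law_apply (p : Transition E d) (η : E) (x : Site d) :
    p.law x η = (p.pairLaw η x).map (fun s n => (s n).2) := by
  unfold Transition.law Transition.pairLaw
  rw [Kernel.map_apply _ (by fun_prop), Kernel.comap_apply]

/-- The one-step Markov property of the trajectory measure. -/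
theorem Transition.lintegral_pairLaw_succ (p : Transition E d) (η : E) (x : Site d) (n : ℕ)
    (F : (Finset.Iic n → E × Site d) → ℝ≥0∞) (hF : Measurable F)
    (G : E × Site d → ℝ≥0∞) (hG : Measurable G) :
    ∫⁻ s, F (Preorder.frestrictLe n s) * G (s (n + 1)) ∂(p.pairLaw η x) =
      ∫⁻ s, F (Preorder.frestrictLe n s) *
        ∑ e, p.prob n (s n).1 (s n).2 e * G ((s n).1, (s n).2 + e.vec) ∂(p.pairLaw η x) := by
  have key : ∀ y : E × Site d, ∫⁻ z, G z ∂(p.step n y) =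
      ∑ e, p.prob n y.1 y.2 e * G (y.1, y.2 + e.vec) := by
    intro y
    change ∫⁻ z, G z ∂(∑ e, p.prob n y.1 y.2 e • Measure.dirac (y.1, y.2 + e.vec)) = _
    rw [lintegral_finsetSum_measure]
    simp [lintegral_dirac' _ hG]
  have hm : Measurable fun y : E × Site d => ∫⁻ z, G z ∂(p.step n y) :=
    hG.lintegral_kernel
  let κ : (n : ℕ) → Kernel (Finset.Iic n → E × Site d) (E × Site d) :=
    fun n => (p.step n).comap (fun s => s ⟨n, Finset.mem_Iic.2 le_rfl⟩) (measurable_pi_apply _)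
  have h1 := Kernel.partialTraj_compProd_eq_map_traj (X := fun _ => E × Site d) (κ := κ)
    (Nat.zero_le n) (x₀ := fun _ => (η, x))
  have h2 : ∫⁻ q, F q.1 * G q.2 ∂((Kernel.traj (X := fun _ => E × Site d) κ 0
      (fun _ => (η, x))).map (fun s => (Preorder.frestrictLe n s, s (n + 1)))) =
      ∫⁻ s, F (Preorder.frestrictLe n s) * G (s (n + 1)) ∂(p.pairLaw η x) := by
    rw [lintegral_map (by fun_prop) (by fun_prop)]
    rfl
  rw [← h2, ← h1, Measure.lintegral_compProd (by fun_prop)]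
  have h3 : ∀ u : Finset.Iic n → E × Site d, ∫⁻ b, F u * G b ∂(κ n u) =
      F u * ∫⁻ z, G z ∂(p.step n (u ⟨n, Finset.mem_Iic.2 le_rfl⟩)) := by
    intro u
    rw [lintegral_const_mul _ hG]
    rfl
  simp_rw [h3]
  rw [← Kernel.traj_map_frestrictLe_apply, lintegral_map _ (by fun_prop)]
  · simp_rw [← key]; rfl
  · exact hF.mul (hm.comp (measurable_pi_apply _))

theorem Transition.pairLaw_zero (p : Transition E d) (η : E) (x : Site d)
    (G : E × Site d → ℝ≥0∞) (hG : Measurable G) :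
    ∫⁻ s, G (s 0) ∂(p.pairLaw η x) = G (η, x) := by
  let κ : (n : ℕ) → Kernel (Finset.Iic n → E × Site d) (E × Site d) :=
    fun n => (p.step n).comap (fun s => s ⟨n, Finset.mem_Iic.2 le_rfl⟩) (measurable_pi_apply _)
  have h1 := Kernel.traj_map_frestrictLe_apply (X := fun _ => E × Site d) (κ := κ) 0 0
    (fun _ => (η, x))
  have h2 : ∫⁻ u, G (u ⟨0, Finset.mem_Iic.2 le_rfl⟩) ∂((Kernel.traj (X := fun _ => E × Site d) κ 0
      (fun _ => (η, x))).map (Preorder.frestrictLe 0)) = ∫⁻ s, G (s 0) ∂(p.pairLaw η x) := by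
    rw [lintegral_map (by fun_prop) (by fun_prop)]
    rfl
  rw [← h2, h1, Kernel.partialTraj_self, Kernel.id_apply, lintegral_dirac' _ (by fun_prop)]

/-- The medium being kept fixed, the walk follows a prescribed sequence of directions up to time
`n` with the product of its transition probabilities. The factor `f`, which sees the medium only,
makes the induction work. -/
theorem Transition.lintegral_pairLaw_cylinder (p : Transition E d) (η : E) (x : Site d)
    (D : ℕ → Dir d) (n : ℕ) (f : E → ℝ≥0∞) (hf : Measurable f) :
    ∫⁻ s, {u : Finset.Iic n → E × Site d | ∀ i : Finset.Iic n, (u i).2 = dirPos x D i}.indicator 1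
        (Preorder.frestrictLe n s) * f (s n).1 ∂(p.pairLaw η x) =
      (∏ i ∈ Finset.range n, p.prob i η (dirPos x D i) (D i)) * f η := by
  have hmeas : ∀ n : ℕ, MeasurableSet {u : Finset.Iic n → E × Site d |
      ∀ i : Finset.Iic n, (u i).2 = dirPos x D i} := by
    intro n
    rw [Set.ofPred_forall]
    exact MeasurableSet.iInter fun i => measurableSet_eq_fun (by fun_prop) measurable_const
  induction n generalizing f with
  | zero =>
    have := p.pairLaw_zero η x (fun y => {z : Site d | z = x}.indicator 1 y.2 * f y.1) (by
      refine Measurable.mul ?_ (hf.comp measurable_fst)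
      exact ((measurable_one.indicator (MeasurableSet.of_discrete))).comp measurable_snd)
    simp only [Finset.range_zero, Finset.prod_empty, one_mul]
    rw [Set.indicator_of_mem (by rfl), Pi.one_apply, one_mul] at this
    rw [← this]
    congr 1 with s
    congr 1
    simp only [Set.indicator_apply, Set.mem_ofPred_eq]
    congr 1
    rw [eq_iff_iff]
    constructor
    · intro h; simpa [dirPos_zero] using h ⟨0, by simp⟩
    · rintro h ⟨i, hi⟩
      obtain rfl : i = 0 := by simpa using hi
      simpa [dirPos_zero] using h
  | succ n ih =>
    have h1 := p.lintegral_pairLaw_succ η x n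
      ({u : Finset.Iic n → E × Site d | ∀ i : Finset.Iic n, (u i).2 = dirPos x D i}.indicator 1)
      (measurable_one.indicator (hmeas n))
      (fun y => {z : Site d | z = dirPos x D (n + 1)}.indicator 1 y.2 * f y.1) (by
      refine Measurable.mul ?_ (hf.comp measurable_fst)
      exact ((measurable_one.indicator (MeasurableSet.of_discrete))).comp measurable_snd)
    have h2 := ih (fun η => p.prob n η (dirPos x D n) (D n) * f η)
      ((p.measurable_prob _ _ _).mul hf)
    rw [Finset.prod_range_succ, mul_assoc, ← h2]
    trans
    · trans
      swap
      · exact h1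
      congr 1 with s
      rw [← mul_assoc]
      congr 1
      simp only [Set.indicator_apply, Set.mem_ofPred_eq, Pi.one_apply]
      by_cases ha : ∀ i : Finset.Iic (n + 1), (Preorder.frestrictLe (n + 1) s i).2 = dirPos x D i
      · rw [if_pos ha, if_pos, if_pos]
        · simp
        · exact ha ⟨n + 1, by simp⟩
        · rintro ⟨i, hi⟩
          exact ha ⟨i, by simp at hi ⊢; omega⟩
      · rw [if_neg ha]
        by_cases hb : ∀ i : Finset.Iic n, (Preorder.frestrictLe n s i).2 = dirPos x D i
        · rw [if_neg (c := (s (n + 1)).2 = dirPos x D (n + 1)), mul_zero]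
          intro hc
          apply ha
          rintro ⟨i, hi⟩
          rcases eq_or_ne i (n + 1) with rfl | hne
          · exact hc
          · exact hb ⟨i, by simp at hi ⊢; omega⟩
        · rw [if_neg hb, zero_mul]
    · congr 1 with s
      by_cases hb : ∀ i : Finset.Iic n, (Preorder.frestrictLe n s i).2 = dirPos x D i
      · congr 1
        have hn : (s n).2 = dirPos x D n := hb ⟨n, by simp⟩
        rw [hn, dirPos_succ, Finset.sum_eq_single (D n)]
        · simp
        · intro e _ he
          rw [Set.indicator_of_notMem]
          · simp
          · intro h
            exact he (Dir.vec_injective (add_left_cancel h))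
        · simp
      · rw [Set.indicator_of_notMem (by exact hb)]
        simp

/-- The law of the chain on cylinders: the probability of following given directions is the product
of the transition probabilities along them. -/
theorem Transition.law_cylinder (p : Transition E d) (η : E) (x : Site d) (D : ℕ → Dir d)
    (n : ℕ) :
    p.law x η {X | ∀ i ≤ n, X i = dirPos x D i} =
      ∏ i ∈ Finset.range n, p.prob i η (dirPos x D i) (D i) := by
  classical
  have h := p.lintegral_pairLaw_cylinder η x D n 1 measurable_one
  have hm : MeasurableSet {X : ℕ → Site d | ∀ i ≤ n, X i = dirPos x D i} := by
    simp only [Set.ofPred_forall]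
    exact MeasurableSet.iInter fun i => MeasurableSet.iInter fun _ =>
      measurableSet_eq_fun (by fun_prop) measurable_const
  simp only [Pi.one_apply, mul_one] at h
  rw [← h, p.law_apply, Measure.map_apply (by fun_prop) hm, ← lintegral_indicator_one
    (hm.preimage (by fun_prop))]
  congr 1 with s
  rw [Set.indicator_apply, Set.indicator_apply]
  congr 1
  rw [eq_iff_iff]
  constructor
  · rintro h ⟨i, hi⟩
    exact h i (by simpa using hi)
  · intro h i hi
    exact h ⟨i, by simpa using hi⟩

end Law

/-! ### Words, cylinders and stopping times -/

section Words

variable {A : Type*}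

/-- The sequence that starts with the word `w` and goes on with `ξ`. -/
def cat : List A → (ℕ → A) → ℕ → A
  | [], ξ => ξ
  | a :: w, ξ => fun n => Nat.casesOn n a (cat w ξ)

@[simp] theorem cat_nil (ξ : ℕ → A) : cat [] ξ = ξ := rfl

@[simp] theorem cat_cons_zero (a : A) (w : List A) (ξ : ℕ → A) : cat (a :: w) ξ 0 = a := rfl

@[simp] theorem cat_cons_succ (a : A) (w : List A) (ξ : ℕ → A) (n : ℕ) :
    cat (a :: w) ξ (n + 1) = cat w ξ n := rfl

theorem cat_append (w v : List A) (ξ : ℕ → A) : cat (w ++ v) ξ = cat w (cat v ξ) := by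
  induction w with
  | nil => rfl
  | cons a w ih => funext n; cases n <;> simp [ih]

theorem cat_add (w : List A) (ξ : ℕ → A) (n : ℕ) : cat w ξ (w.length + n) = ξ n := by
  induction w with
  | nil => simp
  | cons a w ih => rw [List.length_cons, Nat.add_right_comm, cat_cons_succ, ih]

theorem cat_lt (w : List A) (ξ : ℕ → A) (i : ℕ) (h : i < w.length) : cat w ξ i = w[i] := by
  induction w generalizing i with
  | nil => simp at h
  | cons a w ih =>
    cases i with
    | zero => rfl
    | succ i => rw [cat_cons_succ, ih i (by simpa using h)]; rfl

/-- The first `n` letters of a sequence. -/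
def pre (n : ℕ) (ξ : ℕ → A) : List A := List.ofFn fun i : Fin n => ξ i

@[simp] theorem length_pre (n : ℕ) (ξ : ℕ → A) : (pre n ξ).length = n := by simp [pre]

theorem cat_pre (n : ℕ) (ξ : ℕ → A) : cat (pre n ξ) (fun m => ξ (n + m)) = ξ := by
  funext i
  rcases lt_or_ge i n with h | h
  · rw [cat_lt _ _ _ (by simpa using h)]; simp [pre]
  · obtain ⟨m, rfl⟩ := Nat.exists_eq_add_of_le h
    have := cat_add (pre n ξ) (fun m => ξ (n + m)) m
    rwa [length_pre] at this

theorem pre_cat (w : List A) (ξ : ℕ → A) : pre w.length (cat w ξ) = w := by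
  apply List.ext_getElem (by simp)
  intro i h1 h2
  simp [pre, cat_lt w ξ i h2]

/-- The set of sequences that start with the word `w`. -/
def cyl (w : List A) : Set (ℕ → A) := Set.range (cat w)

theorem mem_cyl_iff_pre {w : List A} {ξ : ℕ → A} : ξ ∈ cyl w ↔ pre w.length ξ = w := by
  constructor
  · rintro ⟨ξ', rfl⟩; exact pre_cat w ξ'
  · intro h
    refine ⟨fun m => ξ (w.length + m), ?_⟩
    conv_lhs => rw [← h]
    simpa using cat_pre w.length ξ

theorem mem_cyl {w : List A} {ξ : ℕ → A} :
    ξ ∈ cyl w ↔ ∀ i (h : i < w.length), ξ i = w[i] := by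
  rw [mem_cyl_iff_pre]
  constructor
  · intro h i hi
    have h2 : (pre w.length ξ)[i]'(by simpa using hi) = ξ i := by simp [pre]
    rw [← h2]
    congr 1
  · intro h
    apply List.ext_getElem (by simp)
    intro i h1 h2
    simp [pre, h i h2]

theorem cyl_nil : cyl ([] : List A) = Set.univ := by
  ext ξ; simp [mem_cyl]

theorem cat_mem_cyl_cons {a b : A} {w : List A} {ξ : ℕ → A} :
    cat [a] ξ ∈ cyl (b :: w) ↔ a = b ∧ ξ ∈ cyl w := by
  rw [mem_cyl, mem_cyl]
  constructor
  · intro h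
    refine ⟨h 0 (by simp), fun i hi => ?_⟩
    exact h (i + 1) (by simpa using hi)
  · rintro ⟨rfl, h⟩ i hi
    cases i with
    | zero => rfl
    | succ i => simpa using h i (by simpa using hi)

/-- Stopping times of the filtration of the first letters: the event `T = n` depends on the first
`n` letters. -/
def IsStop (T : (ℕ → A) → ℕ∞) : Prop :=
  ∀ (n : ℕ) (ξ ξ' : ℕ → A), (∀ i < n, ξ i = ξ' i) → T ξ = n → T ξ' = n

/-- The words at the end of which the stopping time `T` occurs. -/
def stopWords (T : (ℕ → A) → ℕ∞) : Set (List A) := {w | ∀ ξ, T (cat w ξ) = w.length}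

theorem IsStop.pre_mem {T : (ℕ → A) → ℕ∞} (hT : IsStop T) {ξ : ℕ → A} {n : ℕ} (h : T ξ = n) :
    pre n ξ ∈ stopWords T := by
  intro ξ'
  rw [length_pre]
  refine hT n ξ _ (fun i hi => ?_) h
  rw [cat_lt _ _ _ (by simpa using hi)]; simp [pre]

theorem pairwise_disjoint_stopWords (T : (ℕ → A) → ℕ∞) :
    Pairwise (Function.onFun Disjoint fun w : stopWords T => cyl w.1) := by
  intro w v hwv
  rw [Function.onFun, Set.disjoint_left]
  intro ξ h1 h2
  apply hwv
  have hl : ((w.1.length : ℕ) : ℕ∞) = v.1.length := by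
    obtain ⟨ξ', rfl⟩ := h1
    obtain ⟨ξ'', h⟩ := h2
    rw [← w.2 ξ', ← v.2 ξ'', h]
  rw [Nat.cast_inj] at hl
  rw [mem_cyl_iff_pre] at h1 h2
  exact Subtype.ext (by rw [← h1, ← h2, hl])

theorem IsStop.setOf_lt_top {T : (ℕ → A) → ℕ∞} (hT : IsStop T) :
    {ξ | T ξ < ⊤} = ⋃ w : stopWords T, cyl w.1 := by
  ext ξ
  simp only [Set.mem_iUnion, Set.mem_ofPred_eq]
  constructor
  · intro h
    obtain ⟨n, hn⟩ := ENat.ne_top_iff_exists.1 h.ne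
    exact ⟨⟨pre n ξ, hT.pre_mem hn.symm⟩, ⟨_, cat_pre n ξ⟩⟩
  · rintro ⟨w, ξ', rfl⟩
    rw [w.2 ξ']; exact ENat.natCast_lt_top _

variable [MeasurableSpace A]

theorem measurable_cat (w : List A) : Measurable (cat w) := by
  rw [measurable_pi_iff]
  intro n
  rcases lt_or_ge n w.length with h | h
  · simp_rw [cat_lt w _ n h]; exact measurable_const
  · obtain ⟨m, rfl⟩ := Nat.exists_eq_add_of_le h
    simp_rw [cat_add]; exact measurable_pi_apply m

variable [MeasurableSingletonClass A]

theorem measurableSet_cyl (w : List A) : MeasurableSet (cyl w) := by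
  have : cyl w = ⋂ i, ⋂ h : i < w.length, {ξ | ξ i = w[i]} := by
    ext ξ; simp [mem_cyl]
  rw [this]
  exact MeasurableSet.iInter fun i => MeasurableSet.iInter fun h =>
    measurable_pi_apply i (measurableSet_singleton _)

variable [Countable A]

/-- A property of sequences which depends on the first `n` letters is measurable. -/
theorem measurableSet_of_prefix (s : Set (ℕ → A)) (n : ℕ)
    (h : ∀ ξ ξ' : ℕ → A, (∀ i < n, ξ i = ξ' i) → ξ ∈ s → ξ' ∈ s) : MeasurableSet s := by
  have : s = ⋃ w : {w : List A // cyl w ⊆ s}, cyl w.1 := by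
    ext ξ
    simp only [Set.mem_iUnion]
    constructor
    · intro hξ
      refine ⟨⟨pre n ξ, fun ξ' h' => h ξ ξ' (fun i hi => ?_) hξ⟩, ?_⟩
      · rw [mem_cyl] at h'
        rw [h' i (by simpa using hi)]
        simp [pre]
      · exact ⟨_, cat_pre n ξ⟩
    · rintro ⟨w, hw⟩; exact w.2 hw
  rw [this]
  exact MeasurableSet.iUnion fun w => measurableSet_cyl _

theorem measure_ext_cyl {μ ν : Measure (ℕ → A)} [IsFiniteMeasure μ]
    (h : ∀ w, μ (cyl w) = ν (cyl w)) : μ = ν := by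
  refine ext_of_generate_finite (insert ∅ (Set.range cyl)) ?_ ?_ ?_ ?_
  · apply le_antisymm
    · refine iSup_le fun i => ?_
      rintro _ ⟨s, _, rfl⟩
      have : (fun ξ : ℕ → A => ξ i) ⁻¹' s =
          ⋃ w : {w : List A // cyl w ⊆ (fun ξ : ℕ → A => ξ i) ⁻¹' s}, cyl w.1 := by
        ext ξ
        simp only [Set.mem_iUnion]
        constructor
        · intro hξ
          refine ⟨⟨pre (i + 1) ξ, fun ξ' h' => ?_⟩, ⟨_, cat_pre (i + 1) ξ⟩⟩
          rw [mem_cyl] at h'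
          have := h' i (by simp)
          simp only [pre, List.getElem_ofFn] at this
          simpa [this] using hξ
        · rintro ⟨w, hw⟩; exact w.2 hw
      rw [this]
      refine @MeasurableSet.iUnion _ _ (MeasurableSpace.generateFrom _) _ _ fun w => ?_
      exact MeasurableSpace.measurableSet_generateFrom (Or.inr ⟨_, rfl⟩)
    · refine MeasurableSpace.generateFrom_le ?_
      rintro _ (rfl | ⟨w, rfl⟩)
      · exact MeasurableSet.empty
      · exact measurableSet_cyl w
  · rintro _ (rfl | ⟨w, rfl⟩) _ (rfl | ⟨v, rfl⟩) hne
    · simp at hne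
    · simp at hne
    · simp at hne
    · right
      obtain ⟨ξ, h1, h2⟩ := hne
      have aux : ∀ w v : List A, ξ ∈ cyl w → ξ ∈ cyl v → w.length ≤ v.length →
          cyl w ∩ cyl v = cyl v := by
        intro w v h1 h2 hl
        refine Set.inter_eq_right.2 fun ξ' h' => ?_
        rw [mem_cyl] at *
        intro i hi
        rw [h' i (by omega), ← h2 i (by omega), h1 i hi]
      rcases le_total w.length v.length with hl | hl
      · exact ⟨v, (aux w v h1 h2 hl).symm⟩
      · exact ⟨w, by rw [Set.inter_comm]; exact (aux v w h2 h1 hl).symm⟩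
  · rintro _ (rfl | ⟨w, rfl⟩)
    · simp
    · exact h w
  · rw [← cyl_nil]; exact h []

theorem IsStop.measurableSet_eq {T : (ℕ → A) → ℕ∞} (hT : IsStop T) (n : ℕ) :
    MeasurableSet {ξ | T ξ = n} :=
  measurableSet_of_prefix _ n fun ξ ξ' h => hT n ξ ξ' h

theorem IsStop.measurableSet_lt_top {T : (ℕ → A) → ℕ∞} (hT : IsStop T) :
    MeasurableSet {ξ | T ξ < ⊤} := by
  rw [hT.setOf_lt_top]
  exact MeasurableSet.iUnion fun w => measurableSet_cyl _

theorem IsStop.measurableSet_le {T : (ℕ → A) → ℕ∞} (hT : IsStop T) (n : ℕ) :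
    MeasurableSet {ξ | (n : ℕ∞) ≤ T ξ} := by
  have : {ξ | (n : ℕ∞) ≤ T ξ} = (⋃ m : Fin n, {ξ | T ξ = (m : ℕ)})ᶜ := by
    ext ξ
    simp only [Set.mem_ofPred_eq, Set.mem_compl_iff, Set.mem_iUnion, not_exists]
    constructor
    · intro h m hm
      rw [hm, Nat.cast_le] at h
      omega
    · intro h
      by_contra hc
      rw [not_le] at hc
      obtain ⟨m, hm⟩ := ENat.ne_top_iff_exists.1 (hc.trans (ENat.natCast_lt_top n)).ne
      rw [← hm, Nat.cast_lt] at hc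
      exact h ⟨m, hc⟩ hm.symm
  rw [this]
  exact (MeasurableSet.iUnion fun m => hT.measurableSet_eq _).compl

end Words

/-! ### The walk as a sequence of letters -/

section Directions

variable {E : Type} [MeasurableSpace E] {d : ℕ} [NeZero d]

/-- The direction of a unit vector; a junk direction for the other vectors. -/
noncomputable def dirOf (x : Site d) : Dir d := Function.invFun Dir.vec x

theorem dirOf_vec (e : Dir d) : dirOf e.vec = e :=
  Function.leftInverse_invFun Dir.vec_injective e

/-- The directions of the steps of a path. -/
noncomputable def dirs (X : ℕ → Site d) (n : ℕ) : Dir d := dirOf (X (n + 1) - X n)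

theorem measurable_dirs : Measurable (dirs (d := d)) := by
  rw [measurable_pi_iff]
  intro n
  exact (Measurable.of_discrete (f := dirOf (d := d))).comp (by fun_prop)

theorem Transition.ae_law (p : Transition E d) (η : E) (x : Site d) :
    ∀ᵐ X ∂(p.law x η), X = dirPos x (dirs X) := by
  have h0 : ∀ᵐ s ∂(p.pairLaw η x), (s 0).2 = x := by
    rw [ae_iff]
    have := p.pairLaw_zero η x (fun y => {z : Site d | z ≠ x}.indicator 1 y.2)
      ((measurable_one.indicator (MeasurableSet.of_discrete)).comp measurable_snd)
    have hm : MeasurableSet {s : ℕ → E × Site d | ¬ (s 0).2 = x} :=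
      (measurableSet_eq_fun (by fun_prop) measurable_const).compl
    rw [← lintegral_indicator_one hm]
    rw [Set.indicator_of_notMem (by simp)] at this
    rw [← this]
    rfl
  have h1 : ∀ᵐ s ∂(p.pairLaw η x), ∀ n, ∃ e : Dir d, (s (n + 1)).2 = (s n).2 + e.vec := by
    rw [ae_all_iff]
    intro n
    have h2 : ∀ z : Site d, ∀ᵐ s ∂(p.pairLaw η x), (s n).2 = z →
        ∃ e : Dir d, (s (n + 1)).2 = (s n).2 + e.vec := by
      intro z
      have hB : MeasurableSet {u : Site d | ¬ ∃ e : Dir d, u = z + e.vec} := .of_discrete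
      have hm0 : MeasurableSet {u : Finset.Iic n → E × Site d |
          (u ⟨n, Finset.mem_Iic.2 le_rfl⟩).2 = z} :=
        measurableSet_eq_fun (by fun_prop) measurable_const
      have key := p.lintegral_pairLaw_succ η x n
        ({u | (u ⟨n, Finset.mem_Iic.2 le_rfl⟩).2 = z}.indicator 1)
        (measurable_one.indicator hm0)
        (fun y => {u : Site d | ¬ ∃ e : Dir d, u = z + e.vec}.indicator 1 y.2)
        ((measurable_one.indicator hB).comp measurable_snd)
      have hzero : ∀ s : ℕ → E × Site d, {u : Finset.Iic n → E × Site d |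
          (u ⟨n, Finset.mem_Iic.2 le_rfl⟩).2 = z}.indicator (1 : (Finset.Iic n → E × Site d) → ℝ≥0∞)
            (Preorder.frestrictLe n s) *
          ∑ e, p.prob n (s n).1 (s n).2 e *
            {u : Site d | ¬ ∃ e : Dir d, u = z + e.vec}.indicator 1 ((s n).2 + e.vec) = 0 := by
        intro s
        by_cases hs : (s n).2 = z
        · rw [Finset.sum_eq_zero, mul_zero]
          intro e _
          rw [Set.indicator_of_notMem, mul_zero]
          rw [hs]
          exact fun h => h ⟨e, rfl⟩
        · rw [Set.indicator_of_notMem (by exact hs), zero_mul]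
      simp only [hzero, lintegral_zero] at key
      rw [lintegral_eq_zero_iff] at key
      · filter_upwards [key] with s hs hz
        by_contra hcon
        rw [Set.indicator_of_mem (by exact hz), Set.indicator_of_mem] at hs
        · simp at hs
        · rwa [hz] at hcon
      · refine Measurable.mul ((measurable_one.indicator hm0).comp (by fun_prop)) ?_
        exact ((measurable_one.indicator hB).comp (by fun_prop))
    rw [← ae_all_iff] at h2
    filter_upwards [h2] with s hs using hs _ rfl
  rw [p.law_apply, ae_map_iff (Measurable.aemeasurable (by fun_prop))]
  · filter_upwards [h0, h1] with s hs0 hs1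
    funext n
    induction n with
    | zero => rw [dirPos_zero]; exact hs0
    | succ n ih =>
      rw [dirPos_succ, ← ih]
      obtain ⟨e, he⟩ := hs1 n
      have : dirs (fun n => (s n).2) n = e := by
        unfold dirs; simp only []; rw [he, add_sub_cancel_left, dirOf_vec]
      rw [this]
      exact he
  · have : {X : ℕ → Site d | X = dirPos x (dirs X)} =
        ⋂ n, {X | X n = dirPos x (dirs X) n} := by
      ext X; simp [funext_iff]
    rw [this]
    refine MeasurableSet.iInter fun n => measurableSet_eq_fun (by fun_prop) ?_
    have h3 : Measurable fun D : ℕ → Dir d => dirPos x D n := by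
      unfold dirPos
      refine Measurable.const_add (Finset.measurable_fun_sum _ fun i _ => ?_) x
      exact (Measurable.of_discrete (f := Dir.vec (d := d))).comp (measurable_pi_apply i)
    exact h3.comp measurable_dirs

theorem Transition.law_dirs (p : Transition E d) (η : E) (x : Site d) (D : ℕ → Dir d) (n : ℕ) :
    p.law x η {X | ∀ i < n, dirs X i = D i} =
      ∏ i ∈ Finset.range n, p.prob i η (dirPos x D i) (D i) := by
  rw [← p.law_cylinder]
  refine measure_congr ?_
  filter_upwards [p.ae_law η x] with X hX
  refine propext ⟨fun h i hi => ?_, fun h i hi => ?_⟩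
  · have h' : ∀ i < n, dirs X i = D i := h
    rw [hX]
    exact dirPos_congr fun j hj => h' j (by omega)
  · have h' : ∀ i ≤ n, X i = dirPos x D i := h
    unfold dirs
    rw [h' i (by omega), h' (i + 1) (by omega), dirPos_succ, add_sub_cancel_left, dirOf_vec]

end Directions

/-- A letter records the symbol `ε_n` and the direction of the `n`-th step. -/
abbrev Letter (d : ℕ) : Type := Push d × Dir d

/-- The site at time `n` of the walk from `x` with a given sequence of letters. -/
def pos {d : ℕ} (x : Site d) (ξ : ℕ → Letter d) (n : ℕ) : Site d :=
  dirPos x (fun i => (ξ i).2) n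

/-- The endpoint of the walk from `x` along a word. -/
def endpt {d : ℕ} (x : Site d) : List (Letter d) → Site d
  | [] => x
  | a :: w => endpt (x + a.2.vec) w

section Paths

variable {d : ℕ}

@[simp] theorem pos_zero (x : Site d) (ξ : ℕ → Letter d) : pos x ξ 0 = x := dirPos_zero _ _

theorem pos_succ (x : Site d) (ξ : ℕ → Letter d) (n : ℕ) :
    pos x ξ (n + 1) = pos x ξ n + (ξ n).2.vec := dirPos_succ _ _ _

theorem pos_cons_succ (x : Site d) (a : Letter d) (w : List (Letter d)) (ξ : ℕ → Letter d)
    (n : ℕ) : pos x (cat (a :: w) ξ) (n + 1) = pos (x + a.2.vec) (cat w ξ) n := by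
  unfold pos dirPos
  rw [Finset.sum_range_succ']
  simp only [cat_cons_succ, cat_cons_zero]
  abel

theorem pos_cat_add (x : Site d) (w : List (Letter d)) (ξ : ℕ → Letter d) (n : ℕ) :
    pos x (cat w ξ) (w.length + n) = pos (endpt x w) ξ n := by
  induction w generalizing x with
  | nil => simp [endpt]
  | cons a w ih => rw [List.length_cons, Nat.add_right_comm, pos_cons_succ, ih]; rfl

theorem pos_cat_length (x : Site d) (w : List (Letter d)) (ξ : ℕ → Letter d) :
    pos x (cat w ξ) w.length = endpt x w := by
  simpa using pos_cat_add x w ξ 0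

theorem pos_congr {x : Site d} {ξ ξ' : ℕ → Letter d} {n : ℕ} (h : ∀ i < n, ξ i = ξ' i) :
    pos x ξ n = pos x ξ' n :=
  dirPos_congr fun i hi => by rw [h i hi]

theorem endpt_append (x : Site d) (w v : List (Letter d)) :
    endpt x (w ++ v) = endpt (endpt x w) v := by
  induction w generalizing x with
  | nil => rfl
  | cons a w ih => exact ih _

theorem pos_add_start (x y : Site d) (ξ : ℕ → Letter d) (n : ℕ) :
    pos (x + y) ξ n = x + pos y ξ n := by
  simp [pos, dirPos, add_assoc]

theorem pos_eq_add (x : Site d) (ξ : ℕ → Letter d) (n : ℕ) : pos x ξ n = x + pos 0 ξ n := by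
  simpa using pos_add_start x 0 ξ n

theorem endpt_eq_add (x : Site d) (w : List (Letter d)) : endpt x w = x + endpt 0 w := by
  induction w generalizing x with
  | nil => simp [endpt]
  | cons a w ih => rw [endpt, ih, endpt, ih (0 + _)]; simp [add_assoc]

theorem measurable_pos (x : Site d) : Measurable (pos x) := by
  rw [measurable_pi_iff]
  intro n
  unfold pos dirPos
  refine Measurable.const_add (Finset.measurable_fun_sum _ fun i _ => ?_) x
  exact (Measurable.of_discrete (f := fun a : Letter d => a.2.vec)).comp (measurable_pi_apply i)

end Paths

section Weights

variable {d : ℕ} {κ : Ellipticity d}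

/-- The quenched probability that the letter at a site with transition vector `z` is `a`. -/
noncomputable def letterProb (κ : Ellipticity d) (z : Dir d → ℝ) (a : Letter d) : ℝ≥0∞ :=
  pushMarginal d κ {a.1} * ENNReal.ofReal (pushedProb κ z a.1 a.2)

/-- The quenched probability that the walk from `x` follows the word `w`. -/
noncomputable def wt (ω : Env d κ) : Site d → List (Letter d) → ℝ≥0∞
  | _, [] => 1
  | x, a :: w => letterProb κ (ω x).1 a * wt ω (x + a.2.vec) w

/-- The sites whose environment is seen by the walk from `x` along a word: all but the last. -/
def sites {d : ℕ} : Site d → List (Letter d) → Set (Site d)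
  | _, [] => ∅
  | x, a :: w => insert x (sites (x + a.2.vec) w)

theorem sites_finite (x : Site d) (w : List (Letter d)) : (sites x w).Finite := by
  induction w generalizing x with
  | nil => exact Set.finite_empty
  | cons a w ih => exact (ih _).insert _

theorem mem_sites {x y : Site d} {w : List (Letter d)} (ξ : ℕ → Letter d) :
    y ∈ sites x w ↔ ∃ n < w.length, y = pos x (cat w ξ) n := by
  induction w generalizing x with
  | nil => simp [sites]
  | cons a w ih =>
    rw [sites, Set.mem_insert_iff, ih]
    constructor
    · rintro (rfl | ⟨n, hn, rfl⟩)
      · exact ⟨0, by simp, by simp⟩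
      · exact ⟨n + 1, by simpa using hn, by rw [pos_cons_succ]⟩
    · rintro ⟨n, hn, rfl⟩
      cases n with
      | zero => left; simp
      | succ n => right; exact ⟨n, by simpa using hn, by rw [pos_cons_succ]⟩

theorem wt_append (ω : Env d κ) (x : Site d) (w v : List (Letter d)) :
    wt ω x (w ++ v) = wt ω x w * wt ω (endpt x w) v := by
  induction w generalizing x with
  | nil => simp [wt, endpt]
  | cons a w ih => simp [wt, endpt, ih, mul_assoc]

theorem wt_shift (ω : Env d κ) (x z : Site d) (w : List (Letter d)) :
    wt (fun y => ω (y + z)) x w = wt ω (x + z) w := by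
  induction w generalizing x with
  | nil => simp [wt]
  | cons a w ih =>
    rw [wt, wt, ih, show x + a.2.vec + z = x + z + a.2.vec by abel]

theorem measurable_letterProb (a : Letter d) :
    Measurable fun z : Simplex d κ => letterProb κ z.1 a := by
  unfold letterProb
  refine Measurable.const_mul (ENNReal.measurable_ofReal.comp ?_) _
  unfold pushedProb
  exact (((measurable_pi_apply a.2).comp measurable_subtype_coe).sub_const _).const_mul _
    |>.const_add _

theorem measurable_wt_cylinderEvents (Δ : Set (Site d)) (x : Site d) (w : List (Letter d))
    (h : sites x w ⊆ Δ) : Measurable[cylinderEvents Δ] fun ω : Env d κ => wt ω x w := by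
  induction w generalizing x with
  | nil => exact measurable_const
  | cons a w ih =>
    have h1 : x ∈ Δ := h (Set.mem_insert _ _)
    have h2 := ih (x + a.2.vec) fun y hy => h (Set.mem_insert_of_mem _ hy)
    have h3 : Measurable[cylinderEvents Δ] fun ω : Env d κ => letterProb κ (ω x).1 a :=
      (measurable_letterProb a).comp (measurable_cylinderEvent_apply h1)
    exact @Measurable.mul ℝ≥0∞ (Env d κ) _ _ (cylinderEvents Δ) _ _ _ h3 h2

theorem measurable_wt (x : Site d) (w : List (Letter d)) :
    Measurable fun ω : Env d κ => wt ω x w :=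
  (measurable_wt_cylinderEvents Set.univ x w (Set.subset_univ _)).mono cylinderEvents_le_pi le_rfl

theorem pushMarginal_some (e : Dir d) : pushMarginal d κ {some e} = ENNReal.ofReal κ := by
  simp [pushMarginal, Finset.sum_apply, Set.indicator_apply]

theorem pushMarginal_none : pushMarginal d κ {none} = ENNReal.ofReal (1 - 2 * d * κ) := by
  simp [pushMarginal]

theorem sum_letterProb (z : Simplex d κ) : ∑ a, letterProb κ z.1 a = 1 := by
  unfold letterProb
  rw [Fintype.sum_prod_type]
  simp_rw [← Finset.mul_sum]
  have : ∀ s : Push d, ∑ e, ENNReal.ofReal (pushedProb κ z.1 s e) = 1 := fun s => by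
    rw [← ENNReal.ofReal_sum_of_nonneg fun e _ => pushedProb_nonneg κ z s e, sum_pushedProb,
      ENNReal.ofReal_one]
  simp_rw [this, mul_one]
  rw [sum_measure_singleton]
  simp

theorem sum_letterProb_fst (z : Simplex d κ) (e : Dir d) :
    ∑ s, letterProb κ z.1 (s, e) = ENNReal.ofReal (z.1 e) := by
  have h1 := two_mul_kappa_lt_one κ
  have h0 : (0 : ℝ) < κ := κ.2.1
  have h2 : 0 ≤ z.1 e - κ := by linarith [z.2.2 e]
  unfold letterProb
  rw [Fintype.sum_option, Finset.sum_eq_single e]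
  · rw [pushMarginal_none, pushMarginal_some, ← ENNReal.ofReal_mul h1.le,
      ← ENNReal.ofReal_mul h0.le, ← ENNReal.ofReal_add]
    · congr 1
      simp only [pushedProb]
      simp
      field_simp
      ring
    · exact mul_nonneg h1.le (pushedProb_nonneg κ z none e)
    · exact mul_nonneg h0.le (pushedProb_nonneg κ z (some e) e)
  · intro e' _ he
    simp [pushedProb, he]
  · simp

theorem letterProb_self (z : Dir d → ℝ) (e : Dir d) :
    letterProb κ z (some e, e) = ENNReal.ofReal κ := by
  simp [letterProb, pushMarginal_some, pushedProb]

theorem letterProb_ne (z : Dir d → ℝ) (e e' : Dir d) (h : e ≠ e') :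
    letterProb κ z (some e, e') = 0 := by
  simp [letterProb, pushedProb, h]

theorem wt_eq_prod (ω : Env d κ) (x : Site d) (w : List (Letter d)) (ξ : ℕ → Letter d) :
    wt ω x w = ∏ i ∈ Finset.range w.length,
      letterProb κ (ω (pos x (cat w ξ) i)).1 (cat w ξ i) := by
  induction w generalizing x with
  | nil => simp [wt]
  | cons a w ih =>
    rw [List.length_cons, Finset.prod_range_succ', wt, ih, mul_comm]
    congr 1
    · refine Finset.prod_congr rfl fun i _ => ?_
      rw [pos_cons_succ, cat_cons_succ]
    · simp

end Weights

/-! ### The quenched law of the letters and the Markov property -/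

section QuenchedLaw

variable {d : ℕ} {κ : Ellipticity d}

theorem lintegral_shift {P : Measure (Env d κ)} (hstat : IsStationary P) (z : Site d)
    (f : Env d κ → ℝ≥0∞) (hf : Measurable f) :
    ∫⁻ ω, f (fun y => ω (y + z)) ∂P = ∫⁻ ω, f ω ∂P := by
  conv_rhs => rw [← hstat z]
  rw [lintegral_map hf]
  rw [measurable_pi_iff]
  exact fun y => measurable_pi_apply _

/-- The quenched probability that the walk from `x` follows given directions. -/
noncomputable def dirWt (ω : Env d κ) : Site d → List (Dir d) → ℝ≥0∞
  | _, [] => 1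
  | x, e :: D => ENNReal.ofReal ((ω x).1 e) * dirWt ω (x + e.vec) D

theorem dirWt_eq_prod (ω : Env d κ) (x : Site d) (D : List (Dir d)) (D' : ℕ → Dir d) :
    dirWt ω x D = ∏ i ∈ Finset.range D.length,
      ENNReal.ofReal ((ω (dirPos x (cat D D') i)).1 (cat D D' i)) := by
  induction D generalizing x with
  | nil => simp [dirWt]
  | cons e D ih =>
    rw [List.length_cons, Finset.prod_range_succ', dirWt, ih, mul_comm]
    congr 1
    · refine Finset.prod_congr rfl fun i _ => ?_
      have : dirPos x (cat (e :: D) D') (i + 1) = dirPos (x + e.vec) (cat D D') i := by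
        unfold dirPos
        rw [Finset.sum_range_succ']
        simp only [cat_cons_succ, cat_cons_zero]
        abel
      rw [this, cat_cons_succ]
    · simp [dirPos_zero]

theorem lintegral_wt_shift {P : Measure (Env d κ)} (hstat : IsStationary P) (x : Site d)
    (w : List (Letter d)) : ∫⁻ ω, wt ω x w ∂P = ∫⁻ ω, wt ω 0 w ∂P := by
  rw [← lintegral_shift hstat x _ (measurable_wt 0 w)]
  simp_rw [wt_shift, zero_add]

section Kernel

variable [NeZero d]

/-- The letters of the walk, as a function of the symbols and of the path. -/
noncomputable def letters (q : (ℕ → Push d) × (ℕ → Site d)) (n : ℕ) : Letter d :=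
  (q.1 n, dirs q.2 n)

theorem measurable_letters : Measurable (letters (d := d)) := by
  rw [measurable_pi_iff]
  intro n
  exact ((measurable_pi_apply n).comp measurable_fst).prodMk
    ((measurable_pi_apply n).comp (measurable_dirs.comp measurable_snd))

/-- The quenched law of the sequence of letters of the walk started at `x`. -/
noncomputable def walkKernel (κ : Ellipticity d) (x : Site d) :
    Kernel (Env d κ) (ℕ → Letter d) :=
  ((Kernel.const (Env d κ) (pushLaw d κ)) ⊗ₖ ((pushedTransition d κ).law x)).map letters

instance (x : Site d) : IsMarkovKernel (walkKernel κ x) := by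
  unfold walkKernel
  exact Kernel.IsMarkovKernel.map _ measurable_letters

theorem walkKernel_cyl (ω : Env d κ) (x : Site d) (w : List (Letter d)) :
    walkKernel κ x ω (cyl w) = wt ω x w := by
  have hne : Nonempty (Letter d) := ⟨(none, (0, true))⟩
  obtain ⟨ξ⟩ : Nonempty (ℕ → Letter d) := inferInstance
  set ζ := cat w ξ with hζ
  have hcyl : ∀ q : (ℕ → Push d) × (ℕ → Site d), letters q ∈ cyl w ↔
      (∀ i < w.length, q.1 i = (ζ i).1) ∧ ∀ i < w.length, dirs q.2 i = (ζ i).2 := by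
    intro q
    rw [mem_cyl, ← forall₂_and]
    refine forall₂_congr fun i hi => ?_
    rw [hζ, cat_lt _ _ _ hi, letters, Prod.ext_iff]
  rw [walkKernel, Kernel.map_apply' _ measurable_letters _ (measurableSet_cyl w),
    Kernel.compProd_apply (measurable_letters (measurableSet_cyl w)), Kernel.const_apply]
  have hin : ∀ ε : ℕ → Push d, (pushedTransition d κ).law x (ω, ε)
      (Prod.mk ε ⁻¹' (letters ⁻¹' cyl w)) =
      (Set.pi (Finset.range w.length : Set ℕ) fun i => {(ζ i).1}).indicator
        (fun _ => ∏ i ∈ Finset.range w.length,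
          ENNReal.ofReal (pushedProb κ (ω (pos x ζ i)).1 (ζ i).1 (ζ i).2)) ε := by
    intro ε
    by_cases hε : ∀ i < w.length, ε i = (ζ i).1
    · rw [Set.indicator_of_mem (by simpa [Set.mem_pi] using hε)]
      have : (Prod.mk ε ⁻¹' (letters ⁻¹' cyl w)) =
          {X : ℕ → Site d | ∀ i < w.length, dirs X i = (ζ i).2} := by
        ext X
        simp only [Set.mem_preimage, hcyl, Set.mem_ofPred_eq]
        exact and_iff_right hε
      rw [this, Transition.law_dirs _ _ _ (fun i => (ζ i).2)]
      refine Finset.prod_congr rfl fun i hi => ?_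
      rw [← hε i (Finset.mem_range.1 hi)]
      rfl
    · rw [Set.indicator_of_notMem (by simpa [Set.mem_pi] using hε)]
      have : (Prod.mk ε ⁻¹' (letters ⁻¹' cyl w)) = ∅ := by
        ext X
        simp only [Set.mem_preimage, hcyl, Set.mem_empty_iff_false, iff_false]
        exact fun h => hε h.1
      rw [this, measure_empty]
  simp_rw [hin]
  rw [lintegral_indicator, setLIntegral_const, pushLaw, Measure.infinitePi_pi, wt_eq_prod ω x w ξ,
    ← Finset.prod_mul_distrib]
  · exact Finset.prod_congr rfl fun i _ => mul_comm _ _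
  · exact fun i _ => measurableSet_singleton _
  · exact MeasurableSet.pi (Finset.countable_toSet _) fun i _ => measurableSet_singleton _

theorem walkKernel_eq_sum (ω : Env d κ) (x : Site d) :
    walkKernel κ x ω = ∑ a, letterProb κ (ω x).1 a •
      (walkKernel κ (x + a.2.vec) ω).map (cat [a]) := by
  refine measure_ext_cyl fun w => ?_
  rw [walkKernel_cyl, Measure.coe_finsetSum, Finset.sum_apply]
  simp only [Measure.smul_apply, smul_eq_mul]
  simp_rw [Measure.map_apply (measurable_cat _) (measurableSet_cyl w)]
  cases w with
  | nil =>
    simp only [cyl_nil, Set.preimage_univ, measure_univ, mul_one]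
    rw [sum_letterProb]; rfl
  | cons b w =>
    rw [Finset.sum_eq_single b]
    · rw [wt]
      congr 1
      rw [← walkKernel_cyl]
      congr 1
      ext ξ
      simp [cat_mem_cyl_cons]
    · intro a _ hab
      have : cat [a] ⁻¹' cyl (b :: w) = ∅ := by
        ext ξ
        simp [cat_mem_cyl_cons, hab]
      rw [this, measure_empty, mul_zero]
    · simp

theorem lintegral_walkKernel_step (ω : Env d κ) (x : Site d) (F : (ℕ → Letter d) → ℝ≥0∞)
    (hF : Measurable F) :
    ∫⁻ ξ, F ξ ∂(walkKernel κ x ω) =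
      ∑ a, letterProb κ (ω x).1 a * ∫⁻ ξ, F (cat [a] ξ) ∂(walkKernel κ (x + a.2.vec) ω) := by
  conv_lhs => rw [walkKernel_eq_sum ω x]
  rw [lintegral_finsetSum_measure]
  refine Finset.sum_congr rfl fun a _ => ?_
  rw [lintegral_smul_measure, lintegral_map hF (measurable_cat _), smul_eq_mul]

theorem setLIntegral_walkKernel_cyl (ω : Env d κ) (x : Site d) (w : List (Letter d))
    (F : (ℕ → Letter d) → ℝ≥0∞) (hF : Measurable F) :
    ∫⁻ ξ in cyl w, F ξ ∂(walkKernel κ x ω) =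
      wt ω x w * ∫⁻ ξ, F (cat w ξ) ∂(walkKernel κ (endpt x w) ω) := by
  induction w generalizing x F with
  | nil => simp [cyl_nil, wt, endpt]
  | cons b w ih =>
    rw [← lintegral_indicator (measurableSet_cyl _), lintegral_walkKernel_step _ _ _
      (hF.indicator (measurableSet_cyl _)), Finset.sum_eq_single b]
    · have h1 : ∀ ξ : ℕ → Letter d, (cyl (b :: w)).indicator F (cat [b] ξ) =
          (cyl w).indicator (fun ξ => F (cat [b] ξ)) ξ := by
        intro ξ
        by_cases hξ : ξ ∈ cyl w
        · rw [Set.indicator_of_mem hξ, Set.indicator_of_mem (cat_mem_cyl_cons.2 ⟨rfl, hξ⟩)]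
        · rw [Set.indicator_of_notMem hξ,
            Set.indicator_of_notMem fun h => hξ (cat_mem_cyl_cons.1 h).2]
      simp_rw [h1]
      rw [lintegral_indicator (measurableSet_cyl _), ih _ (fun ξ => F (cat [b] ξ)) (hF.comp (measurable_cat _)),
        wt,
        endpt,
        mul_assoc]
      simp_rw [← cat_append]
      rfl
    · intro a _ hab
      have h1 : ∀ ξ : ℕ → Letter d, (cyl (b :: w)).indicator F (cat [a] ξ) = 0 := by
        intro ξ
        rw [Set.indicator_of_notMem]
        simp [cat_mem_cyl_cons, hab]
      simp [h1]
    · simp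

/-- The strong Markov property: the integral over `T < ∞` is a sum over the words that end at the
time `T`. -/
theorem strong_markov (ω : Env d κ) (x : Site d) {T : (ℕ → Letter d) → ℕ∞} (hT : IsStop T)
    (F : (ℕ → Letter d) → ℝ≥0∞) (hF : Measurable F) :
    ∫⁻ ξ in {ξ | T ξ < ⊤}, F ξ ∂(walkKernel κ x ω) = ∑' w : stopWords T,
      wt ω x w.1 * ∫⁻ ξ, F (cat w.1 ξ) ∂(walkKernel κ (endpt x w.1) ω) := by
  rw [hT.setOf_lt_top, lintegral_iUnion (fun w => measurableSet_cyl _)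
    (pairwise_disjoint_stopWords T)]
  exact tsum_congr fun w => setLIntegral_walkKernel_cyl ω x w.1 F hF

theorem tsum_wt_stopWords_le_one (ω : Env d κ) (x : Site d) {T : (ℕ → Letter d) → ℕ∞}
    (hT : IsStop T) : ∑' w : stopWords T, wt ω x w.1 ≤ 1 := by
  have := strong_markov ω x hT 1 measurable_one
  simp only [Pi.one_apply, lintegral_const, measure_univ, mul_one, one_mul,
    Measure.restrict_apply_univ] at this
  rw [← this]
  exact prob_le_one

theorem walkKernel_shift (ω : Env d κ) (x z : Site d) :
    walkKernel κ x (fun y => ω (y + z)) = walkKernel κ (x + z) ω :=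
  measure_ext_cyl fun w => by rw [walkKernel_cyl, walkKernel_cyl, wt_shift]

theorem lintegral_walkKernel_shift {P : Measure (Env d κ)} (hstat : IsStationary P) (x : Site d)
    (F : (ℕ → Letter d) → ℝ≥0∞) (hF : Measurable F) :
    ∫⁻ ω, ∫⁻ ξ, F ξ ∂(walkKernel κ x ω) ∂P = ∫⁻ ω, ∫⁻ ξ, F ξ ∂(walkKernel κ 0 ω) ∂P := by
  rw [← lintegral_shift hstat x (fun ω => ∫⁻ ξ, F ξ ∂(walkKernel κ 0 ω)) hF.lintegral_kernel]
  simp_rw [walkKernel_shift, zero_add]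

/-! ### Transfer to the laws of the statement -/

/-- Under the enlarged law, the sequence of letters (symbol and direction of each step) has the
quenched letter law, averaged over the environment. -/
theorem lintegral_enlargedLaw (P : Measure (Env d κ)) [IsProbabilityMeasure P]
    (F : (ℕ → Letter d) → ℝ≥0∞) (hF : Measurable F) :
    ∫⁻ z, F (letters (z.1.2, z.2)) ∂(enlargedLaw P) = ∫⁻ ω, ∫⁻ ξ, F ξ ∂(walkKernel κ 0 ω) ∂P := by
  have hm : Measurable fun z : (Env d κ × (ℕ → Push d)) × (ℕ → Site d) =>
      F (letters (z.1.2, z.2)) := hF.comp (measurable_letters.comp (by fun_prop))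
  rw [enlargedLaw, Measure.lintegral_compProd hm, lintegral_prod]
  · congr 1 with ω
    rw [walkKernel, Kernel.lintegral_map _ measurable_letters _ hF,
      Kernel.lintegral_compProd _ _ _ (f := fun q => F (letters q)) (hF.comp measurable_letters)]
    rfl
  · exact (Measurable.lintegral_kernel_prod_right' (κ := (pushedTransition d κ).law 0)
      hm).aemeasurable

theorem ae_enlargedLaw (P : Measure (Env d κ)) [IsProbabilityMeasure P] :
    ∀ᵐ z ∂(enlargedLaw P), z.2 = pos 0 (letters (z.1.2, z.2)) := by
  rw [enlargedLaw]
  refine Measure.ae_compProd_of_ae_ae ?_ (Eventually.of_forall fun η => ?_)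
  · have : {z : (Env d κ × (ℕ → Push d)) × (ℕ → Site d) | z.2 = pos 0 (letters (z.1.2, z.2))} =
        ⋂ n, {z | z.2 n = pos 0 (letters (z.1.2, z.2)) n} := by
      ext z; simp [funext_iff]
    rw [this]
    refine MeasurableSet.iInter fun n => measurableSet_eq_fun (by fun_prop) ?_
    exact (measurable_pi_apply n).comp ((measurable_pos 0).comp
      (measurable_letters.comp (by fun_prop)))
  · exact (pushedTransition d κ).ae_law η 0

theorem walkKernel_dirs_cyl (ω : Env d κ) (x : Site d) (D : List (Dir d)) :
    walkKernel κ x ω ((fun ξ n => (ξ n).2) ⁻¹' cyl D) = dirWt ω x D := by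
  have hs : Measurable fun (ξ : ℕ → Letter d) (n : ℕ) => (ξ n).2 := by fun_prop
  induction D generalizing x with
  | nil => simp [cyl_nil, dirWt]
  | cons e D ih =>
    have hm : MeasurableSet ((fun (ξ : ℕ → Letter d) n => (ξ n).2) ⁻¹' cyl (e :: D)) :=
      hs (measurableSet_cyl _)
    rw [← lintegral_indicator_one hm, lintegral_walkKernel_step _ _ _ (measurable_one.indicator hm)]
    have hcat : ∀ (a : Letter d) (ξ : ℕ → Letter d),
        (fun n => (cat [a] ξ n).2) = cat [a.2] fun n => (ξ n).2 := by
      intro a ξ; funext n; cases n <;> rfl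
    have h1 : ∀ a : Letter d, ∫⁻ ξ, ((fun (ξ : ℕ → Letter d) n => (ξ n).2) ⁻¹'
        cyl (e :: D)).indicator 1 (cat [a] ξ) ∂(walkKernel κ (x + a.2.vec) ω) =
        if a.2 = e then dirWt ω (x + e.vec) D else 0 := by
      intro a
      split_ifs with ha
      · subst ha
        rw [← ih, ← lintegral_indicator_one (hs (measurableSet_cyl _))]
        congr 1 with ξ
        have hiff : cat [a] ξ ∈ ((fun (ξ : ℕ → Letter d) n => (ξ n).2) ⁻¹' cyl (a.2 :: D)) ↔
            ξ ∈ ((fun (ξ : ℕ → Letter d) n => (ξ n).2) ⁻¹' cyl D) := by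
          rw [Set.mem_preimage, hcat, cat_mem_cyl_cons]
          simp
        by_cases hξ : ξ ∈ ((fun (ξ : ℕ → Letter d) n => (ξ n).2) ⁻¹' cyl D)
        · rw [Set.indicator_of_mem hξ, Set.indicator_of_mem (hiff.2 hξ)]; rfl
        · rw [Set.indicator_of_notMem hξ, Set.indicator_of_notMem fun h => hξ (hiff.1 h)]
      · rw [lintegral_eq_zero_of_ae_eq_zero]
        refine Eventually.of_forall fun ξ => ?_
        refine Set.indicator_of_notMem ?_ _
        rw [Set.mem_preimage, hcat, cat_mem_cyl_cons]
        exact fun h => ha h.1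
    simp_rw [h1]
    rw [Fintype.sum_prod_type, dirWt, ← sum_letterProb_fst, Finset.sum_mul]
    refine Finset.sum_congr rfl fun s _ => ?_
    rw [Finset.sum_eq_single e]
    · simp
    · intro e' _ he'; simp [he']
    · simp

theorem quenchedLaw_map_dirs (ω : Env d κ) (x : Site d) :
    (quenchedLaw d κ x ω).map dirs = (walkKernel κ x ω).map fun ξ n => (ξ n).2 := by
  have hs : Measurable fun (ξ : ℕ → Letter d) (n : ℕ) => (ξ n).2 := by fun_prop
  have : IsProbabilityMeasure (quenchedLaw d κ x ω) :=
    ((quenchedTransition d κ).isMarkovKernel_law x).isProbabilityMeasure ω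
  have := Measure.isProbabilityMeasure_map (μ := quenchedLaw d κ x ω)
    (measurable_dirs (d := d)).aemeasurable
  refine measure_ext_cyl fun D => ?_
  rw [Measure.map_apply hs (measurableSet_cyl D), walkKernel_dirs_cyl,
    Measure.map_apply measurable_dirs (measurableSet_cyl D),
    dirWt_eq_prod ω x D fun _ => (0, true)]
  have h := (quenchedTransition d κ).law_dirs ω x (cat D fun _ => (0, true)) D.length
  rw [quenchedLaw]
  refine Eq.trans ?_ h
  congr 1
  ext X
  rw [Set.mem_preimage, mem_cyl]
  refine forall₂_congr fun i hi => ?_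
  rw [cat_lt _ _ _ hi]

/-- Forgetting the symbols turns the letter walk into the plain walk: a symbol is drawn
independently at each step and its two cases add up to the transition probability `ω(x, e)`. -/
theorem annealedLaw_eq (P : Measure (Env d κ)) [IsProbabilityMeasure P] (x : Site d)
    (B : Set (ℕ → Site d)) (hB : MeasurableSet B) :
    annealedLaw P x {z | z.2 ∈ B} = ∫⁻ ω, walkKernel κ x ω (pos x ⁻¹' B) ∂P := by
  have hs : Measurable fun (ξ : ℕ → Letter d) (n : ℕ) => (ξ n).2 := by fun_prop
  have hd : Measurable fun D : ℕ → Dir d => dirPos x D := by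
    rw [measurable_pi_iff]
    intro n
    unfold dirPos
    refine Measurable.const_add (Finset.measurable_fun_sum _ fun i _ => ?_) x
    exact (Measurable.of_discrete (f := Dir.vec (d := d))).comp (measurable_pi_apply i)
  have := (quenchedTransition d κ).isMarkovKernel_law x
  rw [annealedLaw, quenchedLaw]
  refine (Measure.compProd_apply (measurable_snd hB)).trans ?_
  congr 1 with ω
  have h1 : walkKernel κ x ω (pos x ⁻¹' B) =
      (walkKernel κ x ω).map (fun ξ n => (ξ n).2) ((fun D => dirPos x D) ⁻¹' B) := by
    rw [Measure.map_apply hs (hd hB)]; rfl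
  rw [h1, ← quenchedLaw_map_dirs, Measure.map_apply measurable_dirs (hd hB)]
  refine measure_congr ?_
  filter_upwards [(quenchedTransition d κ).ae_law ω x] with X hX
  change (X ∈ B) = (dirPos x (dirs X) ∈ B)
  rw [← hX]

end Kernel

end QuenchedLaw

/-! ### Decoupling distant regions of the environment -/

section Measure

variable {Ω : Type*} {m₁ m₂ m m0 : MeasurableSpace Ω}

/-- A bound on the dependence of two `σ`-algebras passes from events to functions. -/
theorem lintegral_mul_le_of_measure_inter_le {P : Measure Ω} [IsFiniteMeasure P]
    (h₁ : m₁ ≤ m0) (h₂ : m₂ ≤ m0) (c : ℝ≥0∞)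
    (h : ∀ D B, MeasurableSet[m₁] D → MeasurableSet[m₂] B → P (D ∩ B) ≤ c * (P D * P B))
    {f₁ f₂ : Ω → ℝ≥0∞} (hf₁ : Measurable[m₁] f₁) (hf₂ : Measurable[m₂] f₂) :
    ∫⁻ ω, f₁ ω * f₂ ω ∂P ≤ c * ((∫⁻ ω, f₁ ω ∂P) * ∫⁻ ω, f₂ ω ∂P) := by
  have step1 : ∀ D, MeasurableSet[m₁] D → ∫⁻ ω in D, f₂ ω ∂P ≤ c * P D * ∫⁻ ω, f₂ ω ∂P := by
    intro D hD
    have hle : (P.restrict D).trim h₂ ≤ (c * P D) • P.trim h₂ := by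
      refine Measure.le_iff.2 fun B hB => ?_
      rw [trim_measurableSet_eq h₂ hB, Measure.smul_apply, trim_measurableSet_eq h₂ hB,
        Measure.restrict_apply (h₂ _ hB), Set.inter_comm, smul_eq_mul, mul_assoc]
      exact h D B hD hB
    calc ∫⁻ ω in D, f₂ ω ∂P = ∫⁻ ω, f₂ ω ∂((P.restrict D).trim h₂) := (lintegral_trim h₂ hf₂).symm
      _ ≤ ∫⁻ ω, f₂ ω ∂((c * P D) • P.trim h₂) := lintegral_mono' hle le_rfl
      _ = c * P D * ∫⁻ ω, f₂ ω ∂P := by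
        rw [lintegral_smul_measure, lintegral_trim h₂ hf₂, smul_eq_mul]
  have hle : (P.withDensity f₂).trim h₁ ≤ (c * ∫⁻ ω, f₂ ω ∂P) • P.trim h₁ := by
    refine Measure.le_iff.2 fun D hD => ?_
    rw [trim_measurableSet_eq h₁ hD, Measure.smul_apply, trim_measurableSet_eq h₁ hD,
      withDensity_apply _ (h₁ _ hD), smul_eq_mul]
    refine (step1 D hD).trans (le_of_eq ?_)
    ring
  have hf₁' : Measurable f₁ := hf₁.mono h₁ le_rfl
  have hf₂' : Measurable f₂ := hf₂.mono h₂ le_rfl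
  calc ∫⁻ ω, f₁ ω * f₂ ω ∂P = ∫⁻ ω, f₁ ω ∂(P.withDensity f₂) := by
        rw [lintegral_withDensity_eq_lintegral_mul _ hf₂' hf₁']
        congr 1 with ω
        rw [Pi.mul_apply, mul_comm]
    _ = ∫⁻ ω, f₁ ω ∂((P.withDensity f₂).trim h₁) := (lintegral_trim h₁ hf₁).symm
    _ ≤ ∫⁻ ω, f₁ ω ∂((c * ∫⁻ ω, f₂ ω ∂P) • P.trim h₁) := lintegral_mono' hle le_rfl
    _ = c * ((∫⁻ ω, f₁ ω ∂P) * ∫⁻ ω, f₂ ω ∂P) := by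
      rw [lintegral_smul_measure, lintegral_trim h₁ hf₁, smul_eq_mul]
      ring

/-- If the conditional laws given `m` of an event charge it comparably for almost all pairs of
conditions, then they are bounded by a multiple of its probability. -/
theorem measure_inter_le_of_condExpKernel_le [StandardBorelSpace Ω] {P : Measure Ω}
    [IsProbabilityMeasure P] (hm : m ≤ m0) (c : ℝ≥0∞) {G B : Set Ω}
    (hG : P Gᶜ = 0) (hB : MeasurableSet B)
    (h : ∀ η ∈ G, ∀ η' ∈ G, condExpKernel P m η B ≤ c * condExpKernel P m η' B)
    {D : Set Ω} (hD : MeasurableSet[m] D) : P (D ∩ B) ≤ c * (P D * P B) := by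
  have key : ∀ D, MeasurableSet[m] D → P (D ∩ B) = ∫⁻ η in D, condExpKernel P m η B ∂P := by
    intro D hD
    have h1 := congrArg (fun μ => μ (D ×ˢ B)) (compProd_trim_condExpKernel (μ := P) hm)
    rw [Measure.compProd_apply_prod hD hB] at h1
    rw [restrict_trim hm _ hD, lintegral_trim hm (measurable_condExpKernel hB)] at h1
    rw [h1]
    have hdiag : @Measurable Ω (Ω × Ω) m0 (m.prod m0) Function.diag :=
      (measurable_id'' hm).prodMk measurable_id
    rw [@Measure.map_apply Ω (Ω × Ω) m0 (m.prod m0) P _ hdiag _ (hD.prod hB)]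
    rfl
  have hae : ∀ᵐ η ∂P, η ∈ G := by
    rw [ae_iff]; exact hG
  have hmeas : Measurable fun η => condExpKernel P m η B :=
    (measurable_condExpKernel hB).mono hm le_rfl
  have hbound : ∀ η ∈ G, condExpKernel P m η B ≤ c * P B := by
    intro η hη
    have h2 := key Set.univ MeasurableSet.univ
    rw [Set.univ_inter, Measure.restrict_univ] at h2
    rw [h2, ← lintegral_const_mul _ hmeas]
    calc condExpKernel P m η B = ∫⁻ _, condExpKernel P m η B ∂P := by simp
      _ ≤ _ := lintegral_mono_ae (hae.mono fun η' hη' => h η hη η' hη')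
  rw [key D hD]
  calc ∫⁻ η in D, condExpKernel P m η B ∂P ≤ ∫⁻ _ in D, c * P B ∂P :=
        lintegral_mono_ae ((ae_restrict_of_ae hae).mono hbound)
    _ = c * (P D * P B) := by rw [setLIntegral_const]; ring

end Measure

/-- The mixing condition with `A = Vᶜ` puts no constraint on the two environments compared;
integrating the bound over the second one decouples an observable of `Vᶜ` from one of `Δ`, up to
the exponential factor. -/
theorem MixingWith.lintegral_mul_le {d : ℕ} {κ : Ellipticity d} {r : ℝ}
    {S : Set (Site d) → Set (Site d) → ℝ} {P : Measure (Env d κ)} [IsProbabilityMeasure P]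
    (h : MixingWith r S P) {Δ V : Set (Site d)} (hV : V.Finite) (hΔ : Δ ⊆ V)
    (hr : ∀ x ∈ Δ, ∀ y ∈ Vᶜ, r ≤ (l1 (x - y) : ℝ)) {f₁ f₂ : Env d κ → ℝ≥0∞}
    (hf₁ : Measurable[cylinderEvents Vᶜ] f₁) (hf₂ : Measurable[cylinderEvents Δ] f₂) :
    ∫⁻ ω, f₁ ω * f₂ ω ∂P ≤
      ENNReal.ofReal (Real.exp (S Δ Vᶜ)) * ((∫⁻ ω, f₁ ω ∂P) * ∫⁻ ω, f₂ ω ∂P) := by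
  obtain ⟨G, hG, hG'⟩ := h Δ V Vᶜ hV hΔ hr subset_rfl
  refine lintegral_mul_le_of_measure_inter_le cylinderEvents_le_pi cylinderEvents_le_pi _
    (fun D B hD hB => ?_) hf₁ hf₂
  refine measure_inter_le_of_condExpKernel_le cylinderEvents_le_pi _ hG
    (cylinderEvents_le_pi _ hB) (fun η hη η' hη' => hG' η hη η' hη' ?_ B hB) hD
  simp

/-! ### Exponential sums over the lattice -/

section Norms

variable {d : ℕ}

theorem l1_neg (x : Site d) : l1 (-x) = l1 x := by simp [l1]

theorem l1_sub_comm (x y : Site d) : l1 (x - y) = l1 (y - x) := by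
  rw [← l1_neg, neg_sub]

theorem l1_add_le (x y : Site d) : l1 (x + y) ≤ l1 x + l1 y := by
  unfold l1
  rw [← Finset.sum_add_distrib]
  exact Finset.sum_le_sum fun i _ => Int.natAbs_add_le _ _

theorem l1_sub_le (x y z : Site d) : l1 (x - z) ≤ l1 (x - y) + l1 (y - z) := by
  have := l1_add_le (x - y) (y - z)
  rwa [sub_add_sub_cancel] at this

theorem natAbs_le_l1 (x : Site d) (i : Fin d) : (x i).natAbs ≤ l1 x :=
  Finset.single_le_sum (f := fun i => (x i).natAbs) (fun _ _ => Nat.zero_le _) (Finset.mem_univ i)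

theorem dotProduct_le_l1_mul_l1 (x l : Site d) : x ⬝ᵥ l ≤ (l1 x * l1 l : ℕ) := by
  unfold dotProduct
  rw [l1, Finset.sum_mul, Nat.cast_sum]
  refine Finset.sum_le_sum fun i _ => ?_
  have h2 := natAbs_le_l1 l i
  calc x i * l i ≤ |x i * l i| := le_abs_self _
    _ = ((x i).natAbs * (l i).natAbs : ℕ) := by
      rw [abs_mul, Nat.cast_mul, Int.natCast_natAbs, Int.natCast_natAbs]
    _ ≤ _ := by exact_mod_cast Nat.mul_le_mul_left _ h2

theorem abs_le_l2 (x : Site d) (i : Fin d) : |(x i : ℝ)| ≤ l2 x := by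
  unfold l2
  simpa [toSpace] using PiLp.norm_apply_le (toSpace x) i

theorem l1_le_mul_l2 (x : Site d) : (l1 x : ℝ) ≤ d * l2 x := by
  unfold l1
  rw [Nat.cast_sum]
  calc ∑ i, ((x i).natAbs : ℝ) ≤ ∑ _i : Fin d, l2 x := Finset.sum_le_sum fun i _ => by
        rw [Nat.cast_natAbs, Int.cast_abs]; exact abs_le_l2 x i
    _ = d * l2 x := by simp

theorem finite_l1_le (n : ℕ) : {x : Site d | l1 x ≤ n}.Finite := by
  refine (Set.finite_Icc (fun _ => -(n : ℤ)) (fun _ : Fin d => (n : ℤ))).subset fun x hx => ?_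
  have h : ∀ i, (x i).natAbs ≤ n := fun i => (natAbs_le_l1 x i).trans hx
  exact ⟨fun i => by have := h i; simp only; omega, fun i => by have := h i; simp only; omega⟩

theorem summable_exp_natAbs {α : ℝ} (hα : 0 < α) :
    Summable fun n : ℤ => Real.exp (-α * (n.natAbs : ℝ)) := by
  have h : Summable fun n : ℕ => Real.exp (-α * (n : ℝ)) := by
    have := Real.summable_exp_nat_mul_iff.2 (neg_lt_zero.2 hα)
    simpa [mul_comm] using this
  refine Summable.of_nat_of_neg ?_ ?_ <;> simpa using h

/-- `∑ₓ exp(-α|x|₁)` converges. -/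
theorem summable_exp_l1 {α : ℝ} (hα : 0 < α) :
    Summable fun x : Site d => Real.exp (-α * (l1 x : ℝ)) := by
  have h1 := summable_exp_natAbs hα
  refine summable_of_sum_le (c := (∑' n : ℤ, Real.exp (-α * (n.natAbs : ℝ))) ^ d)
    (fun x => (Real.exp_pos _).le) fun s => ?_
  have hsub : s ⊆ Fintype.piFinset fun i : Fin d => s.image fun x => x i := by
    intro x hx
    rw [Fintype.mem_piFinset]
    exact fun i => Finset.mem_image_of_mem (fun x => x i) hx
  calc ∑ x ∈ s, Real.exp (-α * (l1 x : ℝ))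
      ≤ ∑ x ∈ Fintype.piFinset fun i : Fin d => s.image fun x => x i,
          Real.exp (-α * (l1 x : ℝ)) :=
        Finset.sum_le_sum_of_subset_of_nonneg hsub fun _ _ _ => (Real.exp_pos _).le
    _ = ∏ i : Fin d, ∑ n ∈ s.image fun x => x i, Real.exp (-α * (n.natAbs : ℝ)) := by
        rw [Finset.prod_univ_sum]
        refine Finset.sum_congr rfl fun x _ => ?_
        rw [← Real.exp_sum, l1, Nat.cast_sum, Finset.mul_sum]
    _ ≤ ∏ _i : Fin d, ∑' n : ℤ, Real.exp (-α * (n.natAbs : ℝ)) :=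
        Finset.prod_le_prod (fun i _ => Finset.sum_nonneg fun _ _ => (Real.exp_pos _).le)
          fun i _ => h1.sum_le_tsum _ fun _ _ => (Real.exp_pos _).le
    _ = _ := by simp

/-- The sum of `exp(-g|x-y|₁)` over pairs whose distance is at least `c(|x-z|₁+L)-b` is
exponentially small in `L`, uniformly in the sets of sites. -/
theorem exists_tsum_exp_le {g c : ℝ} (hg : 0 < g) (hc : 0 < c) (b : ℝ) :
    ∃ K : ℝ, ∀ (L : ℕ) (z : Site d) (Δ A : Set (Site d)),
      (∀ x ∈ Δ, ∀ y ∈ A, c * ((l1 (x - z) : ℝ) + L) - b ≤ l1 (x - y)) →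
      ∑' p : Δ × A, Real.exp (-g * (l1 ((p.1 : Site d) - (p.2 : Site d)) : ℝ)) ≤
        K * Real.exp (-(g * c / 2) * L) := by
  have hs1 := summable_exp_l1 (d := d) (show 0 < g * c / 2 by positivity)
  have hs2 := summable_exp_l1 (d := d) (show 0 < g / 2 by positivity)
  have hs := hs1.mul_of_nonneg hs2 (fun _ => (Real.exp_pos _).le) (fun _ => (Real.exp_pos _).le)
  set F : Site d × Site d → ℝ := fun q =>
    Real.exp (-(g * c / 2) * (l1 q.1 : ℝ)) * Real.exp (-(g / 2) * (l1 q.2 : ℝ)) with hF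
  have hF0 : ∀ q, 0 ≤ F q := fun q => by positivity
  refine ⟨Real.exp (g * b / 2) * ∑' q, F q, fun L z Δ A h => ?_⟩
  set K' := Real.exp (g * b / 2) * Real.exp (-(g * c / 2) * L) with hK'
  let i : Δ × A → Site d × Site d := fun p => (p.1 - z, p.1 - p.2)
  have hi : Function.Injective i := by
    rintro ⟨⟨x, hx⟩, ⟨y, hy⟩⟩ ⟨⟨x', hx'⟩, ⟨y', hy'⟩⟩ hxy
    simp only [i, Prod.mk.injEq, sub_left_inj] at hxy
    obtain ⟨rfl, h2⟩ := hxy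
    simp only [sub_right_inj] at h2
    subst h2; rfl
  have hterm : ∀ p : Δ × A, Real.exp (-g * (l1 ((p.1 : Site d) - (p.2 : Site d)) : ℝ)) ≤
      K' * F (i p) := by
    intro p
    have hp := h p.1 p.1.2 p.2 p.2.2
    simp only [hK', hF, i]
    rw [← Real.exp_add, ← Real.exp_add, ← Real.exp_add, Real.exp_le_exp]
    have := mul_le_mul_of_nonneg_left hp (show 0 ≤ g / 2 by positivity)
    nlinarith
  have hsum : Summable fun p : Δ × A => K' * F (i p) := (hs.comp_injective hi).mul_left _
  calc _ ≤ ∑' p : Δ × A, K' * F (i p) :=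
        (Summable.of_nonneg_of_le (fun _ => (Real.exp_pos _).le) hterm hsum).tsum_le_tsum hterm hsum
    _ = K' * ∑' p : Δ × A, F (i p) := tsum_mul_left
    _ ≤ K' * ∑' q, F q := mul_le_mul_of_nonneg_left (tsum_comp_le_tsum_of_inj hs hF0 hi)
        (by positivity)
    _ = _ := by rw [hK']; ring

end Norms

/-- Under either mixing condition, the environment below the level `m` and the environment at
finitely many sites of a cone whose apex lies at height at least `L` above `m` are independent up
to a factor that tends to `1` as `L → ∞`. -/
theorem exists_decoupling {d : ℕ} (hd : 0 < d) {κ : Ellipticity d} (P : Measure (Env d κ))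
    [IsProbabilityMeasure P] {r C g : ℝ} (hr : 1 < r) (hg : 0 < g)
    (hmix : SM r C g P ∨ SMG r C g P) (l : Site d) (hl : 0 < l2 l) {ζ : ℝ} (hζ : 0 < ζ) :
    ∃ S : ℕ → ℝ, Tendsto S atTop (nhds 0) ∧ ∃ L₁ : ℕ, ∀ L ≥ L₁, ∀ (m : ℤ) (z : Site d)
      (Δ : Set (Site d)), Δ.Finite → Δ ⊆ cone l ζ z → m + L ≤ z ⬝ᵥ l →
      ∀ f₁ f₂ : Env d κ → ℝ≥0∞, Measurable[cylinderEvents {y : Site d | y ⬝ᵥ l < m}] f₁ →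
        Measurable[cylinderEvents Δ] f₂ →
        ∫⁻ ω, f₁ ω * f₂ ω ∂P ≤
          ENNReal.ofReal (Real.exp (S L)) * ((∫⁻ ω, f₁ ω ∂P) * ∫⁻ ω, f₂ ω ∂P) := by
  have hd' : (0 : ℝ) < d := by exact_mod_cast hd
  have hB : (0 : ℝ) < l1 l := by
    have h0 : l1 l ≠ 0 := by
      intro h0
      have : l = 0 := by
        funext i
        have := natAbs_le_l1 l i
        simp only [Pi.zero_apply]
        omega
      rw [this] at hl
      simp [l2, toSpace, ← Pi.zero_def] at hl
    exact_mod_cast Nat.pos_of_ne_zero h0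
  set c : ℝ := min (ζ * l2 l / d) 1 / l1 l with hc_def
  have hmin : 0 < min (ζ * l2 l / d) 1 := lt_min (by positivity) one_pos
  have hc : 0 < c := by positivity
  -- sites of the cone are far from the sites below the level `m`
  have hgeo : ∀ (L : ℕ) (m : ℤ) (z x y : Site d), x ∈ cone l ζ z → m + L ≤ z ⬝ᵥ l →
      y ⬝ᵥ l < m → c * ((l1 (x - z) : ℝ) + L) ≤ l1 (x - y) := by
    intro L m z x y hx hz hy
    have h1 : ζ * l2 l * l2 (x - z) ≤ (((x - z) ⬝ᵥ l : ℤ) : ℝ) := hx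
    have h2 := dotProduct_le_l1_mul_l1 (x - y) l
    have h3 : (x - z) ⬝ᵥ l + L ≤ (x - y) ⬝ᵥ l := by
      rw [sub_dotProduct, sub_dotProduct]; linarith
    have h4 : (((x - z) ⬝ᵥ l : ℤ) : ℝ) + L ≤ (l1 (x - y) : ℝ) * l1 l := by
      exact_mod_cast h3.trans h2
    have h5 := l1_le_mul_l2 (x - z)
    rw [hc_def, div_mul_eq_mul_div, div_le_iff₀ hB]
    have h6 : min (ζ * l2 l / d) 1 * (l1 (x - z) : ℝ) ≤ ζ * l2 l * l2 (x - z) := by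
      calc min (ζ * l2 l / d) 1 * (l1 (x - z) : ℝ) ≤ ζ * l2 l / d * (d * l2 (x - z)) :=
            mul_le_mul (min_le_left _ _) h5 (by positivity) (by positivity)
        _ = ζ * l2 l * l2 (x - z) := by field_simp
    have h7 : min (ζ * l2 l / d) 1 * (L : ℝ) ≤ L :=
      mul_le_of_le_one_left (Nat.cast_nonneg _) (min_le_right _ _)
    linarith
  obtain ⟨K, hK⟩ := exists_tsum_exp_le (d := d) hg hc ((c + 2) * r)
  refine ⟨fun L => |C| * (|K| * Real.exp (-(g * c / 2) * L)), ?_, ⌈r / c⌉₊, ?_⟩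
  · have h1 : Tendsto (fun L : ℕ => Real.exp (-(g * c / 2) * L)) atTop (nhds 0) := by
      refine Real.tendsto_exp_atBot.comp ?_
      exact (tendsto_natCast_atTop_atTop).const_mul_atTop_of_neg (by
        have : 0 < g * c / 2 := by positivity
        linarith)
    simpa using (h1.const_mul |K|).const_mul |C|
  intro L hL m z Δ hΔ hcone hz f₁ f₂ hf₁ hf₂
  obtain ⟨n, hn⟩ : ∃ n : ℕ, ∀ x ∈ Δ, c * ((l1 (x - z) : ℝ) + L) ≤ n := by
    obtain ⟨N, hN⟩ := (hΔ.image fun x => c * ((l1 (x - z) : ℝ) + L)).bddAbove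
    refine ⟨⌈N⌉₊, fun x hx => ?_⟩
    exact (hN (Set.mem_image_of_mem _ hx)).trans (Nat.le_ceil N)
  let V : Set (Site d) := {y | m ≤ y ⬝ᵥ l ∧ ∃ x ∈ Δ, l1 (x - y) ≤ n}
  have hV : V.Finite := by
    refine (hΔ.biUnion fun x _ => ((finite_l1_le n).image fun y => x - y)).subset ?_
    rintro y ⟨_, x, hx, hxy⟩
    simp only [Set.mem_iUnion]
    exact ⟨x, hx, x - y, hxy, by simp⟩
  have hΔV : Δ ⊆ V := by
    intro x hx
    refine ⟨?_, x, hx, by simp [l1]⟩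
    have h1 : ζ * l2 l * l2 (x - z) ≤ (((x - z) ⬝ᵥ l : ℤ) : ℝ) := hcone hx
    have h2 : (0 : ℝ) ≤ (((x - z) ⬝ᵥ l : ℤ) : ℝ) :=
      le_trans (by unfold l2; positivity) h1
    have h3 : 0 ≤ (x - z) ⬝ᵥ l := by exact_mod_cast h2
    rw [sub_dotProduct] at h3
    linarith
  have hfar : ∀ x ∈ Δ, ∀ y ∈ Vᶜ, c * ((l1 (x - z) : ℝ) + L) ≤ l1 (x - y) := by
    intro x hx y hy
    by_cases hym : y ⬝ᵥ l < m
    · exact hgeo L m z x y (hcone hx) hz hym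
    · have : n < l1 (x - y) := by
        by_contra hcon
        exact hy ⟨not_lt.1 hym, x, hx, not_lt.1 hcon⟩
      exact (hn x hx).trans (by exact_mod_cast this.le)
  have hrL : r ≤ c * L := by
    have : r / c ≤ L := Nat.ceil_le.1 hL
    rwa [div_le_iff₀ hc, mul_comm] at this
  have hrV : ∀ x ∈ Δ, ∀ y ∈ Vᶜ, r ≤ (l1 (x - y) : ℝ) := by
    intro x hx y hy
    have h1 := hfar x hx y hy
    have h2 : (0 : ℝ) ≤ c * l1 (x - z) := by positivity
    linarith
  have hHV : {y : Site d | y ⬝ᵥ l < m} ⊆ Vᶜ := fun y hy hyV => not_lt.2 hyV.1 hy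
  have hf₁' : Measurable[cylinderEvents Vᶜ] f₁ := hf₁.mono (cylinderEvents_mono hHV) le_rfl
  have hfin : ∀ s : ℝ, s ≤ K * Real.exp (-(g * c / 2) * L) → 0 ≤ s →
      C * s ≤ |C| * (|K| * Real.exp (-(g * c / 2) * L)) := by
    intro s hs hs0
    calc C * s ≤ |C| * s := mul_le_mul_of_nonneg_right (le_abs_self C) hs0
      _ ≤ _ := mul_le_mul_of_nonneg_left (hs.trans
        (mul_le_mul_of_nonneg_right (le_abs_self K) (Real.exp_pos _).le)) (abs_nonneg C)
  have hr0 : 0 < r := by linarith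
  rcases hmix with ⟨_, hmix⟩ | ⟨_, hmix⟩
  · refine (hmix.lintegral_mul_le hV hΔV hrV hf₁' hf₂).trans ?_
    gcongr
    refine hfin _ (hK L z _ _ ?_) (tsum_nonneg fun _ => (Real.exp_pos _).le)
    rintro x ⟨_, x₀, hx₀, hx⟩ y ⟨_, y₀, hy₀, hy⟩
    have h1 := hfar x₀ hx₀ y₀ hy₀
    have h2 : (l1 (x₀ - y₀) : ℝ) ≤ l1 (x - x₀) + l1 (x - y) + l1 (y - y₀) := by
      have ha := l1_sub_le x₀ x y₀
      have hb := l1_sub_le x y y₀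
      rw [l1_sub_comm x₀ x] at ha
      exact_mod_cast (by omega : l1 (x₀ - y₀) ≤ l1 (x - x₀) + l1 (x - y) + l1 (y - y₀))
    have h3 : (l1 (x - z) : ℝ) ≤ l1 (x - x₀) + l1 (x₀ - z) := by
      exact_mod_cast l1_sub_le x x₀ z
    have h4 : c * (l1 (x - z) : ℝ) ≤ c * (r + l1 (x₀ - z)) :=
      mul_le_mul_of_nonneg_left (by linarith) hc.le
    linarith
  · refine (hmix.lintegral_mul_le hV hΔV hrV hf₁' hf₂).trans ?_
    gcongr
    refine hfin _ (hK L z _ _ ?_) (tsum_nonneg fun _ => (Real.exp_pos _).le)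
    intro x hx y hy
    have h1 := hfar x hx y hy
    have h2 : 0 ≤ (c + 2) * r := by positivity
    linarith

/-! ### Waiting for the next candidate in a fixed environment -/

section Candidates

variable {d : ℕ}

/-- The level of the walk from `0` at time `n`. -/
def lev (l : Site d) (ξ : ℕ → Letter d) (n : ℕ) : ℤ := pos 0 ξ n ⬝ᵥ l

/-- The exponential of a level, as an extended nonnegative number. -/
noncomputable def ex (θ : ℝ) (k : ℤ) : ℝ≥0∞ := ENNReal.ofReal (Real.exp (θ * k))

theorem ex_mono {θ : ℝ} (hθ : 0 ≤ θ) {j k : ℤ} (h : j ≤ k) : ex θ j ≤ ex θ k := by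
  unfold ex
  gcongr

theorem ex_add (θ : ℝ) (j k : ℤ) : ex θ (j + k) = ex θ j * ex θ k := by
  unfold ex
  rw [← ENNReal.ofReal_mul (Real.exp_pos _).le, ← Real.exp_add]
  push_cast
  ring_nf

@[simp] theorem ex_zero (θ : ℝ) : ex θ 0 = 1 := by simp [ex]

theorem one_le_ex {θ : ℝ} (hθ : 0 ≤ θ) {k : ℤ} (h : 0 ≤ k) : 1 ≤ ex θ k := by
  rw [← ex_zero θ]; exact ex_mono hθ h

/-- The candidate times, as a function of the letters. -/
def cand (l : Site d) (L : ℕ) (ξ : ℕ → Letter d) : Set ℕ :=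
  candidateTimes l L (fun n => (ξ n).1) (pos 0 ξ)

theorem mem_cand_of_congr {l : Site d} {L n : ℕ} {ξ ξ' : ℕ → Letter d} (h : ∀ i < n, ξ i = ξ' i)
    (hn : n ∈ cand l L ξ) : n ∈ cand l L ξ' := by
  obtain ⟨h1, h2, h3⟩ := hn
  refine ⟨h1, fun j hj => ?_, ?_⟩
  · rw [← pos_congr fun i hi => h i (by omega), ← pos_congr fun i hi => h i (by omega)]
    exact h2 j hj
  · rw [← h3]
    congr 1
    funext j
    exact congrArg Prod.fst (h (n - L + j) (by omega)).symm

/-- No candidate occurs strictly between the times `n₀` and `n`. -/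
def noCand (l : Site d) (L n₀ n : ℕ) (ξ : ℕ → Letter d) : Prop :=
  ∀ k, n₀ < k → k < n → k ∉ cand l L ξ

theorem noCand_of_congr {l : Site d} {L n₀ n : ℕ} {ξ ξ' : ℕ → Letter d}
    (h : ∀ i < n, ξ i = ξ' i) (hn : noCand l L n₀ n ξ) : noCand l L n₀ n ξ' := by
  intro k h1 h2 h3
  exact hn k h1 h2 (mem_cand_of_congr (fun i hi => (h i (by omega)).symm) h3)

open Classical in
/-- The largest exponential of a level up to the time `N` or the first candidate after `n₀`. -/
noncomputable def supUntilCand (θ : ℝ) (l : Site d) (L n₀ N : ℕ) (ξ : ℕ → Letter d) : ℝ≥0∞ :=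
  ⨆ n, if n ≤ N ∧ noCand l L n₀ n ξ then ex θ (lev l ξ n) else 0

/-- The largest exponential of a level along a word. -/
noncomputable def wordMax (θ : ℝ) (l : Site d) (w : List (Letter d)) : ℝ≥0∞ :=
  ⨆ n, ⨆ _ : n ≤ w.length, ex θ (endpt 0 (w.take n) ⬝ᵥ l)

theorem pos_cat_eq_endpt_take (x : Site d) (w : List (Letter d)) (ξ : ℕ → Letter d) {n : ℕ}
    (h : n ≤ w.length) : pos x (cat w ξ) n = endpt x (w.take n) := by
  have h1 := pos_cat_length x (w.take n) (cat (w.drop n) ξ)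
  rwa [← cat_append, List.take_append_drop, List.length_take, min_eq_left h] at h1

theorem lev_cat {l : Site d} {w : List (Letter d)} (ξ : ℕ → Letter d) {n : ℕ}
    (h : n ≤ w.length) : lev l (cat w ξ) n = endpt 0 (w.take n) ⬝ᵥ l := by
  rw [lev, pos_cat_eq_endpt_take _ _ _ h]

theorem ex_lev_le_wordMax (θ : ℝ) (l : Site d) (w : List (Letter d)) (ξ : ℕ → Letter d) {n : ℕ}
    (h : n ≤ w.length) : ex θ (lev l (cat w ξ) n) ≤ wordMax θ l w := by
  rw [lev_cat ξ h]
  exact le_iSup₂_of_le n h le_rfl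

theorem measurable_lev (l : Site d) (n : ℕ) : Measurable fun ξ : ℕ → Letter d => lev l ξ n :=
  (Measurable.of_discrete (f := fun x : Site d => x ⬝ᵥ l)).comp
    ((measurable_pi_apply n).comp (measurable_pos 0))

theorem measurable_ex_lev (θ : ℝ) (l : Site d) (n : ℕ) :
    Measurable fun ξ : ℕ → Letter d => ex θ (lev l ξ n) :=
  (Measurable.of_discrete (f := ex θ)).comp (measurable_lev l n)

theorem measurable_supUntilCand (θ : ℝ) (l : Site d) (L n₀ N : ℕ) :
    Measurable (supUntilCand θ l L n₀ N) := by
  classical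
  refine Measurable.iSup fun n => Measurable.ite ?_ (measurable_ex_lev θ l n) measurable_const
  exact measurableSet_of_prefix _ n fun ξ ξ' h hξ => ⟨hξ.1, noCand_of_congr h hξ.2⟩

/-- The endpoint of the word is at a strictly higher level than all the earlier sites. -/
def IsRecord (l : Site d) (w : List (Letter d)) : Prop :=
  ∀ n < w.length, endpt 0 (w.take n) ⬝ᵥ l < endpt 0 w ⬝ᵥ l

/-- The word in which the symbols are those of `ε̄^{(L)}` and the walk obeys them. -/
def barWord (l : Site d) (L : ℕ) : List (Letter d) := (barSeqL l L).map fun e => (some e, e)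

theorem length_barSeq (l : Site d) : (barSeq l).length = l1 l := by
  simp only [barSeq, List.length_flatMap, List.length_replicate, l1]
  exact (Fin.sum_univ_def _).symm

theorem length_barSeqL {l : Site d} {L : ℕ} (h : l1 l ∣ L) : (barSeqL l L).length = L := by
  simp only [barSeqL, List.length_flatten, List.map_replicate, List.sum_replicate, length_barSeq,
    smul_eq_mul]
  exact Nat.div_mul_cancel h

theorem length_barWord {l : Site d} {L : ℕ} (h : l1 l ∣ L) : (barWord l L).length = L := by
  rw [barWord, List.length_map, length_barSeqL h]

theorem mem_cand_of_isRecord {l : Site d} {L : ℕ} (h : l1 l ∣ L) {w : List (Letter d)}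
    (hw : IsRecord l w) (ξ : ℕ → Letter d) :
    w.length + L ∈ cand l L (cat (w ++ barWord l L) ξ) := by
  refine ⟨by omega, fun j hj => ?_, ?_⟩
  · rw [Nat.add_sub_cancel] at hj ⊢
    rw [cat_append, pos_cat_eq_endpt_take _ _ _ hj.le, pos_cat_length]
    exact hw j hj
  · apply List.ext_getElem
    · simp [length_barSeqL h]
    · intro i h1 h2
      simp only [List.getElem_ofFn, Nat.add_sub_cancel, cat_append, cat_add]
      rw [cat_lt _ _ _ (by simpa [barWord] using h2)]
      simp [barWord]

theorem abs_vec_dotProduct_le (e : Dir d) (l : Site d) : |e.vec ⬝ᵥ l| ≤ l1 l := by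
  have h : e.vec ⬝ᵥ l = if e.2 then l e.1 else -l e.1 := by
    unfold Dir.vec
    split_ifs <;> simp
  have h2 : |e.vec ⬝ᵥ l| = (l e.1).natAbs := by
    rw [h, Int.natCast_natAbs]
    split_ifs <;> simp
  rw [h2]
  exact_mod_cast natAbs_le_l1 l e.1

theorem endpt_concat (x : Site d) (w : List (Letter d)) (a : Letter d) :
    endpt x (w ++ [a]) = endpt x w + a.2.vec := by
  rw [endpt_append]; rfl

theorem wordMax_concat_le {θ : ℝ} (hθ : 0 ≤ θ) (l : Site d) (w : List (Letter d)) (a : Letter d) :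
    wordMax θ l (w ++ [a]) ≤ ex θ (l1 l) * wordMax θ l w := by
  refine iSup₂_le fun n hn => ?_
  rcases Nat.lt_or_ge w.length n with h | h
  · have hn' : n = w.length + 1 := by simp at hn; omega
    subst hn'
    rw [List.take_of_length_le (by simp), endpt_concat, add_dotProduct, add_comm, ex_add]
    refine mul_le_mul' (ex_mono hθ ((le_abs_self _).trans (abs_vec_dotProduct_le _ _))) ?_
    exact le_iSup₂_of_le w.length le_rfl (by rw [List.take_length])
  · rw [List.take_append_of_le_length h]
    refine le_trans (le_iSup₂_of_le n h le_rfl) (le_mul_of_one_le_left' ?_)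
    exact one_le_ex hθ (by positivity)

theorem wordMax_concat_of_not_isRecord {θ : ℝ} (hθ : 0 ≤ θ) {l : Site d} {w : List (Letter d)}
    {a : Letter d} (h : ¬ IsRecord l (w ++ [a])) : wordMax θ l (w ++ [a]) ≤ wordMax θ l w := by
  unfold IsRecord at h
  push Not at h
  obtain ⟨m, hm, hle⟩ := h
  have hm' : m ≤ w.length := by simp at hm; omega
  rw [List.take_append_of_le_length hm'] at hle
  refine iSup₂_le fun n hn => ?_
  rcases Nat.lt_or_ge w.length n with h | h
  · have hn' : n = w.length + 1 := by simp at hn; omega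
    subst hn'
    rw [List.take_of_length_le (by simp)]
    exact (ex_mono hθ hle).trans (le_iSup₂_of_le m hm' le_rfl)
  · rw [List.take_append_of_le_length h]
    exact le_iSup₂_of_le n h le_rfl

theorem supUntilCand_le_wordMax {θ : ℝ} {l : Site d} {L n₀ N : ℕ} {w : List (Letter d)}
    {ξ : ℕ → Letter d} (h : ∀ n ≤ N, noCand l L n₀ n (cat w ξ) → n ≤ w.length) :
    supUntilCand θ l L n₀ N (cat w ξ) ≤ wordMax θ l w := by
  refine iSup_le fun n => ?_
  split_ifs with hn
  · exact ex_lev_le_wordMax θ l w ξ (h n hn.1 hn.2)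
  · exact zero_le

/-- The weight of a trial of which `j` symbols have been matched. -/
noncomputable def trialWeight (c κ : ℝ) (b L j : ℕ) : ℝ := 1 + 8 * b * c * (1 - κ ^ (L - j))

theorem one_le_trialWeight {c κ : ℝ} (hc : 0 ≤ c) (hκ : 0 ≤ κ) (hκ' : κ ≤ 1) (b L j : ℕ) :
    1 ≤ trialWeight c κ b L j := by
  have h := pow_le_one₀ hκ hκ' (n := L - j)
  have : 0 ≤ 8 * (b : ℝ) * c * (1 - κ ^ (L - j)) :=
    mul_nonneg (by positivity) (by linarith)
  unfold trialWeight
  linarith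

/-- The weights make the exponential of the running maximum a supermartingale: a further symbol is
matched with probability `κ`, otherwise a new trial starts at the next record. -/
theorem trialWeight_step {c κ : ℝ} (hc : 0 ≤ c) (hκ : 0 ≤ κ) (hκ' : κ ≤ 1 / 4) {b L j : ℕ}
    (hcb : 8 * b * c ≤ 1) (hj : j < L) :
    κ * (Real.exp (c * κ ^ L * b) * trialWeight c κ b L (j + 1)) +
      (1 - κ) * (Real.exp (c * κ ^ L * b) * trialWeight c κ b L 0) ≤ trialWeight c κ b L j := by
  have h1 : κ ^ (L - j) = κ * κ ^ (L - (j + 1)) := by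
    rw [← pow_succ']; congr 1; omega
  have hs0 : 0 ≤ κ ^ (L - (j + 1)) := by positivity
  have hs1 : κ * κ ^ (L - (j + 1)) ≤ 1 := by
    rw [← h1]; exact pow_le_one₀ hκ (by linarith)
  have ht0 : 0 ≤ κ ^ L := by positivity
  have ht1 : κ ^ L ≤ 1 := pow_le_one₀ hκ (by linarith)
  have hcb0 : 0 ≤ c * b := by positivity
  unfold trialWeight
  rw [Nat.sub_zero, h1]
  set t := κ ^ L
  set s := κ ^ (L - (j + 1))
  set D := 8 * (b : ℝ) * c with hD
  have hx0 : 0 ≤ c * t * b := by positivity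
  have hx1 : c * t * b ≤ 1 := by nlinarith
  have hu : Real.exp (c * t * b) ≤ 1 + 2 * (c * t * b) := by
    have h := Real.abs_exp_sub_one_le (x := c * t * b) (by rwa [abs_of_nonneg hx0])
    rw [abs_of_nonneg hx0] at h
    linarith [le_abs_self (Real.exp (c * t * b) - 1)]
  have hD0 : 0 ≤ D := by positivity
  have hW0 : 0 ≤ 1 + D - D * (κ * s) - D * (1 - κ) * t := by
    have h2 : D * (1 - κ) * t ≤ D * 1 := by
      rw [mul_assoc]
      exact mul_le_mul_of_nonneg_left (by nlinarith) hD0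
    have h3 : D * (κ * s) ≤ 1 := by nlinarith [mul_nonneg hκ hs0]
    linarith
  calc κ * (Real.exp (c * t * b) * (1 + D * (1 - s))) +
        (1 - κ) * (Real.exp (c * t * b) * (1 + D * (1 - t)))
      = Real.exp (c * t * b) * (1 + D - D * (κ * s) - D * (1 - κ) * t) := by ring
    _ ≤ (1 + 2 * (c * t * b)) * (1 + D - D * (κ * s) - D * (1 - κ) * t) :=
        mul_le_mul_of_nonneg_right hu hW0
    _ ≤ 1 + D * (1 - κ * s) := by
        have e1 : 2 * (c * t * b) = D / 4 * t := by rw [hD]; ring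
        rw [e1]
        have h4 : D / 4 * t * (1 + D - D * (κ * s) - D * (1 - κ) * t) ≤ D / 4 * t * 2 := by
          refine mul_le_mul_of_nonneg_left ?_ (by positivity)
          have : 0 ≤ D * (κ * s) := by positivity
          have : 0 ≤ D * (1 - κ) * t := mul_nonneg (mul_nonneg hD0 (by linarith)) ht0
          linarith
        have h5 : D / 4 * t * 2 ≤ D * (1 - κ) * t := by
          have : 0 ≤ D * t := by positivity
          nlinarith
        nlinarith

variable [NeZero d] {κ : Ellipticity d}

theorem kappa_le_quarter (κ : Ellipticity d) : (κ : ℝ) ≤ 1 / 4 := by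
  refine κ.2.2.trans ?_
  have : (1 : ℝ) ≤ d := by exact_mod_cast NeZero.one_le
  exact one_div_le_one_div_of_le (by norm_num) (by linarith)

/-- Bounds for the walk with past `w`, in general and in the middle of a trial. -/
theorem lintegral_supUntilCand_le_aux (ω : Env d κ) {l : Site d} {L : ℕ} (hL : 0 < L)
    (hdvd : l1 l ∣ L) {c : ℝ} (hc : 0 ≤ c) (hcb : 8 * l1 l * c ≤ 1) (n₀ N : ℕ) :
    ∀ w : List (Letter d), n₀ ≤ w.length →
      (∫⁻ ξ, supUntilCand (c * (κ : ℝ) ^ L) l L n₀ (w.length + N) (cat w ξ)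
          ∂(walkKernel κ (endpt 0 w) ω) ≤
        ENNReal.ofReal (Real.exp (c * (κ : ℝ) ^ L * l1 l) * trialWeight c κ (l1 l) L 0) *
          wordMax (c * (κ : ℝ) ^ L) l w) ∧
      ∀ (v : List (Letter d)) (j : ℕ), j ≤ L → n₀ ≤ v.length → IsRecord l v →
        w = v ++ (barWord l L).take j →
        ∫⁻ ξ, supUntilCand (c * (κ : ℝ) ^ L) l L n₀ (w.length + N) (cat w ξ)
          ∂(walkKernel κ (endpt 0 w) ω) ≤
        ENNReal.ofReal (trialWeight c κ (l1 l) L j) * wordMax (c * (κ : ℝ) ^ L) l w := by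
  have hκ0 : (0 : ℝ) < κ := κ.2.1
  have hκ4 := kappa_le_quarter κ
  set θ := c * (κ : ℝ) ^ L with hθ
  have hθ0 : 0 ≤ θ := by positivity
  have hψ : ∀ j, 1 ≤ trialWeight c κ (l1 l) L j :=
    fun j => one_le_trialWeight hc hκ0.le (by linarith) _ _ _
  have hψ0 : ∀ j, 0 ≤ trialWeight c κ (l1 l) L j := fun j => by linarith [hψ j]
  have hu : 1 ≤ Real.exp (θ * l1 l) := Real.one_le_exp (by positivity)
  -- a bound by the maximum along the word is good enough
  have hconst : ∀ (w : List (Letter d)) (F : (ℕ → Letter d) → ℝ≥0∞) (C : ℝ), 1 ≤ C →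
      (∀ ξ, F ξ ≤ wordMax θ l w) → ∫⁻ ξ, F ξ ∂(walkKernel κ (endpt 0 w) ω) ≤
        ENNReal.ofReal C * wordMax θ l w := by
    intro w F C hC hF
    calc ∫⁻ ξ, F ξ ∂(walkKernel κ (endpt 0 w) ω)
        ≤ ∫⁻ _, wordMax θ l w ∂(walkKernel κ (endpt 0 w) ω) := lintegral_mono hF
      _ = wordMax θ l w := by simp
      _ ≤ _ := le_mul_of_one_le_left' (by simpa using ENNReal.ofReal_le_ofReal hC)
  have hful : ∀ (N : ℕ) (w v : List (Letter d)), n₀ ≤ v.length → IsRecord l v →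
      w = v ++ (barWord l L).take L → ∫⁻ ξ, supUntilCand θ l L n₀ (w.length + N) (cat w ξ)
          ∂(walkKernel κ (endpt 0 w) ω) ≤
        ENNReal.ofReal (trialWeight c κ (l1 l) L L) * wordMax θ l w := by
    intro N w v hv hrec hw
    refine hconst w _ _ (hψ L) fun ξ => supUntilCand_le_wordMax fun n _ hn => ?_
    rw [List.take_of_length_le (length_barWord hdvd).le] at hw
    by_contra hcon
    have hlen : w.length = v.length + L := by rw [hw, List.length_append, length_barWord hdvd]
    refine hn (v.length + L) (by omega) (by omega) ?_
    rw [hw]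
    exact mem_cand_of_isRecord hdvd hrec ξ
  induction N with
  | zero =>
    intro w hw
    refine ⟨hconst w _ _ ?_ fun ξ => supUntilCand_le_wordMax fun n hn _ => by omega,
      fun v j hj hv hrec hwv =>
        hconst w _ _ (hψ j) fun ξ => supUntilCand_le_wordMax fun n hn _ => by omega⟩
    have := hψ 0
    nlinarith
  | succ N ih =>
    intro w hw
    have hstep : ∫⁻ ξ, supUntilCand θ l L n₀ (w.length + (N + 1)) (cat w ξ)
          ∂(walkKernel κ (endpt 0 w) ω) = ∑ a, letterProb κ (ω (endpt 0 w)).1 a *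
        ∫⁻ ξ, supUntilCand θ l L n₀ ((w ++ [a]).length + N) (cat (w ++ [a]) ξ)
          ∂(walkKernel κ (endpt 0 (w ++ [a])) ω) := by
      rw [lintegral_walkKernel_step _ _
        (fun ξ => supUntilCand θ l L n₀ (w.length + (N + 1)) (cat w ξ))
          ((measurable_supUntilCand θ l L n₀ _).comp (measurable_cat w))]
      refine Finset.sum_congr rfl fun a _ => ?_
      rw [endpt_concat, show (w ++ [a]).length + N = w.length + (N + 1) by simp; omega]
      simp_rw [cat_append]
    -- whatever the next letter, the walk is at worst between two trials
    have hany : ∀ a, ∫⁻ ξ, supUntilCand θ l L n₀ ((w ++ [a]).length + N) (cat (w ++ [a]) ξ)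
          ∂(walkKernel κ (endpt 0 (w ++ [a])) ω) ≤
        ENNReal.ofReal (Real.exp (θ * l1 l) * trialWeight c κ (l1 l) L 0) * wordMax θ l w := by
      intro a
      have hlen : n₀ ≤ (w ++ [a]).length := by simp; omega
      obtain ⟨h1, h2⟩ := ih (w ++ [a]) hlen
      by_cases hrec : IsRecord l (w ++ [a])
      · refine (h2 (w ++ [a]) 0 (Nat.zero_le _) hlen hrec (by simp)).trans ?_
        rw [ENNReal.ofReal_mul (Real.exp_pos _).le, mul_comm (ENNReal.ofReal (Real.exp _)),
          mul_assoc]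
        refine mul_le_mul' le_rfl ((wordMax_concat_le hθ0 l w a).trans (le_of_eq ?_))
        simp [ex]
      · exact h1.trans (mul_le_mul' le_rfl (wordMax_concat_of_not_isRecord hθ0 hrec))
    refine ⟨?_, fun v j hj hv hrec hwv => ?_⟩
    · rw [hstep]
      calc _ ≤ ∑ a, letterProb κ (ω (endpt 0 w)).1 a *
            (ENNReal.ofReal (Real.exp (θ * l1 l) * trialWeight c κ (l1 l) L 0) *
              wordMax θ l w) := Finset.sum_le_sum fun a _ => mul_le_mul' le_rfl (hany a)
        _ = _ := by rw [← Finset.sum_mul, sum_letterProb, one_mul]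
    · rcases hj.lt_or_eq with hjL | rfl
      swap
      · exact hful _ w v hv hrec hwv
      have hjl : j < (barWord l L).length := by rwa [length_barWord hdvd]
      obtain ⟨e, he⟩ : ∃ e : Dir d, (barWord l L)[j] = (some e, e) := by
        simp [barWord]
      have hnext : ∫⁻ ξ, supUntilCand θ l L n₀ ((w ++ [(some e, e)]).length + N)
            (cat (w ++ [(some e, e)]) ξ) ∂(walkKernel κ (endpt 0 (w ++ [(some e, e)])) ω) ≤
          ENNReal.ofReal (Real.exp (θ * l1 l) * trialWeight c κ (l1 l) L (j + 1)) *
            wordMax θ l w := by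
        have hlen : n₀ ≤ (w ++ [((some e, e) : Letter d)]).length := by simp; omega
        refine ((ih _ hlen).2 v (j + 1) hjL hv hrec ?_).trans ?_
        · rw [hwv, List.append_assoc, List.take_add_one, List.getElem?_eq_getElem hjl, he]
          rfl
        · rw [ENNReal.ofReal_mul (Real.exp_pos _).le, mul_comm (ENNReal.ofReal (Real.exp _)),
            mul_assoc]
          refine mul_le_mul' le_rfl ((wordMax_concat_le hθ0 l w _).trans (le_of_eq ?_))
          simp [ex]
      have hsum := sum_letterProb (ω (endpt 0 w))
      rw [← Finset.add_sum_erase _ _ (Finset.mem_univ ((some e, e) : Letter d)),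
        letterProb_self] at hsum
      have hrest : ∑ a ∈ Finset.univ.erase ((some e, e) : Letter d),
          letterProb κ (ω (endpt 0 w)).1 a = ENNReal.ofReal (1 - κ) := by
        have h1 : ENNReal.ofReal (κ : ℝ) + ENNReal.ofReal (1 - κ) = 1 := by
          rw [← ENNReal.ofReal_add hκ0.le (by linarith)]; simp
        rw [← h1] at hsum
        exact (ENNReal.add_right_inj ENNReal.ofReal_ne_top).1 hsum
      rw [hstep, ← Finset.add_sum_erase _ _ (Finset.mem_univ ((some e, e) : Letter d)),
        letterProb_self]
      calc _ ≤ ENNReal.ofReal κ * (ENNReal.ofReal (Real.exp (θ * l1 l) *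
                trialWeight c κ (l1 l) L (j + 1)) * wordMax θ l w) +
            ∑ a ∈ Finset.univ.erase ((some e, e) : Letter d), letterProb κ (ω (endpt 0 w)).1 a *
              (ENNReal.ofReal (Real.exp (θ * l1 l) * trialWeight c κ (l1 l) L 0) *
                wordMax θ l w) :=
            add_le_add (mul_le_mul' le_rfl hnext)
              (Finset.sum_le_sum fun a _ => mul_le_mul' le_rfl (hany a))
        _ = ENNReal.ofReal (κ * (Real.exp (θ * l1 l) * trialWeight c κ (l1 l) L (j + 1)) +
              (1 - κ) * (Real.exp (θ * l1 l) * trialWeight c κ (l1 l) L 0)) * wordMax θ l w := by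
            rw [← Finset.sum_mul, hrest, ENNReal.ofReal_add, ENNReal.ofReal_mul hκ0.le,
              ENNReal.ofReal_mul (p := 1 - (κ : ℝ)) (by linarith)]
            · ring
            · exact mul_nonneg hκ0.le (mul_nonneg (Real.exp_pos _).le (hψ0 _))
            · exact mul_nonneg (by linarith) (mul_nonneg (Real.exp_pos _).le (hψ0 _))
        _ ≤ _ := mul_le_mul' (ENNReal.ofReal_le_ofReal
            (trialWeight_step hc hκ0.le hκ4 hcb hjL)) le_rfl

open Classical in
/-- The quenched expectation of `exp(cκ^L X_n·l)`, maximized over the times `n` up to the first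
candidate after the past `w`, exceeds the maximum over the past by at most a factor which is close
to `1` when `c` is small, uniformly in `L`. -/
theorem lintegral_sup_until_cand_le (ω : Env d κ) {l : Site d} {L : ℕ} (hL : 0 < L)
    (hdvd : l1 l ∣ L) {c : ℝ} (hc : 0 ≤ c) (hcb : 8 * l1 l * c ≤ 1) (w : List (Letter d)) :
    ∫⁻ ξ, ⨆ n, (if noCand l L w.length n (cat w ξ) then
        ex (c * (κ : ℝ) ^ L) (lev l (cat w ξ) n) else 0) ∂(walkKernel κ (endpt 0 w) ω) ≤
      ENNReal.ofReal (Real.exp (c * l1 l) * (1 + 8 * l1 l * c)) *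
        wordMax (c * (κ : ℝ) ^ L) l w := by
  have hκ0 : (0 : ℝ) < κ := κ.2.1
  have hκ4 := kappa_le_quarter κ
  have hsup : ∀ ξ : ℕ → Letter d, (⨆ n, (if noCand l L w.length n (cat w ξ) then
      ex (c * (κ : ℝ) ^ L) (lev l (cat w ξ) n) else 0)) =
      ⨆ N, supUntilCand (c * (κ : ℝ) ^ L) l L w.length (w.length + N) (cat w ξ) := by
    intro ξ
    apply le_antisymm
    · refine iSup_le fun n => le_iSup_of_le n (le_iSup_of_le n ?_)
      split_ifs with h1 h2 h2
      · exact le_rfl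
      · exact absurd ⟨by omega, h1⟩ h2
      · exact zero_le
      · exact zero_le
    · refine iSup_le fun N => iSup_le fun n => le_iSup_of_le n ?_
      split_ifs with h1 h2 h2
      · exact le_rfl
      · exact absurd h1.2 h2
      · exact zero_le
      · exact zero_le
  simp_rw [hsup]
  rw [lintegral_iSup]
  · refine iSup_le fun N =>
      ((lintegral_supUntilCand_le_aux ω hL hdvd hc hcb w.length N w le_rfl).1).trans ?_
    gcongr
    · have := one_le_trialWeight hc hκ0.le (by linarith) (l1 l) L 0
      linarith
    · have h1 : (κ : ℝ) ^ L ≤ 1 := pow_le_one₀ hκ0.le (by linarith)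
      have : c * (κ : ℝ) ^ L ≤ c * 1 := mul_le_mul_of_nonneg_left h1 hc
      linarith
    · unfold trialWeight
      have : 0 ≤ 8 * (l1 l : ℝ) * c * (κ : ℝ) ^ (L - 0) := by positivity
      linarith
  · exact fun N => (measurable_supUntilCand _ _ _ _ _).comp (measurable_cat w)
  · intro N N' hNN' ξ
    refine iSup_mono fun n => ?_
    split_ifs with h1 h2 h2
    · exact le_rfl
    · exact absurd ⟨by omega, h1.2⟩ h2
    · exact zero_le
    · exact zero_le

end Candidates

/-! ### First times -/

section FirstTime

theorem firstTime_le {s : Set ℕ} {n : ℕ} (h : n ∈ s) : firstTime s ≤ n :=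
  sInf_le ⟨n, h, rfl⟩

theorem le_firstTime {s : Set ℕ} {t : ℕ∞} (h : ∀ n ∈ s, t ≤ (n : ℕ∞)) : t ≤ firstTime s := by
  refine le_sInf ?_
  rintro _ ⟨n, hn, rfl⟩
  exact h n hn

theorem firstTime_eq_coe {s : Set ℕ} {n : ℕ} : firstTime s = n ↔ n ∈ s ∧ ∀ k < n, k ∉ s := by
  constructor
  · intro h
    have hlt : ∀ k < n, k ∉ s := by
      intro k hk hks
      have := firstTime_le hks
      rw [h, Nat.cast_le] at this
      omega
    refine ⟨?_, hlt⟩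
    by_contra hn
    have : ((n + 1 : ℕ) : ℕ∞) ≤ firstTime s := by
      refine le_firstTime fun k hk => ?_
      have h1 : ¬ k < n := fun h => hlt k h hk
      have h2 : k ≠ n := fun h => hn (h ▸ hk)
      exact_mod_cast (by omega : n + 1 ≤ k)
    rw [h, Nat.cast_le] at this
    omega
  · rintro ⟨h1, h2⟩
    refine le_antisymm (firstTime_le h1) (le_firstTime fun k hk => ?_)
    have : ¬ k < n := fun h => h2 k h hk
    exact_mod_cast (by omega : n ≤ k)

theorem firstTime_eq_top {s : Set ℕ} : firstTime s = ⊤ ↔ s = ∅ := by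
  constructor
  · intro h
    by_contra hne
    obtain ⟨n, hn⟩ := Set.nonempty_iff_ne_empty.2 hne
    have := firstTime_le hn
    rw [h] at this
    exact absurd this (not_le.2 (ENat.natCast_lt_top n))
  · rintro rfl
    simp [firstTime]

theorem exists_firstTime_eq {s : Set ℕ} (h : s.Nonempty) : ∃ n ∈ s, firstTime s = n := by
  have : firstTime s ≠ ⊤ := by
    rw [Ne, firstTime_eq_top]; exact h.ne_empty
  obtain ⟨n, hn⟩ := ENat.ne_top_iff_exists.1 this
  exact ⟨n, (firstTime_eq_coe.1 hn.symm).1, hn.symm⟩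

/-- The first time of a random set of times is a stopping time if membership of `n` depends on the
first `n` letters. -/
theorem isStop_firstTime {A : Type*} (s : (ℕ → A) → Set ℕ)
    (h : ∀ (n : ℕ) (ξ ξ' : ℕ → A), (∀ i < n, ξ i = ξ' i) → n ∈ s ξ → n ∈ s ξ') :
    IsStop fun ξ => firstTime (s ξ) := by
  intro n ξ ξ' hξ hn
  rw [firstTime_eq_coe] at hn ⊢
  refine ⟨h n ξ ξ' hξ hn.1, fun k hk hks => hn.2 k hk ?_⟩
  exact h k ξ' ξ (fun i hi => (hξ i (by omega)).symm) hks

end FirstTime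

/-! ### Coordinates adapted to the boxes -/

section Coordinates

variable {d : ℕ}

theorem toSpace_add (x y : Site d) : toSpace (x + y) = toSpace x + toSpace y := by
  ext i; simp [toSpace]

theorem toSpace_sub (x y : Site d) : toSpace (x - y) = toSpace x - toSpace y := by
  ext i; simp [toSpace]

theorem toSpace_zero : toSpace (0 : Site d) = 0 := by
  ext i; simp [toSpace]

theorem l2_nonneg (x : Site d) : 0 ≤ l2 x := norm_nonneg _

theorem l2_add_le (x y : Site d) : l2 (x + y) ≤ l2 x + l2 y := by
  unfold l2; rw [toSpace_add]; exact norm_add_le _ _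

theorem norm_le_sum_abs (u : Space d) : ‖u‖ ≤ ∑ i, |u i| := by
  rw [EuclideanSpace.norm_eq]
  refine Real.sqrt_le_iff.2 ⟨Finset.sum_nonneg fun i _ => abs_nonneg _, ?_⟩
  simp only [Real.norm_eq_abs]
  exact Finset.sum_sq_le_sq_sum_of_nonneg fun i _ => abs_nonneg _

theorem l2_le_l1 (x : Site d) : l2 x ≤ l1 x := by
  refine (norm_le_sum_abs _).trans (le_of_eq ?_)
  unfold l1
  rw [Nat.cast_sum]
  refine Finset.sum_congr rfl fun i _ => ?_
  rw [Nat.cast_natAbs, Int.cast_abs]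
  rfl

theorem inner_toSpace (x y : Site d) : ⟪toSpace x, toSpace y⟫ = ((x ⬝ᵥ y : ℤ) : ℝ) := by
  simp [toSpace, PiLp.inner_apply, dotProduct, mul_comm]

/-- The path leaves the box of size `M` around `0`, and does so through the positive boundary. -/
def goodExit (R : Space d ≃ₗᵢ[ℝ] Space d) (ℓ : Space d) (ρ M : ℝ) : Set (ℕ → Site d) :=
  {X | exitTime (box R M (ρ * M) 0) X ≠ ⊤ ∧
    X (exitTime (box R M (ρ * M) 0) X).toNat ∈ boxPosBoundary R ℓ M (ρ * M) 0}

theorem mem_goodExit {R : Space d ≃ₗᵢ[ℝ] Space d} {ℓ : Space d} {ρ M : ℝ} {X : ℕ → Site d} :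
    X ∈ goodExit R ℓ ρ M ↔
    ∃ n, ((∀ k < n, X k ∈ box R M (ρ * M) 0) ∧ X n ∉ box R M (ρ * M) 0) ∧
      X n ∈ boxPosBoundary R ℓ M (ρ * M) 0 := by
  have key : ∀ n : ℕ, exitTime (box R M (ρ * M) 0) X = n ↔
      (∀ k < n, X k ∈ box R M (ρ * M) 0) ∧ X n ∉ box R M (ρ * M) 0 := by
    intro n
    rw [exitTime, firstTime_eq_coe, and_comm]
    simp
  constructor
  · rintro ⟨h1, h2⟩
    obtain ⟨n, hn⟩ := ENat.ne_top_iff_exists.1 h1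
    rw [← hn, ENat.toNat_natCast] at h2
    exact ⟨n, (key n).1 hn.symm, h2⟩
  · rintro ⟨n, h1, h2⟩
    have hn := (key n).2 h1
    refine ⟨by rw [hn]; exact ENat.natCast_ne_top n, ?_⟩
    rw [hn, ENat.toNat_natCast]
    exact h2

theorem measurableSet_goodExit {R : Space d ≃ₗᵢ[ℝ] Space d} (ℓ : Space d) (ρ M : ℝ) :
    MeasurableSet (goodExit R ℓ ρ M) := by
  have : goodExit R ℓ ρ M = ⋃ n, {X | ((∀ k < n, X k ∈ box R M (ρ * M) 0) ∧
      X n ∉ box R M (ρ * M) 0) ∧ X n ∈ boxPosBoundary R ℓ M (ρ * M) 0} := by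
    ext X
    rw [mem_goodExit, Set.mem_iUnion]
    rfl
  rw [this]
  refine MeasurableSet.iUnion fun n => measurableSet_of_prefix _ (n + 1) ?_
  rintro ξ ξ' h ⟨⟨h1, h2⟩, h3⟩
  refine ⟨⟨fun k hk => ?_, ?_⟩, ?_⟩
  · rw [← h k (by omega)]; exact h1 k hk
  · rw [← h n (by omega)]; exact h2
  · rw [← h n (by omega)]; exact h3

/-- The coordinates of a site in the rotated frame of the boxes. -/
noncomputable def crd (R : Space d ≃ₗᵢ[ℝ] Space d) (x : Site d) (i : Fin d) : ℝ :=
  R.symm (toSpace x) i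

variable (R : Space d ≃ₗᵢ[ℝ] Space d)

theorem crd_sub (x y : Site d) (i : Fin d) : crd R (x - y) i = crd R x i - crd R y i := by
  simp [crd, toSpace_sub]

@[simp] theorem crd_zero (i : Fin d) : crd R 0 i = 0 := by
  simp [crd, toSpace_zero]

theorem abs_crd_le (x : Site d) (i : Fin d) : |crd R x i| ≤ l2 x := by
  have h := PiLp.norm_apply_le (R.symm (toSpace x)) i
  rw [LinearIsometryEquiv.norm_map] at h
  exact h

theorem l2_le_sum_crd (x : Site d) : l2 x ≤ ∑ i, |crd R x i| := by
  have h := norm_le_sum_abs (R.symm (toSpace x))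
  rw [LinearIsometryEquiv.norm_map] at h
  exact h

variable [NeZero d]

theorem crd_zero_eq_inner {ℓ : Space d}
    (hR : ∀ i : Fin d, i.val = 0 → R (EuclideanSpace.single i 1) = ℓ) (x : Site d) :
    crd R x 0 = ⟪toSpace x, ℓ⟫ := by
  rw [← hR 0 rfl, ← LinearIsometryEquiv.inner_map_map R.symm,
    LinearIsometryEquiv.symm_apply_apply, EuclideanSpace.inner_single_right]
  simp [crd]

theorem mem_box_zero {M M' : ℝ} {y : Site d} :
    y ∈ box R M M' 0 ↔ |crd R y 0| < M ∧ ∀ i ≠ 0, |crd R y i| < M' := by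
  constructor
  · rintro ⟨u, h1, h2, h3⟩
    rw [toSpace_zero, zero_add] at h3
    have hu : ∀ i, crd R y i = u i := by
      intro i; rw [crd, h3, LinearIsometryEquiv.symm_apply_apply]
    simp_rw [hu]
    exact ⟨h1 0 rfl, fun i hi => h2 i fun h => hi (Fin.ext h)⟩
  · rintro ⟨h1, h2⟩
    refine ⟨R.symm (toSpace y), fun i hi => ?_, fun i hi => h2 i fun h => hi (by rw [h]; rfl), ?_⟩
    · obtain rfl : i = 0 := Fin.ext hi
      exact h1
    · rw [toSpace_zero, zero_add, LinearIsometryEquiv.apply_symm_apply]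

variable {R}

/-- What a good exit means in the coordinates of the box: the overshoot is at most `1`. -/
theorem exists_of_mem_goodExit {ℓ : Space d}
    (hR : ∀ i : Fin d, i.val = 0 → R (EuclideanSpace.single i 1) = ℓ) {ρ M : ℝ}
    {X : ℕ → Site d} (hX : X ∈ goodExit R ℓ ρ M) :
    ∃ T, (∀ n < T, X n ∈ box R M (ρ * M) 0) ∧ M ≤ crd R (X T) 0 ∧ crd R (X T) 0 < M + 1 ∧
      ∀ i ≠ 0, |crd R (X T) i| < ρ * M + 1 := by
  obtain ⟨T, ⟨h1, _⟩, ⟨⟨_, z, hz, hzd⟩, h4⟩⟩ := mem_goodExit.1 hX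
  have hle : ∀ i, |crd R (X T) i| ≤ |crd R z i| + 1 := by
    intro i
    have h5 := abs_crd_le R (X T - z) i
    have h6 := (l2_le_l1 (X T - z)).trans hzd
    rw [crd_sub] at h5
    have h7 := abs_sub_abs_le_abs_sub (crd R (X T) i) (crd R z i)
    linarith
  rw [mem_box_zero] at hz
  refine ⟨T, h1, ?_, ?_, fun i hi => ?_⟩
  · rw [crd_zero_eq_inner R hR]
    simpa using h4
  · have := hle 0
    have := le_abs_self (crd R (X T) 0)
    linarith [hz.1]
  · linarith [hle i, hz.2 i hi]

end Coordinates

/-! ### Consequences of condition (T) for all boxes at once -/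

section ConditionT

variable {d : ℕ}

/-- The first hitting time of the site `y` by the walk from `0`. -/
noncomputable def hitTime (y : Site d) (ξ : ℕ → Letter d) : ℕ∞ := firstTime {n | pos 0 ξ n = y}

theorem isStop_hitTime (y : Site d) : IsStop (hitTime y) :=
  isStop_firstTime _ fun n ξ ξ' h hn => by
    change pos 0 ξ' n = y
    rw [← pos_congr h]; exact hn

/-- The walk hits `y` and the path after the first visit fails to leave the box of size `m` around
`y` through the positive boundary. -/
def badHit (R : Space d ≃ₗᵢ[ℝ] Space d) (ℓ : Space d) (ρ : ℝ) (m : ℕ) (y : Site d) :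
    Set (ℕ → Letter d) :=
  {ξ | ∃ n : ℕ, hitTime y ξ = n ∧ pos 0 (fun k => ξ (n + k)) ∉ goodExit R ℓ ρ m}

theorem measurableSet_badHit (R : Space d ≃ₗᵢ[ℝ] Space d) (ℓ : Space d) (ρ : ℝ) (m : ℕ)
    (y : Site d) : MeasurableSet (badHit R ℓ ρ m y) := by
  have : badHit R ℓ ρ m y = ⋃ n : ℕ, {ξ | hitTime y ξ = n} ∩
      (fun (ξ : ℕ → Letter d) k => ξ (n + k)) ⁻¹' (pos 0 ⁻¹' (goodExit R ℓ ρ m)ᶜ) := by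
    ext ξ
    simp only [Set.mem_iUnion]
    rfl
  rw [this]
  refine MeasurableSet.iUnion fun n => ((isStop_hitTime y).measurableSet_eq n).inter ?_
  exact (measurable_pos 0 (measurableSet_goodExit ℓ ρ m).compl).preimage (by fun_prop)

variable [NeZero d] {κ : Ellipticity d}

/-- A negative limit superior in condition (T) bounds the probability of a bad exit exponentially,
for all large integer sizes of the box. -/
theorem ConditionT.exists_exp_bound {P : Measure (Env d κ)} [IsProbabilityMeasure P]
    {ℓ : Space d} {R : Space d ≃ₗᵢ[ℝ] Space d} {ρ : ℝ} (hT : ConditionT P ℓ R ρ) :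
    ∃ γ : ℝ, 0 < γ ∧ ∃ m₁ : ℕ, ∀ m : ℕ, m₁ ≤ m →
      ∫⁻ ω, walkKernel κ 0 ω (pos 0 ⁻¹' (goodExit R ℓ ρ m)ᶜ) ∂P ≤
        ENNReal.ofReal (Real.exp (-γ * m)) := by
  obtain ⟨_, _, hlim⟩ := hT
  obtain ⟨x, hx1, hx2⟩ := EReal.lt_iff_exists_real_btwn.1 hlim
  have hx0 : x < 0 := by exact_mod_cast hx2
  obtain ⟨N, hN⟩ := eventually_atTop.1 (eventually_lt_of_limsup_lt hx1)
  refine ⟨-x, by linarith, ⌈N⌉₊ + 1, fun m hm => ?_⟩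
  have hm0 : (0 : ℝ) < m := by
    have : 0 < m := by omega
    exact_mod_cast this
  have hmN : N ≤ m := (Nat.le_ceil N).trans (by exact_mod_cast (by omega : ⌈N⌉₊ ≤ m))
  have h := hN m hmN
  rw [← annealedLaw_eq P 0 _ (measurableSet_goodExit ℓ ρ m).compl]
  change ((((m : ℝ)⁻¹ : ℝ) : EReal) * ENNReal.log (annealedLaw P 0
    {z | z.2 ∈ (goodExit R ℓ ρ m)ᶜ})) < x at h
  set p := annealedLaw P 0 {z | z.2 ∈ (goodExit R ℓ ρ m)ᶜ}
  have hlog : ENNReal.log p ≤ ((x * m : ℝ) : EReal) := by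
    by_contra hcon
    rw [not_le] at hcon
    have h2 : (((m : ℝ)⁻¹ : ℝ) : EReal) * ((x * m : ℝ) : EReal) ≤
        (((m : ℝ)⁻¹ : ℝ) : EReal) * ENNReal.log p :=
      mul_le_mul_of_nonneg_left hcon.le (by exact_mod_cast (inv_pos.2 hm0).le)
    have h3 : (((m : ℝ)⁻¹ : ℝ) : EReal) * ((x * m : ℝ) : EReal) = x := by
      rw [← EReal.coe_mul]
      congr 1
      field_simp
    rw [h3] at h2
    exact absurd h (not_lt.2 h2)
  have h4 := EReal.exp_monotone hlog
  rw [ENNReal.exp_log, EReal.exp_coe] at h4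
  simpa using h4

/-- By the Markov property at the first visit to `y` and stationarity, a bad exit from the box
around `y` is no more likely than one from the box around the origin. -/
theorem lintegral_badHit_le {P : Measure (Env d κ)} (hstat : IsStationary P)
    (R : Space d ≃ₗᵢ[ℝ] Space d) (ℓ : Space d) (ρ : ℝ) (m : ℕ) (y : Site d) :
    ∫⁻ ω, walkKernel κ 0 ω (badHit R ℓ ρ m y) ∂P ≤
      ∫⁻ ω, walkKernel κ 0 ω (pos 0 ⁻¹' (goodExit R ℓ ρ m)ᶜ) ∂P := by
  have hmeas := measurable_pos (d := d) 0 (measurableSet_goodExit (R := R) ℓ ρ m).compl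
  have hshift := lintegral_walkKernel_shift hstat y
    ((pos 0 ⁻¹' (goodExit R ℓ ρ m)ᶜ).indicator 1) (measurable_one.indicator hmeas)
  simp_rw [lintegral_indicator_one hmeas] at hshift
  rw [← hshift]
  refine lintegral_mono fun ω => ?_
  have hbad := measurableSet_badHit R ℓ ρ m y
  have hsub : badHit R ℓ ρ m y ⊆ {ξ | hitTime y ξ < ⊤} := by
    rintro ξ ⟨n, hn, _⟩
    simp only [Set.mem_ofPred_eq, hn]
    exact ENat.natCast_lt_top n
  have h1 : walkKernel κ 0 ω (badHit R ℓ ρ m y) = ∫⁻ ξ in {ξ | hitTime y ξ < ⊤},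
      (badHit R ℓ ρ m y).indicator 1 ξ ∂(walkKernel κ 0 ω) := by
    rw [lintegral_indicator_one hbad, Measure.restrict_apply hbad,
      Set.inter_eq_left.2 hsub]
  rw [h1, strong_markov ω 0 (isStop_hitTime y) _ (measurable_one.indicator hbad)]
  calc ∑' w : stopWords (hitTime y), wt ω 0 w.1 *
        ∫⁻ ξ, (badHit R ℓ ρ m y).indicator 1 (cat w.1 ξ) ∂(walkKernel κ (endpt 0 w.1) ω)
      ≤ ∑' w : stopWords (hitTime y), wt ω 0 w.1 *
          walkKernel κ y ω (pos 0 ⁻¹' (goodExit R ℓ ρ m)ᶜ) := by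
        refine ENNReal.tsum_le_tsum fun w => mul_le_mul' le_rfl ?_
        have hne : Nonempty (Letter d) := ⟨(none, (0, true))⟩
        obtain ⟨ξ₀⟩ : Nonempty (ℕ → Letter d) := inferInstance
        have hy : endpt 0 w.1 = y := by
          have := (firstTime_eq_coe.1 (w.2 ξ₀)).1
          simp only [Set.mem_ofPred_eq, pos_cat_length] at this
          exact this
        rw [hy, ← lintegral_indicator_one hmeas]
        refine lintegral_mono fun ξ => ?_
        by_cases hb : cat w.1 ξ ∈ badHit R ℓ ρ m y
        · obtain ⟨n, hn, hgood⟩ := hb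
          have hlen : n = w.1.length := by
            have := w.2 ξ
            rw [hn] at this
            exact_mod_cast this
          have hξ : (fun k => cat w.1 ξ (n + k)) = ξ := by
            funext k
            rw [hlen, cat_add]
          rw [hξ] at hgood
          rw [Set.indicator_of_mem (show ξ ∈ pos 0 ⁻¹' (goodExit R ℓ ρ m)ᶜ from hgood)]
          exact Set.indicator_le_self' (fun _ _ => zero_le) _
        · rw [Set.indicator_of_notMem hb]
          exact zero_le
    _ ≤ _ := by
        rw [ENNReal.tsum_mul_right]
        exact mul_le_of_le_one_left' (tsum_wt_stopWords_le_one ω 0 (isStop_hitTime y))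

end ConditionT

/-! ### Confinement of the path at large scales -/

section Geometry

variable {d : ℕ}

theorem l2_eq_of_toSpace {ℓ : Space d} (hℓ : ‖ℓ‖ = 1) {h : ℝ} (hh : 0 < h) {l : Site d}
    (hl : toSpace l = h • ℓ) : l2 l = h := by
  rw [l2, hl, norm_smul, hℓ, mul_one, Real.norm_of_nonneg hh.le]

theorem pos_add (x : Site d) (ξ : ℕ → Letter d) (n k : ℕ) :
    pos x ξ (n + k) = pos (pos x ξ n) (fun i => ξ (n + i)) k := by
  induction k with
  | zero => simp
  | succ k ih => rw [← add_assoc, pos_succ, ih, pos_succ]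

/-- The sum of `exp(c m)` over the failures of boxes of size `m ≥ m₁`. -/
noncomputable def badSum (R : Space d ≃ₗᵢ[ℝ] Space d) (ℓ : Space d) (ρ c : ℝ) (K m₁ : ℕ)
    (ξ : ℕ → Letter d) : ℝ≥0∞ :=
  ∑' m : ℕ, ∑' y : Site d, (if m₁ ≤ m ∧ l1 y ≤ K * m then ENNReal.ofReal (Real.exp (c * m)) else 0)
    * (badHit R ℓ ρ m y).indicator 1 ξ

theorem measurable_badSum (R : Space d ≃ₗᵢ[ℝ] Space d) (ℓ : Space d) (ρ c : ℝ) (K m₁ : ℕ) :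
    Measurable (badSum R ℓ ρ c K m₁) :=
  Measurable.tsum fun m => Measurable.tsum fun y =>
    (measurable_one.indicator (measurableSet_badHit R ℓ ρ m y)).const_mul _

variable [NeZero d]

/-- Every box of size at least `m₀` around a site `y` with `|y|₁ ≤ K m` is left through its positive
boundary by the path after its first visit to `y`. -/
def ExitsWell (R : Space d ≃ₗᵢ[ℝ] Space d) (ρ : ℝ) (K m₀ : ℕ) (X : ℕ → Site d) : Prop :=
  ∀ m : ℕ, m₀ ≤ m → ∀ n, (∀ k < n, X k ≠ X n) → l1 (X n) ≤ K * m →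
    ∃ T, (∀ j < T, X (n + j) - X n ∈ box R m (ρ * m) 0) ∧
      (m : ℝ) ≤ crd R (X (n + T) - X n) 0 ∧ crd R (X (n + T) - X n) 0 < m + 1 ∧
        ∀ i ≠ 0, |crd R (X (n + T) - X n) i| < ρ * m + 1

/-- The path leaves all the centred boxes of size at least `m₀` at a high level, and stays in the
cone after it has left the box of size `4 m₀`. -/
def Confined (R : Space d ≃ₗᵢ[ℝ] Space d) (ρ : ℝ) (l : Site d) (ζ : ℝ) (m₀ : ℕ)
    (X : ℕ → Site d) : Prop :=
  (∀ M : ℕ, m₀ ≤ M → ∃ T, (∀ n < T, X n ∈ box R M (ρ * M) 0) ∧ (M : ℝ) ≤ crd R (X T) 0) ∧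
    ∃ T, (∀ n < T, X n ∈ box R (4 * m₀ : ℕ) (ρ * (4 * m₀ : ℕ)) 0) ∧
      ∀ n, T ≤ n → X n ∈ cone l ζ 0

theorem dotProduct_eq_mul_crd {R : Space d ≃ₗᵢ[ℝ] Space d} {ℓ : Space d}
    (hR : ∀ i : Fin d, i.val = 0 → R (EuclideanSpace.single i 1) = ℓ) {h : ℝ} {l : Site d}
    (hl : toSpace l = h • ℓ) (y : Site d) : ((y ⬝ᵥ l : ℤ) : ℝ) = h * crd R y 0 := by
  rw [← inner_toSpace, hl, inner_smul_right, crd_zero_eq_inner R hR]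

theorem l2_le_of_crd_le {R : Space d ≃ₗᵢ[ℝ] Space d} {y : Site d} {a b : ℝ} (hb : 0 ≤ b)
    (h0 : |crd R y 0| ≤ a) (h1 : ∀ i ≠ 0, |crd R y i| ≤ b) : l2 y ≤ a + d * b := by
  calc l2 y ≤ ∑ i, |crd R y i| := l2_le_sum_crd R y
    _ ≤ ∑ i : Fin d, ((if i = 0 then a else 0) + b) := by
        refine Finset.sum_le_sum fun i _ => ?_
        split_ifs with hi
        · rw [hi]; linarith
        · rw [zero_add]; exact h1 i hi
    _ = a + d * b := by
        rw [Finset.sum_add_distrib, Finset.sum_ite_eq' Finset.univ (0 : Fin d)]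
        simp

/-- The boxes are chained: after leaving the box of size `4 m₀` at a level `t`, the path leaves the
box of size `⌊t / 4⌋` around its current site, and so on. The levels of the exits grow, and the
boxes lie in the cone. -/
theorem ExitsWell.confined (hd : 1 < d) {R : Space d ≃ₗᵢ[ℝ] Space d} {ℓ : Space d}
    (hR : ∀ i : Fin d, i.val = 0 → R (EuclideanSpace.single i 1) = ℓ) (hℓ : ‖ℓ‖ = 1) {h : ℝ}
    (hh : 0 < h) {l : Site d} (hl : toSpace l = h • ℓ) {ρ : ℝ} (hρ : 0 < ρ) {ζ : ℝ} (hζ : 0 < ζ)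
    (hζ1 : ζ * (9 * d) < 1) (hζ2 : ζ * (3 * d * ρ) < 1) {K : ℕ}
    (hK : d * (1 + d * (ρ + 1)) * 8 ≤ K) {m₀ : ℕ} (hm₀ : 1 ≤ m₀) {X : ℕ → Site d} (hX0 : X 0 = 0)
    (hX : ExitsWell R ρ K m₀ X) : Confined R ρ l ζ m₀ X := by
  have hd2 : (2 : ℝ) ≤ d := by exact_mod_cast hd
  have hstart : ∀ M : ℕ, m₀ ≤ M → ∃ T, (∀ n < T, X n ∈ box R M (ρ * M) 0) ∧
      (M : ℝ) ≤ crd R (X T) 0 ∧ crd R (X T) 0 < M + 1 ∧ ∀ i ≠ 0, |crd R (X T) i| < ρ * M + 1 := by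
    intro M hM
    have h1 := hX M hM 0 (fun k hk => absurd hk (Nat.not_lt_zero k)) (by rw [hX0]; simp [l1])
    simpa [hX0] using h1
  refine ⟨fun M hM => ?_, ?_⟩
  · obtain ⟨T, h1, h2, -⟩ := hstart M hM
    exact ⟨T, h1, h2⟩
  obtain ⟨T₁, hT1, hT2, -, hT4⟩ := hstart (4 * m₀) (by omega)
  refine ⟨T₁, hT1, ?_⟩
  have hm₀' : (1 : ℝ) ≤ m₀ := by exact_mod_cast hm₀
  push_cast at hT2 hT4
  have hlev : ∀ {M M' : ℝ} {y : Site d}, y ∈ box R M M' 0 → crd R y 0 < M := fun hy =>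
    (le_abs_self _).trans_lt ((mem_box_zero R).1 hy).1
  have key : ∀ k : ℕ, ∃ T, T₁ + k ≤ T ∧ (∀ j < T, crd R (X j) 0 < crd R (X T) 0) ∧
      4 * (m₀ : ℝ) ≤ crd R (X T) 0 ∧ (∀ i ≠ 0, |crd R (X T) i| ≤ (ρ + 1) * crd R (X T) 0) ∧
      ∀ n, T₁ ≤ n → n < T → X n ∈ cone l ζ 0 := by
    intro k
    induction k with
    | zero =>
      refine ⟨T₁, le_rfl, fun j hj => ?_, hT2, fun i hi => (hT4 i hi).le.trans ?_,
        fun n h1 h2 => by omega⟩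
      · have := hlev (hT1 j hj)
        push_cast at this
        linarith
      · nlinarith
    | succ k ih =>
      obtain ⟨T, hTk, hrec, hlow, hlat, hcone⟩ := ih
      set t := crd R (X T) 0 with ht
      have ht0 : 0 < t := by linarith
      set m := ⌊t / 4⌋₊ with hm
      have hmt : (m : ℝ) ≤ t / 4 := Nat.floor_le (by positivity)
      have hmt' : t / 4 < m + 1 := Nat.lt_floor_add_one _
      have hm0 : m₀ ≤ m := Nat.le_floor (by linarith)
      have hm1 : (1 : ℝ) ≤ m := hm₀'.trans (by exact_mod_cast hm0)
      have hl2 : l2 (X T) ≤ t + d * ((ρ + 1) * t) :=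
        l2_le_of_crd_le (by positivity) (by rw [← ht, abs_of_pos ht0]) hlat
      have hl1 : l1 (X T) ≤ K * m := by
        have h2 : (l1 (X T) : ℝ) ≤ K * m := by
          calc (l1 (X T) : ℝ) ≤ d * (t + d * ((ρ + 1) * t)) :=
                (l1_le_mul_l2 _).trans (by gcongr)
            _ = d * (1 + d * (ρ + 1)) * t := by ring
            _ ≤ d * (1 + d * (ρ + 1)) * (8 * m) := by gcongr; linarith
            _ = d * (1 + d * (ρ + 1)) * 8 * m := by ring
            _ ≤ K * m := by gcongr
        exact_mod_cast h2
      obtain ⟨T', h1, h2, h3, h4⟩ := hX m hm0 T (fun j hj he => by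
        have := hrec j hj
        rw [he] at this
        exact lt_irrefl _ this) hl1
      have hT' : T' ≠ 0 := by
        rintro rfl
        simp only [Nat.add_zero, sub_self, crd_zero] at h2
        linarith
      have hsub : ∀ n i, crd R (X n) i = crd R (X T) i + crd R (X n - X T) i := by
        intro n i; rw [crd_sub]; ring
      have hnew := hsub (T + T') 0
      rw [← ht] at hnew
      refine ⟨T + T', by omega, fun j hj => ?_, by linarith, fun i hi => ?_, fun n hn1 hn2 => ?_⟩
      · rcases lt_or_ge j T with hjT | hjT
        · linarith [hrec j hjT]
        · obtain ⟨j, rfl⟩ := Nat.exists_eq_add_of_le hjT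
          have h5 := hlev (h1 j (by omega))
          have h6 := hsub (T + j) 0
          rw [← ht] at h6
          linarith
      · rw [hsub]
        refine (abs_add_le _ _).trans ?_
        have h5 := hlat i hi
        have h6 := (h4 i hi).le
        have h7 : (ρ + 1) * (t + m) ≤ (ρ + 1) * crd R (X (T + T')) 0 := by
          gcongr; linarith
        nlinarith
      · rcases lt_or_ge n T with hnT | hnT
        · exact hcone n hn1 hnT
        obtain ⟨j, rfl⟩ := Nat.exists_eq_add_of_le hnT
        have hbox := (mem_box_zero R).1 (h1 j (by omega))
        have h5 := hsub (T + j) 0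
        rw [← ht] at h5
        have h6 := abs_lt.1 hbox.1
        have hlow' : 3 / 4 * t ≤ crd R (X (T + j)) 0 := by linarith
        have hbound : l2 (X (T + j)) ≤ 5 / 4 * t + d * (5 / 4 * (ρ + 1) * t) := by
          refine l2_le_of_crd_le (R := R) (by positivity) ?_ fun i hi => ?_
          · rw [abs_of_nonneg (by linarith)]; linarith
          · rw [hsub]
            refine (abs_add_le _ _).trans ?_
            have h7 := hlat i hi
            have h8 := (hbox.2 i hi).le
            nlinarith
        have hζt : ζ * (5 / 4 * t + d * (5 / 4 * (ρ + 1) * t)) ≤ 3 / 4 * t := by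
          have : ζ * (5 / 4 * (1 + d * (ρ + 1))) ≤ 3 / 4 := by nlinarith
          nlinarith
        change ζ * l2 l * l2 (X (T + j) - 0) ≤ (((X (T + j) - 0) ⬝ᵥ l : ℤ) : ℝ)
        rw [sub_zero, l2_eq_of_toSpace hℓ hh hl, dotProduct_eq_mul_crd hR hl]
        calc ζ * h * l2 (X (T + j)) = h * (ζ * l2 (X (T + j))) := by ring
          _ ≤ h * (ζ * (5 / 4 * t + d * (5 / 4 * (ρ + 1) * t))) := by gcongr
          _ ≤ h * (3 / 4 * t) := by gcongr
          _ ≤ _ := by gcongr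
  intro n hn
  obtain ⟨T, hT, -, -, -, hc⟩ := key (n + 1)
  exact hc n hn (by omega)

theorem exitsWell_of_notMem_badHit {R : Space d ≃ₗᵢ[ℝ] Space d} {ℓ : Space d}
    (hR : ∀ i : Fin d, i.val = 0 → R (EuclideanSpace.single i 1) = ℓ) {ρ : ℝ} {K m₀ : ℕ}
    {ξ : ℕ → Letter d}
    (h : ∀ m, m₀ ≤ m → ∀ y, l1 y ≤ K * m → ξ ∉ badHit R ℓ ρ m y) :
    ExitsWell R ρ K m₀ (pos 0 ξ) := by
  intro m hm n hn hl
  have hhit : hitTime (pos 0 ξ n) ξ = n := firstTime_eq_coe.2 ⟨rfl, hn⟩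
  have hgood : pos 0 (fun k => ξ (n + k)) ∈ goodExit R ℓ ρ m := by
    by_contra hcon
    exact h m hm _ hl ⟨n, hhit, hcon⟩
  have hpos : ∀ k, pos 0 ξ (n + k) - pos 0 ξ n = pos 0 (fun i => ξ (n + i)) k := by
    intro k
    rw [pos_add, pos_eq_add]
    simp
  simp_rw [hpos]
  exact exists_of_mem_goodExit hR hgood

variable {κ : Ellipticity d}

theorem lintegral_badSum_lt_top {P : Measure (Env d κ)} (hstat : IsStationary P)
    {R : Space d ≃ₗᵢ[ℝ] Space d} {ℓ : Space d} {ρ γ : ℝ} (hγ : 0 < γ) {m₁ : ℕ}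
    (h : ∀ m : ℕ, m₁ ≤ m → ∫⁻ ω, walkKernel κ 0 ω (pos 0 ⁻¹' (goodExit R ℓ ρ m)ᶜ) ∂P ≤
      ENNReal.ofReal (Real.exp (-γ * m))) (K : ℕ) :
    ∫⁻ ω, ∫⁻ ξ, badSum R ℓ ρ (γ / 2) K m₁ ξ ∂(walkKernel κ 0 ω) ∂P < ⊤ := by
  have hm : ∀ m y, Measurable fun ω => walkKernel κ 0 ω (badHit R ℓ ρ m y) := fun m y =>
    Kernel.measurable_coe _ (measurableSet_badHit R ℓ ρ m y)
  have h1 : ∀ ω, ∫⁻ ξ, badSum R ℓ ρ (γ / 2) K m₁ ξ ∂(walkKernel κ 0 ω) =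
      ∑' m : ℕ, ∑' y : Site d,
        (if m₁ ≤ m ∧ l1 y ≤ K * m then ENNReal.ofReal (Real.exp (γ / 2 * m)) else 0) *
          walkKernel κ 0 ω (badHit R ℓ ρ m y) := by
    intro ω
    unfold badSum
    have hmeas : ∀ m y, Measurable fun ξ => (if m₁ ≤ m ∧ l1 y ≤ K * m then
        ENNReal.ofReal (Real.exp (γ / 2 * m)) else 0) *
          (badHit R ℓ ρ m y).indicator (1 : (ℕ → Letter d) → ℝ≥0∞) ξ := fun m y =>
      (measurable_one.indicator (measurableSet_badHit R ℓ ρ m y)).const_mul _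
    rw [lintegral_tsum fun m => (Measurable.tsum (hmeas m)).aemeasurable]
    refine tsum_congr fun m => ?_
    rw [lintegral_tsum fun y => (hmeas m y).aemeasurable]
    refine tsum_congr fun y => ?_
    rw [lintegral_const_mul _ (measurable_one.indicator (measurableSet_badHit R ℓ ρ m y)),
      lintegral_indicator_one (measurableSet_badHit R ℓ ρ m y)]
  simp_rw [h1]
  rw [lintegral_tsum fun m => (Measurable.tsum fun y => (hm m y).const_mul _).aemeasurable]
  set α := γ / (4 * (K + 1)) with hα
  have hα0 : 0 < α := by positivity
  have hterm : ∀ (m : ℕ) (y : Site d),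
      (if m₁ ≤ m ∧ l1 y ≤ K * m then ENNReal.ofReal (Real.exp (γ / 2 * m)) else 0) *
        ∫⁻ ω, walkKernel κ 0 ω (badHit R ℓ ρ m y) ∂P ≤
      ENNReal.ofReal (Real.exp (-(γ / 4) * m)) * ENNReal.ofReal (Real.exp (-α * l1 y)) := by
    intro m y
    split_ifs with hc
    · refine (mul_le_mul' le_rfl ((lintegral_badHit_le hstat R ℓ ρ m y).trans
        (h m hc.1))).trans ?_
      rw [← ENNReal.ofReal_mul (Real.exp_pos _).le, ← ENNReal.ofReal_mul (Real.exp_pos _).le,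
        ← Real.exp_add, ← Real.exp_add]
      refine ENNReal.ofReal_le_ofReal (Real.exp_le_exp.2 ?_)
      have h2 : (l1 y : ℝ) ≤ (K + 1) * m := by
        have : (l1 y : ℝ) ≤ K * m := by exact_mod_cast hc.2
        have : (0 : ℝ) ≤ m := by positivity
        linarith
      have h3 : α * l1 y ≤ α * ((K + 1) * m) := by gcongr
      have h4 : α * ((K + 1) * m) = γ / 4 * m := by rw [hα]; field_simp
      linarith
    · rw [zero_mul]; exact zero_le
  calc _ ≤ ∑' m : ℕ, ∑' y : Site d, ENNReal.ofReal (Real.exp (-(γ / 4) * m)) *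
        ENNReal.ofReal (Real.exp (-α * l1 y)) := by
        refine ENNReal.tsum_le_tsum fun m => ?_
        rw [lintegral_tsum fun y => ((hm m y).const_mul _).aemeasurable]
        refine ENNReal.tsum_le_tsum fun y => ?_
        rw [lintegral_const_mul _ (hm m y)]
        exact hterm m y
    _ = (∑' m : ℕ, ENNReal.ofReal (Real.exp (-(γ / 4) * m))) *
          ∑' y : Site d, ENNReal.ofReal (Real.exp (-α * l1 y)) := by
        simp_rw [ENNReal.tsum_mul_left, ENNReal.tsum_mul_right]
    _ < ⊤ := by
        refine ENNReal.mul_lt_top ?_ (summable_exp_l1 hα0).tsum_ofReal_lt_top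
        refine Summable.tsum_ofReal_lt_top ?_
        have := Real.summable_exp_nat_mul_of_ge (c := -(γ / 4)) (by linarith)
          (f := fun n => (n : ℝ)) fun n => le_rfl
        exact this

/-- Under condition (T) the path is confined at a scale with an exponential moment: this scale is
controlled by an integrable function of the path. -/
theorem ConditionT.exists_scale (hd : 1 < d) {P : Measure (Env d κ)} [IsProbabilityMeasure P]
    (hstat : IsStationary P) {R : Space d ≃ₗᵢ[ℝ] Space d} {ℓ : Space d} (hℓ : ‖ℓ‖ = 1) {h : ℝ}
    (hh : 0 < h) {l : Site d} (hl : toSpace l = h • ℓ) {ρ : ℝ} (hT : ConditionT P ℓ R ρ) {ζ : ℝ}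
    (hζ : 0 < ζ) (hζ1 : ζ * (9 * d) < 1) (hζ2 : ζ * (3 * d * ρ) < 1) :
    ∃ c : ℝ, 0 < c ∧ ∃ Z : (ℕ → Letter d) → ℝ≥0∞, Measurable Z ∧
      ∫⁻ ω, ∫⁻ ξ, Z ξ ∂(walkKernel κ 0 ω) ∂P < ⊤ ∧
      ∀ ξ, Z ξ < ⊤ → ∃ m₀ : ℕ, 1 ≤ m₀ ∧ ENNReal.ofReal (Real.exp (c * m₀)) ≤ Z ξ ∧
        Confined R ρ l ζ m₀ (pos 0 ξ) := by
  obtain ⟨γ, hγ, m₁, hm₁⟩ := hT.exists_exp_bound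
  obtain ⟨hR, hρ, -⟩ := hT
  set K := ⌈d * (1 + d * (ρ + 1)) * 8⌉₊ with hK
  set c := γ / 2 with hc
  have hc0 : 0 < c := by positivity
  set A := ENNReal.ofReal (Real.exp (c * (m₁ + 1 : ℕ))) with hA
  have hmeas := measurable_badSum R ℓ ρ c K m₁
  refine ⟨c, hc0, fun ξ => A * (1 + badSum R ℓ ρ c K m₁ ξ), (hmeas.const_add 1).const_mul _,
    ?_, fun ξ hξ => ?_⟩
  · have h1 : ∀ ω, ∫⁻ ξ, A * (1 + badSum R ℓ ρ c K m₁ ξ) ∂(walkKernel κ 0 ω) =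
        A * (1 + ∫⁻ ξ, badSum R ℓ ρ c K m₁ ξ ∂(walkKernel κ 0 ω)) := by
      intro ω
      rw [lintegral_const_mul _ (hmeas.const_add 1), lintegral_add_right _ hmeas]
      simp
    simp_rw [h1]
    have h2 : Measurable fun ω => ∫⁻ ξ, badSum R ℓ ρ c K m₁ ξ ∂(walkKernel κ 0 ω) :=
      hmeas.lintegral_kernel
    rw [lintegral_const_mul _ (h2.const_add 1), lintegral_add_right _ h2]
    refine ENNReal.mul_lt_top ENNReal.ofReal_lt_top (ENNReal.add_lt_top.2 ⟨by simp, ?_⟩)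
    exact lintegral_badSum_lt_top hstat hγ hm₁ K
  · have hA0 : A ≠ 0 := by
      rw [hA, Ne, ENNReal.ofReal_eq_zero, not_le]; exact Real.exp_pos _
    have hZ : badSum R ℓ ρ c K m₁ ξ ≠ ⊤ := by
      intro htop
      simp [htop, hA0] at hξ
    -- a single failure bounds the sum from below
    have hbad : ∀ m y, m₁ ≤ m → l1 y ≤ K * m → ξ ∈ badHit R ℓ ρ m y →
        ENNReal.ofReal (Real.exp (c * m)) ≤ badSum R ℓ ρ c K m₁ ξ := by
      intro m y h1 h2 h3
      refine le_trans ?_ ((ENNReal.le_tsum y).trans (ENNReal.le_tsum m))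
      rw [if_pos ⟨h1, h2⟩, Set.indicator_of_mem h3]
      simp
    have hex : ∃ m₀, m₁ + 1 ≤ m₀ ∧ ∀ m, m₀ ≤ m → ∀ y, l1 y ≤ K * m → ξ ∉ badHit R ℓ ρ m y := by
      obtain ⟨N, hN⟩ := exists_nat_gt ((badSum R ℓ ρ c K m₁ ξ).toReal / c)
      refine ⟨m₁ + 1 + N, by omega, fun m hm y hy hmem => ?_⟩
      have h1 := hbad m y (by omega) hy hmem
      rw [ENNReal.ofReal_le_iff_le_toReal hZ] at h1
      rw [div_lt_iff₀ hc0] at hN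
      have h2 := Real.add_one_le_exp (c * m)
      have h3 : (N : ℝ) ≤ m := by exact_mod_cast (by omega : N ≤ m)
      nlinarith
    classical
    set m₀ := Nat.find hex with hm₀
    obtain ⟨h1, h2⟩ := Nat.find_spec hex
    rw [← hm₀] at h1 h2
    refine ⟨m₀, by omega, ?_, (exitsWell_of_notMem_badHit hR h2).confined hd hR hℓ hh hl hρ hζ hζ1
      hζ2 (Nat.le_ceil _) (by omega) (pos_zero _ _)⟩
    rcases h1.lt_or_eq with hlt | heq
    · have hmin := Nat.find_min hex (m := m₀ - 1) (by omega)
      push Not at hmin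
      obtain ⟨m, hm, y, hy, hmem⟩ := hmin (by omega)
      calc ENNReal.ofReal (Real.exp (c * m₀))
          ≤ ENNReal.ofReal (Real.exp (c * (m₁ + 1 : ℕ)) * Real.exp (c * m)) := by
            rw [← Real.exp_add, ← mul_add]
            refine ENNReal.ofReal_le_ofReal (Real.exp_le_exp.2 ?_)
            have : (m₀ : ℝ) ≤ (m₁ + 1 : ℕ) + m := by exact_mod_cast (by omega)
            gcongr
        _ = A * ENNReal.ofReal (Real.exp (c * m)) := ENNReal.ofReal_mul (Real.exp_pos _).le
        _ ≤ _ := mul_le_mul' le_rfl ((hbad m y (by omega) hy hmem).trans le_add_self)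
    · rw [← heq]
      exact le_mul_of_one_le_right' (le_self_add)

end Geometry

/-! ### The cone and the exit from it -/

section Cone

variable {d : ℕ}

theorem mem_cone_iff_sub {l x y : Site d} {ζ : ℝ} : y ∈ cone l ζ x ↔ y - x ∈ cone l ζ 0 := by
  unfold cone
  simp

theorem mem_cone_zero {l y : Site d} {ζ : ℝ} :
    y ∈ cone l ζ 0 ↔ ζ * l2 l * l2 y ≤ ((y ⬝ᵥ l : ℤ) : ℝ) := by
  unfold cone
  simp

theorem l2_zero : l2 (0 : Site d) = 0 := by simp [l2, toSpace_zero]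

theorem zero_mem_cone (l : Site d) (ζ : ℝ) : (0 : Site d) ∈ cone l ζ 0 := by
  rw [mem_cone_zero, l2_zero]; simp

theorem add_mem_cone {l x y : Site d} {ζ : ℝ} (hζ : 0 ≤ ζ) (hx : x ∈ cone l ζ 0)
    (hy : y ∈ cone l ζ 0) : x + y ∈ cone l ζ 0 := by
  rw [mem_cone_zero] at *
  have h1 : ζ * l2 l * l2 (x + y) ≤ ζ * l2 l * (l2 x + l2 y) :=
    mul_le_mul_of_nonneg_left (l2_add_le x y) (mul_nonneg hζ (l2_nonneg l))
  rw [add_dotProduct]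
  push_cast
  linarith

/-- The exit time from the cone at the origin, as a function of the letters. -/
noncomputable def coneTime (l : Site d) (ζ : ℝ) (ξ : ℕ → Letter d) : ℕ∞ := coneExit l ζ (pos 0 ξ)

theorem coneTime_eq (l : Site d) (ζ : ℝ) (ξ : ℕ → Letter d) :
    coneTime l ζ ξ = firstTime {n | pos 0 ξ n ∉ cone l ζ 0} := by
  rw [coneTime, coneExit, exitTime, pos_zero]

theorem isStop_coneTime (l : Site d) (ζ : ℝ) : IsStop (coneTime l ζ) := by
  have h := isStop_firstTime (fun ξ : ℕ → Letter d => {n | pos 0 ξ n ∉ cone l ζ 0})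
    fun n ξ ξ' h hn => by
      change pos 0 ξ' n ∉ _
      rw [← pos_congr h]; exact hn
  intro n ξ ξ' hξ hn
  rw [coneTime_eq] at hn ⊢
  exact h n ξ ξ' hξ hn

theorem coneTime_eq_top {l : Site d} {ζ : ℝ} {ξ : ℕ → Letter d} :
    coneTime l ζ ξ = ⊤ ↔ ∀ n, pos 0 ξ n ∈ cone l ζ 0 := by
  rw [coneTime_eq, firstTime_eq_top, Set.eq_empty_iff_forall_notMem]
  simp

theorem endpt_eq_sum (x : Site d) (w : List (Letter d)) :
    endpt x w = x + (w.map fun a => a.2.vec).sum := by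
  induction w generalizing x with
  | nil => simp [endpt]
  | cons a w ih => rw [endpt, ih, List.map_cons, List.sum_cons, add_assoc]

theorem endpt_barWord (l : Site d) (L n : ℕ) :
    endpt 0 ((barWord l L).take n) = (((barSeqL l L).take n).map Dir.vec).sum := by
  rw [endpt_eq_sum, zero_add, barWord, ← List.map_take, List.map_map]
  rfl

theorem sum_barSeq (l : Site d) : ((barSeq l).map Dir.vec).sum = l := by
  have h : ∀ i : Fin d, ((List.replicate (l i).natAbs ((i, decide (0 < l i)) : Dir d)).map
      Dir.vec).sum = Pi.single i (l i) := by
    intro i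
    rw [List.map_replicate, List.sum_replicate]
    funext j
    rcases lt_or_ge 0 (l i) with h | h
    · simp only [h, decide_true, Dir.vec, if_true, Pi.smul_apply, nsmul_eq_mul]
      rcases eq_or_ne j i with rfl | hj
      · simp; omega
      · simp [hj]
    · simp only [not_lt.2 h, decide_false, Dir.vec, Pi.smul_apply, nsmul_eq_mul]
      rcases eq_or_ne j i with rfl | hj
      · simp [abs_of_nonpos h]
      · simp [hj]
  rw [barSeq, List.map_flatMap, List.flatMap, List.sum_flatten, List.map_map]
  have : (List.sum ∘ fun i : Fin d => (List.replicate (l i).natAbs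
      ((i, decide (0 < l i)) : Dir d)).map Dir.vec) = fun i => Pi.single i (l i) := by
    funext i; exact h i
  rw [this, ← Fin.sum_univ_def, Finset.univ_sum_single]

theorem sum_barSeqL (l : Site d) (L : ℕ) :
    ((barSeqL l L).map Dir.vec).sum = (L / l1 l) • l := by
  rw [barSeqL, List.map_flatten, List.sum_flatten, List.map_replicate, List.map_replicate,
    List.sum_replicate, sum_barSeq]

theorem endpt_barWord_self (l : Site d) (L : ℕ) : endpt 0 (barWord l L) = (L / l1 l) • l := by
  rw [← sum_barSeqL, endpt_eq_sum, zero_add, barWord, List.map_map]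
  rfl

theorem endpt_barWord_mem_cone {l : Site d} {ζ : ℝ} (hζ : 0 ≤ ζ)
    (hζl : ∀ m : ℕ, 1 ≤ m → m ≤ l1 l → (((barSeq l).take m).map Dir.vec).sum ∈ cone l ζ 0)
    (L n : ℕ) : endpt 0 ((barWord l L).take n) ∈ cone l ζ 0 := by
  have hs : ∀ m, (((barSeq l).take m).map Dir.vec).sum ∈ cone l ζ 0 := by
    intro m
    rcases Nat.eq_zero_or_pos m with rfl | hm
    · simpa using zero_mem_cone l ζ
    rcases le_or_gt m (l1 l) with h | h
    · exact hζl m hm h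
    · rw [List.take_of_length_le (by rw [length_barSeq]; exact h.le)]
      rcases Nat.eq_zero_or_pos (l1 l) with h0 | h0
      · have : barSeq l = [] := by rw [← List.length_eq_zero_iff, length_barSeq, h0]
        simpa [this] using zero_mem_cone l ζ
      · have := hζl (l1 l) h0 le_rfl
        rwa [List.take_of_length_le (length_barSeq l).le] at this
  rw [endpt_barWord, barSeqL]
  induction L / l1 l generalizing n with
  | zero => simpa using zero_mem_cone l ζ
  | succ k ih =>
    rw [List.replicate_succ, List.flatten_cons, List.take_append, List.map_append, List.sum_append]
    exact add_mem_cone hζ (hs n) (ih _)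

end Cone

/-! ### The maximal level up to a time -/

section MaximalLevel

variable {d : ℕ}

open Classical in
/-- The largest exponential of a level up to the time `t`. -/
noncomputable def supTo (θ : ℝ) (l : Site d) (t : ℕ∞) (ξ : ℕ → Letter d) : ℝ≥0∞ :=
  ⨆ n : ℕ, if (n : ℕ∞) ≤ t then ex θ (lev l ξ n) else 0

theorem le_supTo {θ : ℝ} {l : Site d} {t : ℕ∞} {ξ : ℕ → Letter d} {n : ℕ} (h : (n : ℕ∞) ≤ t) :
    ex θ (lev l ξ n) ≤ supTo θ l t ξ :=
  le_iSup_of_le n (by rw [if_pos h])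

theorem supTo_le {θ : ℝ} {l : Site d} {t : ℕ∞} {ξ : ℕ → Letter d} {a : ℝ≥0∞}
    (h : ∀ n : ℕ, (n : ℕ∞) ≤ t → ex θ (lev l ξ n) ≤ a) : supTo θ l t ξ ≤ a := by
  refine iSup_le fun n => ?_
  split_ifs with hn
  · exact h n hn
  · exact zero_le

theorem lev_zero (l : Site d) (ξ : ℕ → Letter d) : lev l ξ 0 = 0 := by simp [lev]

theorem one_le_supTo (θ : ℝ) (l : Site d) (t : ℕ∞) (ξ : ℕ → Letter d) : 1 ≤ supTo θ l t ξ := by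
  have h := le_supTo (θ := θ) (l := l) (t := t) (ξ := ξ) (n := 0) (by simp)
  rwa [lev_zero, ex_zero] at h

theorem supTo_length (θ : ℝ) (l : Site d) (w : List (Letter d)) (ξ : ℕ → Letter d) :
    supTo θ l w.length (cat w ξ) = wordMax θ l w := by
  apply le_antisymm
  · exact supTo_le fun n hn => ex_lev_le_wordMax θ l w ξ (by exact_mod_cast hn)
  · refine iSup₂_le fun n hn => ?_
    rw [← lev_cat ξ hn]
    exact le_supTo (by exact_mod_cast hn)

theorem supTo_add_length_le {θ : ℝ} (l : Site d) (t : ℕ∞) (w : List (Letter d))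
    (ξ : ℕ → Letter d) : supTo θ l (t + w.length) (cat w ξ) ≤ wordMax θ l w * supTo θ l t ξ := by
  refine supTo_le fun n hn => ?_
  rcases le_or_gt n w.length with h | h
  · exact (ex_lev_le_wordMax θ l w ξ h).trans (le_mul_of_one_le_right' (one_le_supTo θ l t ξ))
  · obtain ⟨j, rfl⟩ := Nat.exists_eq_add_of_le h.le
    have hj : (j : ℕ∞) ≤ t := by
      rw [Nat.cast_add, add_comm] at hn
      exact (ENat.add_le_add_iff_right (ENat.natCast_ne_top _)).1 hn
    rw [lev, pos_cat_add, pos_eq_add, add_dotProduct, ex_add]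
    refine mul_le_mul' ?_ (le_supTo hj)
    exact le_iSup₂_of_le w.length le_rfl (by rw [List.take_length])

theorem measurable_supTo (θ : ℝ) (l : Site d) {T : (ℕ → Letter d) → ℕ∞} (hT : IsStop T) :
    Measurable fun ξ => supTo θ l (T ξ) ξ := by
  classical
  exact Measurable.iSup fun n => Measurable.ite (hT.measurableSet_le n)
    (measurable_ex_lev θ l n) measurable_const

end MaximalLevel

section ConeMoment

variable {d : ℕ} {κ : Ellipticity d}

theorem wt_barWord (ω : Env d κ) (x : Site d) (l : Site d) (L : ℕ) :
    wt ω x (barWord l L) = ENNReal.ofReal κ ^ (barWord l L).length := by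
  unfold barWord
  induction barSeqL l L generalizing x with
  | nil => simp [wt]
  | cons e s ih =>
    rw [List.map_cons, wt, ih, letterProb_self, List.length_cons, pow_succ']

variable [NeZero d]

/-- After `N` copies of `ε̄`, a path which is confined at a scale small compared to `N` never
leaves the cone. -/
theorem Confined.coneTime_eq_top {R : Space d ≃ₗᵢ[ℝ] Space d} {ℓ : Space d}
    (hR : ∀ i : Fin d, i.val = 0 → R (EuclideanSpace.single i 1) = ℓ) (hℓ : ‖ℓ‖ = 1) {h : ℝ}
    (hh : 0 < h) {l : Site d} (hl : toSpace l = h • ℓ) {ρ : ℝ} (hρ : 0 < ρ) {ζ : ℝ} (hζ : 0 < ζ)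
    (hζ3 : ζ ≤ 1 / 2)
    (hζl : ∀ m : ℕ, 1 ≤ m → m ≤ l1 l → (((barSeq l).take m).map Dir.vec).sum ∈ cone l ζ 0)
    {m₀ N : ℕ} (hb : 0 < l1 l) {ξ : ℕ → Letter d} (hξ : Confined R ρ l ζ m₀ (pos 0 ξ))
    (hN : 8 * m₀ * (2 + d * ρ) ≤ N * h) :
    coneTime l ζ (cat (barWord l (N * l1 l)) ξ) = ⊤ := by
  rw [RWRE.coneTime_eq_top]
  intro n
  rcases le_or_gt n (barWord l (N * l1 l)).length with hn | hn
  · rw [pos_cat_eq_endpt_take _ _ _ hn]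
    exact endpt_barWord_mem_cone hζ.le hζl _ _
  obtain ⟨k, rfl⟩ := Nat.exists_eq_add_of_le hn.le
  rw [pos_cat_add, pos_eq_add]
  have hend := endpt_barWord_mem_cone hζ.le hζl (N * l1 l) (barWord l (N * l1 l)).length
  rw [List.take_length] at hend
  obtain ⟨-, T, hT1, hT2⟩ := hξ
  rcases le_or_gt T k with hk | hk
  · exact add_mem_cone hζ.le hend (hT2 k hk)
  · have hbox := (mem_box_zero R).1 (hT1 k hk)
    set y := pos 0 ξ k
    have hy2 : l2 y ≤ 4 * m₀ + d * (ρ * (4 * m₀)) := by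
      refine l2_le_of_crd_le (R := R) (by positivity) ?_ fun i hi => ?_
      · have := hbox.1.le; push_cast at this; exact this
      · have := (hbox.2 i hi).le; push_cast at this; exact this
    have hy1 := abs_lt.1 hbox.1
    push_cast at hy1
    rw [endpt_barWord_self, Nat.mul_div_cancel _ hb, mem_cone_zero, add_dotProduct,
      smul_dotProduct]
    have hll : ((l ⬝ᵥ l : ℤ) : ℝ) = h * h := by
      rw [← inner_toSpace, real_inner_self_eq_norm_sq]
      change l2 l ^ 2 = _
      rw [l2_eq_of_toSpace hℓ hh hl, sq]
    have hl2 : l2 (N • l) = N * h := by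
      have : toSpace (N • l) = (N : ℝ) • toSpace l := by
        ext i; simp [toSpace]
      rw [l2, this, norm_smul, Real.norm_natCast]
      change N * l2 l = _
      rw [l2_eq_of_toSpace hℓ hh hl]
    have htri := l2_add_le (N • l) y
    rw [hl2] at htri
    rw [Int.cast_add, nsmul_eq_mul N (l ⬝ᵥ l), Int.cast_mul, Int.cast_natCast, hll,
      dotProduct_eq_mul_crd hR hl, l2_eq_of_toSpace hℓ hh hl]
    have hm : (0 : ℝ) ≤ m₀ := by positivity
    have h1 : ζ * l2 (N • l + y) ≤ 1 / 2 * (N * h + (4 * m₀ + d * (ρ * (4 * m₀)))) :=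
      mul_le_mul hζ3 (by linarith) (l2_nonneg _) (by norm_num)
    have h2 : ζ * l2 (N • l + y) ≤ N * h + crd R y 0 := by
      have : (0 : ℝ) ≤ d * ρ * m₀ := by positivity
      nlinarith [hy1.1]
    calc ζ * h * l2 (N • l + y) = h * (ζ * l2 (N • l + y)) := by ring
      _ ≤ h * (N * h + crd R y 0) := by gcongr
      _ = _ := by ring

/-- With positive probability the walk never leaves the cone. -/
theorem lintegral_coneTime_eq_top_pos {P : Measure (Env d κ)} [IsProbabilityMeasure P]
    (hstat : IsStationary P) {R : Space d ≃ₗᵢ[ℝ] Space d} {ℓ : Space d}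
    (hR : ∀ i : Fin d, i.val = 0 → R (EuclideanSpace.single i 1) = ℓ) (hℓ : ‖ℓ‖ = 1) {h : ℝ}
    (hh : 0 < h) {l : Site d} (hl : toSpace l = h • ℓ) {ρ : ℝ} (hρ : 0 < ρ) {ζ : ℝ} (hζ : 0 < ζ)
    (hζ3 : ζ ≤ 1 / 2)
    (hζl : ∀ m : ℕ, 1 ≤ m → m ≤ l1 l → (((barSeq l).take m).map Dir.vec).sum ∈ cone l ζ 0)
    (hb : 0 < l1 l) {c : ℝ} (hc : 0 < c) {Z : (ℕ → Letter d) → ℝ≥0∞} (hZm : Measurable Z)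
    (hZint : ∫⁻ ω, ∫⁻ ξ, Z ξ ∂(walkKernel κ 0 ω) ∂P < ⊤)
    (hZ : ∀ ξ, Z ξ < ⊤ → ∃ m₀ : ℕ, 1 ≤ m₀ ∧ ENNReal.ofReal (Real.exp (c * m₀)) ≤ Z ξ ∧
      Confined R ρ l ζ m₀ (pos 0 ξ)) :
    0 < ∫⁻ ω, walkKernel κ 0 ω {ξ | coneTime l ζ ξ = ⊤} ∂P := by
  set I := ∫⁻ ω, ∫⁻ ξ, Z ξ ∂(walkKernel κ 0 ω) ∂P with hI
  -- the scale is below a deterministic bound with positive probability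
  set a : ℝ≥0∞ := I + 1 with ha
  have hatop : a ≠ ⊤ := ENNReal.add_ne_top.2 ⟨hZint.ne, ENNReal.one_ne_top⟩
  have ha0 : a ≠ 0 := by simp [ha]
  have hset : MeasurableSet {ξ | Z ξ < a} := measurableSet_lt hZm measurable_const
  have hpos : 0 < ∫⁻ ω, walkKernel κ 0 ω {ξ | Z ξ < a} ∂P := by
    rw [pos_iff_ne_zero]
    intro h0
    have h1 : a ≤ I := by
      calc a = ∫⁻ ω, a * (walkKernel κ 0 ω {ξ | Z ξ < a} +
              walkKernel κ 0 ω {ξ | Z ξ < a}ᶜ) ∂P := by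
            simp_rw [measure_add_measure_compl hset, measure_univ]
            simp
        _ = a * ∫⁻ ω, walkKernel κ 0 ω {ξ | Z ξ < a}ᶜ ∂P := by
            have hm : Measurable fun ω => walkKernel κ 0 ω {ξ | Z ξ < a} +
                walkKernel κ 0 ω {ξ | Z ξ < a}ᶜ :=
              (Kernel.measurable_coe _ hset).add (Kernel.measurable_coe _ hset.compl)
            rw [lintegral_const_mul _ hm,
              lintegral_add_left (Kernel.measurable_coe _ hset), h0, zero_add]
        _ = ∫⁻ ω, a * walkKernel κ 0 ω {ξ | Z ξ < a}ᶜ ∂P :=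
            (lintegral_const_mul _ (Kernel.measurable_coe _ hset.compl)).symm
        _ ≤ I := by
            refine lintegral_mono fun ω => ?_
            have : {ξ | Z ξ < a}ᶜ = {ξ | a ≤ Z ξ} := by
              ext ξ; simp
            rw [this]
            exact mul_meas_ge_le_lintegral hZm a
    exact absurd h1 (not_le.2 (ENNReal.lt_add_right hZint.ne one_ne_zero))
  obtain ⟨M, hM⟩ : ∃ M : ℕ, ∀ m₀ : ℕ, ENNReal.ofReal (Real.exp (c * m₀)) ≤ a → m₀ ≤ M := by
    refine ⟨⌈a.toReal / c⌉₊, fun m₀ hm => ?_⟩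
    rw [ENNReal.ofReal_le_iff_le_toReal hatop] at hm
    have h1 := Real.add_one_le_exp (c * m₀)
    have h2 : (m₀ : ℝ) ≤ a.toReal / c := by
      rw [le_div_iff₀ hc]; linarith
    exact_mod_cast h2.trans (Nat.le_ceil _)
  obtain ⟨N, hN⟩ : ∃ N : ℕ, 8 * M * (2 + d * ρ) ≤ N * h := by
    refine ⟨⌈8 * M * (2 + d * ρ) / h⌉₊, ?_⟩
    rw [← div_le_iff₀ hh]
    exact Nat.le_ceil _
  set w := barWord l (N * l1 l) with hw
  have hesc : ∀ ξ, Z ξ < a → coneTime l ζ (cat w ξ) = ⊤ := by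
    intro ξ hξ
    obtain ⟨m₀, -, h1, h2⟩ := hZ ξ (hξ.trans hatop.lt_top)
    refine h2.coneTime_eq_top hR hℓ hh hl hρ hζ hζ3 hζl hb (le_trans ?_ hN)
    have : (m₀ : ℝ) ≤ M := by exact_mod_cast hM m₀ (h1.trans hξ.le)
    gcongr
  have htop : MeasurableSet {ξ | coneTime l ζ ξ = ⊤} := by
    have := (isStop_coneTime l ζ).measurableSet_lt_top.compl
    convert this using 1
    ext ξ; simp
  have hlow : ∀ ω : Env d κ, ENNReal.ofReal κ ^ w.length *
      walkKernel κ (endpt 0 w) ω {ξ | Z ξ < a} ≤ walkKernel κ 0 ω {ξ | coneTime l ζ ξ = ⊤} := by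
    intro ω
    have h1 := setLIntegral_walkKernel_cyl ω 0 w ({ξ | coneTime l ζ ξ = ⊤}.indicator 1)
      (measurable_one.indicator htop)
    rw [hw, wt_barWord, ← hw] at h1
    calc ENNReal.ofReal κ ^ w.length * walkKernel κ (endpt 0 w) ω {ξ | Z ξ < a}
        ≤ ENNReal.ofReal κ ^ w.length * ∫⁻ ξ, {ξ | coneTime l ζ ξ = ⊤}.indicator 1 (cat w ξ)
            ∂(walkKernel κ (endpt 0 w) ω) := by
          rw [← lintegral_indicator_one hset]
          refine mul_le_mul' le_rfl (lintegral_mono fun ξ => ?_)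
          by_cases hξ : Z ξ < a
          · rw [Set.indicator_of_mem (show ξ ∈ {ξ | Z ξ < a} from hξ),
              Set.indicator_of_mem (show cat w ξ ∈ {ξ | coneTime l ζ ξ = ⊤} from hesc ξ hξ)]
            simp
          · rw [Set.indicator_of_notMem (show ξ ∉ {ξ | Z ξ < a} from hξ)]
            exact zero_le
      _ ≤ ∫⁻ ξ, {ξ | coneTime l ζ ξ = ⊤}.indicator 1 ξ ∂(walkKernel κ 0 ω) := by
          rw [← h1]
          exact setLIntegral_le_lintegral _ _
      _ = _ := lintegral_indicator_one htop
  have hshift := lintegral_walkKernel_shift hstat (endpt 0 w) ({ξ | Z ξ < a}.indicator 1)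
    (measurable_one.indicator hset)
  simp_rw [lintegral_indicator_one hset] at hshift
  refine lt_of_lt_of_le ?_ (lintegral_mono hlow)
  rw [lintegral_const_mul _ (Kernel.measurable_coe _ hset), hshift]
  refine ENNReal.mul_pos (pow_ne_zero _ ?_) hpos.ne'
  rw [Ne, ENNReal.ofReal_eq_zero, not_le]
  exact κ.2.1

/-- The exponential moment of the maximal level before the exit from the cone, on the event that
the walk exits, is less than one: it is close to the probability of this event. -/
theorem exists_coneMoment_le {P : Measure (Env d κ)} [IsProbabilityMeasure P]
    (hstat : IsStationary P) {R : Space d ≃ₗᵢ[ℝ] Space d} {ℓ : Space d}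
    (hR : ∀ i : Fin d, i.val = 0 → R (EuclideanSpace.single i 1) = ℓ) (hℓ : ‖ℓ‖ = 1) {h : ℝ}
    (hh : 0 < h) {l : Site d} (hl : toSpace l = h • ℓ) {ρ : ℝ} (hρ : 0 < ρ) {ζ : ℝ} (hζ : 0 < ζ)
    (hζ3 : ζ ≤ 1 / 2)
    (hζl : ∀ m : ℕ, 1 ≤ m → m ≤ l1 l → (((barSeq l).take m).map Dir.vec).sum ∈ cone l ζ 0)
    (hb : 0 < l1 l) {c : ℝ} (hc : 0 < c) {Z : (ℕ → Letter d) → ℝ≥0∞} (hZm : Measurable Z)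
    (hZint : ∫⁻ ω, ∫⁻ ξ, Z ξ ∂(walkKernel κ 0 ω) ∂P < ⊤)
    (hZ : ∀ ξ, Z ξ < ⊤ → ∃ m₀ : ℕ, 1 ≤ m₀ ∧ ENNReal.ofReal (Real.exp (c * m₀)) ≤ Z ξ ∧
      Confined R ρ l ζ m₀ (pos 0 ξ)) :
    ∃ θ₁ : ℝ, 0 < θ₁ ∧ ∃ q : ℝ≥0∞, q < 1 ∧ ∀ θ : ℝ, 0 < θ → θ ≤ θ₁ →
      ∑' g : stopWords (coneTime l ζ), (∫⁻ ω, wt ω 0 g.1 ∂P) * wordMax θ l g.1 ≤ q := by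
  have hp := lintegral_coneTime_eq_top_pos hstat hR hℓ hh hl hρ hζ hζ3 hζl hb hc hZm hZint hZ
  set p := ∫⁻ ω, walkKernel κ 0 ω {ξ | coneTime l ζ ξ = ⊤} ∂P with hpdef
  set I := ∫⁻ ω, ∫⁻ ξ, Z ξ ∂(walkKernel κ 0 ω) ∂P with hI
  have hexit := isStop_coneTime l ζ
  have hfin := hexit.measurableSet_lt_top
  set Pf := ∫⁻ ω, walkKernel κ 0 ω {ξ | coneTime l ζ ξ < ⊤} ∂P with hPf
  have hsum1 : Pf + p = 1 := by
    have hcompl : {ξ | coneTime l ζ ξ = ⊤} = {ξ | coneTime l ζ ξ < ⊤}ᶜ := by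
      ext ξ; simp
    rw [hPf, hpdef, hcompl, ← lintegral_add_left (Kernel.measurable_coe _ hfin)]
    simp_rw [measure_add_measure_compl hfin, measure_univ]
    simp
  have hPf1 : Pf < 1 := by
    rw [← hsum1]
    refine ENNReal.lt_add_right (ne_top_of_le_ne_top ENNReal.one_ne_top ?_) hp.ne'
    rw [← hsum1]; exact le_self_add
  obtain ⟨q, hq1, hq2⟩ := exists_between hPf1
  have hδ0 : 0 < (q - Pf).toReal := by
    rw [ENNReal.toReal_pos_iff]
    exact ⟨tsub_pos_of_lt hq1, (tsub_le_self.trans hq2.le).trans_lt ENNReal.one_lt_top⟩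
  set lam := min 1 ((q - Pf).toReal / (I.toReal + 1)) with hlam
  have hI0 : 0 ≤ I.toReal := ENNReal.toReal_nonneg
  have hlam0 : 0 < lam := lt_min one_pos (by positivity)
  have hlamI : ENNReal.ofReal lam * I ≤ q - Pf := by
    have h1 : lam * I.toReal ≤ (q - Pf).toReal := by
      calc lam * I.toReal ≤ (q - Pf).toReal / (I.toReal + 1) * (I.toReal + 1) := by
            refine mul_le_mul (min_le_right _ _) (by linarith) hI0 (by positivity)
        _ = _ := by field_simp
    calc ENNReal.ofReal lam * I = ENNReal.ofReal (lam * I.toReal) := by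
          rw [ENNReal.ofReal_mul hlam0.le, ENNReal.ofReal_toReal hZint.ne]
      _ ≤ ENNReal.ofReal (q - Pf).toReal := ENNReal.ofReal_le_ofReal h1
      _ ≤ _ := ENNReal.ofReal_toReal_le
  refine ⟨lam * (c / (4 * h)), by positivity, q, hq2, fun θ hθ hθ1 => ?_⟩
  have hmax := measurable_supTo θ l hexit
  -- the levels before the exit from the cone are of the order of the scale of confinement
  have hbound : ∀ ξ, coneTime l ζ ξ < ⊤ →
      supTo θ l (coneTime l ζ ξ) ξ ≤ 1 + ENNReal.ofReal lam * Z ξ := by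
    intro ξ hξ
    rcases eq_or_ne (Z ξ) ⊤ with htop | htop
    · rw [htop, ENNReal.mul_top (by simpa using hlam0)]
      simp
    obtain ⟨m₀, hm1, hm2, -, T, hT1, hT2⟩ := hZ ξ htop.lt_top
    refine supTo_le fun n hn => ?_
    have hnT : n < T := by
      by_contra hcon
      obtain ⟨N, hN⟩ := ENat.ne_top_iff_exists.1 hξ.ne
      have hN2 := hN.symm
      rw [coneTime_eq, firstTime_eq_coe] at hN2
      rw [← hN, Nat.cast_le] at hn
      exact hN2.1 (hT2 N (by omega))
    have h1 := ((mem_box_zero R).1 (hT1 n hnT)).1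
    have h2 : ((lev l ξ n : ℤ) : ℝ) ≤ h * (4 * m₀) := by
      rw [lev, dotProduct_eq_mul_crd hR hl]
      have := (le_abs_self _).trans h1.le
      push_cast at this
      gcongr
    have h3 : θ * lev l ξ n ≤ lam * (c * m₀) := by
      calc θ * lev l ξ n ≤ θ * (h * (4 * m₀)) := by gcongr
        _ ≤ lam * (c / (4 * h)) * (h * (4 * m₀)) := by gcongr
        _ = lam * (c * m₀) := by field_simp
    have h4 : Real.exp (lam * (c * m₀)) ≤ 1 + lam * Real.exp (c * m₀) := by
      have hcv := convexOn_exp.2 (Set.mem_univ 0) (Set.mem_univ (c * m₀))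
        (sub_nonneg.2 (min_le_left _ _ : lam ≤ 1)) hlam0.le (by ring)
      simp only [smul_eq_mul, mul_zero, zero_add, Real.exp_zero, mul_one] at hcv
      linarith
    calc ex θ (lev l ξ n) ≤ ENNReal.ofReal (1 + lam * Real.exp (c * m₀)) :=
          ENNReal.ofReal_le_ofReal ((Real.exp_le_exp.2 h3).trans h4)
      _ = 1 + ENNReal.ofReal lam * ENNReal.ofReal (Real.exp (c * m₀)) := by
          rw [ENNReal.ofReal_add zero_le_one (by positivity), ENNReal.ofReal_one,
            ENNReal.ofReal_mul hlam0.le]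
      _ ≤ _ := by gcongr
  calc ∑' g : stopWords (coneTime l ζ), (∫⁻ ω, wt ω 0 g.1 ∂P) * wordMax θ l g.1
      = ∫⁻ ω, ∑' g : stopWords (coneTime l ζ), wt ω 0 g.1 * wordMax θ l g.1 ∂P := by
        have hm : ∀ g : stopWords (coneTime l ζ), Measurable fun ω : Env d κ =>
            wt ω 0 g.1 * wordMax θ l g.1 := fun g => (measurable_wt 0 g.1).mul_const _
        rw [lintegral_tsum fun g => (hm g).aemeasurable]
        exact tsum_congr fun g => (lintegral_mul_const _ (measurable_wt 0 g.1)).symm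
    _ ≤ ∫⁻ ω, ∫⁻ ξ in {ξ | coneTime l ζ ξ < ⊤},
        supTo θ l (coneTime l ζ ξ) ξ ∂(walkKernel κ 0 ω) ∂P := by
        refine lintegral_mono fun ω => ?_
        rw [strong_markov ω 0 hexit _ hmax]
        refine ENNReal.tsum_le_tsum fun g => mul_le_mul' le_rfl ?_
        have h1 : ∀ ξ, supTo θ l (coneTime l ζ (cat g.1 ξ)) (cat g.1 ξ) = wordMax θ l g.1 := by
          intro ξ; rw [g.2 ξ, supTo_length]
        simp_rw [h1]
        rw [lintegral_const, measure_univ, mul_one]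
    _ ≤ ∫⁻ ω, (walkKernel κ 0 ω {ξ | coneTime l ζ ξ < ⊤} +
          ENNReal.ofReal lam * ∫⁻ ξ, Z ξ ∂(walkKernel κ 0 ω)) ∂P := by
        refine lintegral_mono fun ω => ?_
        calc ∫⁻ ξ in {ξ | coneTime l ζ ξ < ⊤}, supTo θ l (coneTime l ζ ξ) ξ ∂(walkKernel κ 0 ω)
            ≤ ∫⁻ ξ in {ξ | coneTime l ζ ξ < ⊤}, (1 + ENNReal.ofReal lam * Z ξ)
                ∂(walkKernel κ 0 ω) := setLIntegral_mono' hfin hbound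
          _ = walkKernel κ 0 ω {ξ | coneTime l ζ ξ < ⊤} + ENNReal.ofReal lam *
                ∫⁻ ξ in {ξ | coneTime l ζ ξ < ⊤}, Z ξ ∂(walkKernel κ 0 ω) := by
              rw [lintegral_add_left measurable_const, lintegral_const_mul _ hZm]
              simp
          _ ≤ _ := by
              gcongr
              exact Measure.restrict_le_self
    _ = Pf + ENNReal.ofReal lam * I := by
        rw [lintegral_add_left (Kernel.measurable_coe _ hfin),
          lintegral_const_mul _ hZm.lintegral_kernel]
    _ ≤ Pf + (q - Pf) := by gcongr
    _ = q := add_tsub_cancel_of_le hq1.le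

end ConeMoment

/-! ### The successive attempts at regeneration -/

section Attempts

variable {d : ℕ}

/-- The time `S_{k+1}` at which attempt number `k` starts, as a function of the letters. -/
noncomputable def attempt (l : Site d) (ζ : ℝ) (L k : ℕ) (ξ : ℕ → Letter d) : ℕ∞ :=
  timeS l ζ L (fun n => (ξ n).1) (pos 0 ξ) (k + 1)

/-- The time `R_k` after which attempt number `k` is sought; by convention `R_0 = 0`. -/
noncomputable def failure (l : Site d) (ζ : ℝ) (L : ℕ) : ℕ → (ℕ → Letter d) → ℕ∞
  | 0, _ => 0
  | k + 1, ξ => timeR l ζ L (fun n => (ξ n).1) (pos 0 ξ) (k + 1)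

theorem attempt_eq_firstTime {l : Site d} {ζ : ℝ} {L : ℕ} (hL : 0 < L) (k : ℕ)
    (ξ : ℕ → Letter d) :
    attempt l ζ L k ξ = firstTime {n | failure l ζ L k ξ < (n : ℕ∞) ∧ n ∈ cand l L ξ} := by
  cases k with
  | zero =>
    unfold attempt timeS failure
    congr 1
    ext n
    refine ⟨fun h => ⟨?_, h⟩, fun h => h.2⟩
    have : L ≤ n := h.1
    change (0 : ℕ∞) < n
    exact_mod_cast (by omega : 0 < n)
  | succ k => rfl

theorem failure_succ_of_top {l : Site d} {ζ : ℝ} {L k : ℕ} {ξ : ℕ → Letter d}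
    (h : attempt l ζ L k ξ = ⊤) : failure l ζ L (k + 1) ξ = ⊤ := by
  unfold attempt at h
  simp [failure, timeR, coneExitAfter, h]

theorem failure_succ_of_eq {l : Site d} {ζ : ℝ} {L k m : ℕ} {ξ : ℕ → Letter d}
    (h : attempt l ζ L k ξ = m) :
    failure l ζ L (k + 1) ξ = coneTime l ζ (fun i => ξ (m + i)) + m := by
  unfold attempt at h
  have hpos : (fun j => pos 0 ξ (m + j)) = fun j => pos 0 ξ m + pos 0 (fun i => ξ (m + i)) j := by
    funext j
    rw [pos_add, pos_eq_add]
  rw [failure, timeR, coneExitAfter, h, if_neg (ENat.natCast_ne_top m), ENat.toNat_natCast, hpos]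
  congr 1
  rw [coneTime_eq, coneExit, exitTime]
  congr 1
  ext j
  rw [Set.mem_ofPred_eq, Set.mem_ofPred_eq, pos_zero, add_zero, mem_cone_iff_sub,
    add_sub_cancel_left]

theorem failure_succ_cat {l : Site d} {ζ : ℝ} {L k : ℕ} {w : List (Letter d)} {ξ : ℕ → Letter d}
    (h : attempt l ζ L k (cat w ξ) = w.length) :
    failure l ζ L (k + 1) (cat w ξ) = coneTime l ζ ξ + w.length := by
  rw [failure_succ_of_eq h]
  simp_rw [cat_add]

theorem isStop_attempt_of_failure {l : Site d} {ζ : ℝ} {L k : ℕ} (hL : 0 < L)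
    (h : IsStop (failure l ζ L k)) : IsStop (attempt l ζ L k) := by
  have h1 := isStop_firstTime
    (fun ξ : ℕ → Letter d => {n | failure l ζ L k ξ < (n : ℕ∞) ∧ n ∈ cand l L ξ})
    fun n ξ ξ' hξ hn => by
      refine ⟨?_, mem_cand_of_congr hξ hn.2⟩
      obtain ⟨m, hm⟩ := ENat.ne_top_iff_exists.1 (hn.1.trans (ENat.natCast_lt_top n)).ne
      have hmn := hn.1
      rw [← hm, Nat.cast_lt] at hmn
      rw [h m ξ ξ' (fun i hi => hξ i (by omega)) hm.symm]
      exact_mod_cast hmn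
  intro n ξ ξ' hξ hn
  rw [attempt_eq_firstTime hL] at hn ⊢
  exact h1 n ξ ξ' hξ hn

theorem isStop_failure_succ {l : Site d} {ζ : ℝ} {L k : ℕ} (h : IsStop (attempt l ζ L k)) :
    IsStop (failure l ζ L (k + 1)) := by
  intro n ξ ξ' hξ hn
  rcases eq_or_ne (attempt l ζ L k ξ) ⊤ with htop | htop
  · rw [failure_succ_of_top htop] at hn
    exact absurd hn.symm (ENat.natCast_ne_top n)
  obtain ⟨m, hm⟩ := ENat.ne_top_iff_exists.1 htop
  rw [failure_succ_of_eq hm.symm] at hn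
  have hmn : m ≤ n := by
    have : (m : ℕ∞) ≤ n := by rw [← hn]; exact le_add_self
    exact_mod_cast this
  rw [failure_succ_of_eq (h m ξ ξ' (fun i hi => hξ i (by omega)) hm.symm), ← hn]
  congr 1
  obtain ⟨j, hj⟩ := ENat.ne_top_iff_exists.1
    (ne_top_of_le_ne_top (ENat.natCast_ne_top n) (hn ▸ le_self_add) :
      coneTime l ζ (fun i => ξ (m + i)) ≠ ⊤)
  rw [← hj] at hn ⊢
  have hjn : j + m = n := by exact_mod_cast hn
  exact isStop_coneTime l ζ j _ _ (fun i hi => hξ (m + i) (by omega)) hj.symm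

theorem isStop_failure (l : Site d) (ζ : ℝ) {L : ℕ} (hL : 0 < L) (k : ℕ) :
    IsStop (failure l ζ L k) := by
  induction k with
  | zero => exact fun n ξ ξ' _ h => h
  | succ k ih => exact isStop_failure_succ (isStop_attempt_of_failure hL ih)

theorem isStop_attempt (l : Site d) (ζ : ℝ) {L : ℕ} (hL : 0 < L) (k : ℕ) :
    IsStop (attempt l ζ L k) :=
  isStop_attempt_of_failure hL (isStop_failure l ζ hL k)

theorem failure_lt_top_of_attempt {l : Site d} {ζ : ℝ} {L : ℕ} (hL : 0 < L) {k : ℕ}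
    {ξ : ℕ → Letter d} (h : attempt l ζ L k ξ < ⊤) : failure l ζ L k ξ < ⊤ := by
  obtain ⟨n, hn⟩ := ENat.ne_top_iff_exists.1 h.ne
  have h1 := hn.symm
  rw [attempt_eq_firstTime hL, firstTime_eq_coe] at h1
  exact h1.1.1.trans (ENat.natCast_lt_top n)

theorem noCand_of_le_attempt {l : Site d} {ζ : ℝ} {L : ℕ} (hL : 0 < L) {k m n : ℕ}
    {ξ : ℕ → Letter d} (hm : failure l ζ L k ξ = m) (hn : (n : ℕ∞) ≤ attempt l ζ L k ξ) :
    noCand l L m n ξ := by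
  intro j h1 h2 h3
  rw [attempt_eq_firstTime hL] at hn
  have h4 := hn.trans (firstTime_le (n := j) ⟨by rw [hm]; exact_mod_cast h1, h3⟩)
  rw [Nat.cast_le] at h4
  omega

theorem mem_cand_of_attempt_eq {l : Site d} {ζ : ℝ} {L : ℕ} (hL : 0 < L) {k n : ℕ}
    {ξ : ℕ → Letter d} (h : attempt l ζ L k ξ = n) : n ∈ cand l L ξ := by
  rw [attempt_eq_firstTime hL, firstTime_eq_coe] at h
  exact h.1.2

end Attempts

/-! ### Decoupling at the start of an attempt -/

section Decoupling

variable {d : ℕ} {κ : Ellipticity d}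

/-- Where the symbols dictate the steps, a word that disobeys has weight zero. -/
theorem eq_map_or_wt_eq_zero (s : List (Dir d)) (v : List (Letter d))
    (h : v.map Prod.fst = s.map some) :
    v = s.map (fun e => (some e, e)) ∨ ∀ (ω : Env d κ) x, wt ω x v = 0 := by
  induction s generalizing v with
  | nil => left; simpa using h
  | cons e s ih =>
    cases v with
    | nil => simp at h
    | cons a v =>
      rw [List.map_cons, List.map_cons, List.cons.injEq] at h
      obtain ⟨a1, a2⟩ := a
      obtain ⟨h1, h2⟩ := h
      change a1 = some e at h1
      subst h1
      by_cases he : e = a2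
      · subst he
        rcases ih v h2 with h3 | h3
        · left; rw [h3, List.map_cons]
        · right; intro ω x; rw [wt, h3, mul_zero]
      · right; intro ω x; rw [wt, letterProb_ne _ _ _ he, zero_mul]

theorem sites_subset_cone {l : Site d} {ζ : ℝ} {g : List (Letter d)}
    (hg : g ∈ stopWords (coneTime l ζ)) (ξ : ℕ → Letter d) (z : Site d) :
    sites z g ⊆ cone l ζ z := by
  intro y hy
  obtain ⟨n, hn, rfl⟩ := (mem_sites ξ).1 hy
  have h := hg ξ
  rw [coneTime_eq, firstTime_eq_coe] at h
  have h2 : pos 0 (cat g ξ) n ∈ cone l ζ 0 := by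
    by_contra hcon
    exact h.2 n hn hcon
  rw [mem_cone_iff_sub, pos_eq_add, add_sub_cancel_left]
  exact h2

theorem l1_le_dotProduct_self (l : Site d) : (l1 l : ℤ) ≤ l ⬝ᵥ l := by
  unfold l1 dotProduct
  rw [Nat.cast_sum]
  refine Finset.sum_le_sum fun i _ => ?_
  rw [← Int.natAbs_mul_self]
  exact_mod_cast Nat.le_mul_self _

/-- The environment along the path before the last `L` steps of an attempt is nearly independent
of the environment in the cone based at its end; the weights of the last `L` steps do not depend on
the environment. -/
theorem lintegral_wt_mul_wt_le {P : Measure (Env d κ)} (hstat : IsStationary P) {l : Site d}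
    {ζ : ℝ} {L : ℕ} (hL : 0 < L) (hdvd : l1 l ∣ L) {S : ℝ}
    (hdec : ∀ (m : ℤ) (z : Site d) (Δ : Set (Site d)), Δ.Finite → Δ ⊆ cone l ζ z →
      m + L ≤ z ⬝ᵥ l → ∀ f₁ f₂ : Env d κ → ℝ≥0∞,
        Measurable[cylinderEvents {y : Site d | y ⬝ᵥ l < m}] f₁ →
        Measurable[cylinderEvents Δ] f₂ → ∫⁻ ω, f₁ ω * f₂ ω ∂P ≤
          ENNReal.ofReal (Real.exp S) * ((∫⁻ ω, f₁ ω ∂P) * ∫⁻ ω, f₂ ω ∂P))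
    (ξ : ℕ → Letter d) {k : ℕ} {w g : List (Letter d)} (hw : w ∈ stopWords (attempt l ζ L k))
    (hg : g ∈ stopWords (coneTime l ζ)) :
    ∫⁻ ω, wt ω 0 w * wt ω (endpt 0 w) g ∂P ≤
      ENNReal.ofReal (Real.exp S) * ((∫⁻ ω, wt ω 0 w ∂P) * ∫⁻ ω, wt ω 0 g ∂P) := by
  obtain ⟨h1, h2, h3⟩ := mem_cand_of_attempt_eq hL (hw ξ)
  set w' := w.take (w.length - L) with hw'
  set v := w.drop (w.length - L) with hv
  have hwv : w = w' ++ v := (List.take_append_drop _ _).symm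
  have hlen' : w'.length = w.length - L := by rw [hw', List.length_take]; omega
  have hlenv : v.length = L := by rw [hv, List.length_drop]; omega
  have hsym : v.map Prod.fst = (barSeqL l L).map some := by
    rw [← h3]
    apply List.ext_getElem
    · simp [hlenv]
    · intro i hi1 hi2
      simp only [List.length_map] at hi1
      rw [List.getElem_map, List.getElem_ofFn]
      simp only [hv, List.getElem_drop]
      rw [cat_lt _ _ _ (by omega)]
  rcases eq_map_or_wt_eq_zero (κ := κ) _ _ hsym with hbar | hzero
  swap
  · have h0 : ∀ ω : Env d κ, wt ω 0 w = 0 := by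
      intro ω; rw [hwv, wt_append, hzero, mul_zero]
    simp [h0]
  change v = barWord l L at hbar
  have hww : ∀ ω : Env d κ, wt ω 0 w = ENNReal.ofReal κ ^ L * wt ω 0 w' := by
    intro ω
    rw [hwv, wt_append, hbar, wt_barWord, length_barWord hdvd, mul_comm]
  set z := endpt 0 w with hz
  have hzeq : z = endpt 0 w' + (L / l1 l) • l := by
    rw [hz, hwv, endpt_append, endpt_eq_add, hbar, endpt_barWord_self]
  have hbpos : 0 < l1 l := Nat.pos_of_dvd_of_pos hdvd hL
  have hzl : endpt 0 w' ⬝ᵥ l + L ≤ z ⬝ᵥ l := by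
    rw [hzeq, add_dotProduct, smul_dotProduct, nsmul_eq_mul]
    have h4 : ((L / l1 l : ℕ) : ℤ) * l1 l = L := by exact_mod_cast Nat.div_mul_cancel hdvd
    have h5 : ((L / l1 l : ℕ) : ℤ) * l1 l ≤ ((L / l1 l : ℕ) : ℤ) * (l ⬝ᵥ l) :=
      mul_le_mul_of_nonneg_left (l1_le_dotProduct_self l) (by positivity)
    linarith
  have hsites : sites 0 w' ⊆ {y : Site d | y ⬝ᵥ l < endpt 0 w' ⬝ᵥ l} := by
    intro y hy
    obtain ⟨n, hn, rfl⟩ := (mem_sites (cat v ξ)).1 hy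
    rw [← cat_append, ← hwv]
    have h4 := h2 n (by omega)
    rw [← hlen'] at h4
    have h5 := pos_cat_length 0 w' (cat v ξ)
    rw [← cat_append, ← hwv] at h5
    rw [h5] at h4
    exact h4
  have hdec' := hdec _ z (sites z g) (sites_finite z g) (sites_subset_cone hg ξ z) hzl
    (fun ω => wt ω 0 w') (fun ω => wt ω z g) (measurable_wt_cylinderEvents _ _ _ hsites)
    (measurable_wt_cylinderEvents _ _ _ le_rfl)
  have hm : Measurable fun ω : Env d κ => wt ω 0 w' * wt ω z g :=
    (measurable_wt 0 w').mul (measurable_wt z g)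
  simp_rw [hww, mul_assoc]
  rw [lintegral_const_mul _ hm, lintegral_const_mul _ (measurable_wt 0 w')]
  calc ENNReal.ofReal κ ^ L * ∫⁻ ω, wt ω 0 w' * wt ω z g ∂P
      ≤ ENNReal.ofReal κ ^ L * (ENNReal.ofReal (Real.exp S) *
          ((∫⁻ ω, wt ω 0 w' ∂P) * ∫⁻ ω, wt ω z g ∂P)) := mul_le_mul' le_rfl hdec'
    _ = _ := by rw [lintegral_wt_shift hstat z g]; ring

end Decoupling

/-! ### The exponential moment of the maximal level up to an attempt -/

section Recursion

variable {d : ℕ} [NeZero d] {κ : Ellipticity d}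

/-- The exponential moment of the maximal level up to attempt number `k`, on the event that this
attempt is made or at least awaited. -/
noncomputable def attemptMoment (P : Measure (Env d κ)) (θ : ℝ) (l : Site d) (ζ : ℝ) (L k : ℕ) :
    ℝ≥0∞ :=
  ∫⁻ ω, ∫⁻ ξ in {ξ | failure l ζ L k ξ < ⊤}, supTo θ l (attempt l ζ L k ξ) ξ
    ∂(walkKernel κ 0 ω) ∂P

theorem exists_path : Nonempty (ℕ → Letter d) := ⟨fun _ => (none, (0, true))⟩

/-- The quenched form of the wait for attempt number `k` after failure number `k`. -/
theorem setLIntegral_supTo_attempt_le (ω : Env d κ) {l : Site d} {ζ : ℝ} {L : ℕ} (hL : 0 < L)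
    (hdvd : l1 l ∣ L) {c : ℝ} (hc : 0 ≤ c) (hcb : 8 * l1 l * c ≤ 1) (k : ℕ) :
    ∫⁻ ξ in {ξ | failure l ζ L k ξ < ⊤}, supTo (c * (κ : ℝ) ^ L) l (attempt l ζ L k ξ) ξ
        ∂(walkKernel κ 0 ω) ≤
      ENNReal.ofReal (Real.exp (c * l1 l) * (1 + 8 * l1 l * c)) *
        ∫⁻ ξ in {ξ | failure l ζ L k ξ < ⊤}, supTo (c * (κ : ℝ) ^ L) l (failure l ζ L k ξ) ξ
          ∂(walkKernel κ 0 ω) := by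
  classical
  have hfail := isStop_failure l ζ hL k
  rw [strong_markov ω 0 hfail _ (measurable_supTo _ l (isStop_attempt l ζ hL k)),
    strong_markov ω 0 hfail _ (measurable_supTo _ l hfail), ← ENNReal.tsum_mul_left]
  refine ENNReal.tsum_le_tsum fun w => ?_
  rw [mul_left_comm]
  refine mul_le_mul' le_rfl ?_
  have h1 : ∀ ξ, supTo (c * (κ : ℝ) ^ L) l (failure l ζ L k (cat w.1 ξ)) (cat w.1 ξ) =
      wordMax (c * (κ : ℝ) ^ L) l w.1 := by
    intro ξ; rw [w.2 ξ, supTo_length]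
  simp_rw [h1]
  rw [lintegral_const, measure_univ, mul_one]
  refine le_trans (lintegral_mono fun ξ => ?_) (lintegral_sup_until_cand_le ω hL hdvd hc hcb w.1)
  refine supTo_le fun n hn => le_iSup_of_le n ?_
  rw [if_pos (noCand_of_le_attempt hL (w.2 ξ) hn)]

theorem attemptMoment_zero_le (P : Measure (Env d κ)) [IsProbabilityMeasure P] {l : Site d} {ζ : ℝ}
    {L : ℕ} (hL : 0 < L) (hdvd : l1 l ∣ L) {c : ℝ} (hc : 0 ≤ c) (hcb : 8 * l1 l * c ≤ 1) :
    attemptMoment P (c * (κ : ℝ) ^ L) l ζ L 0 ≤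
      ENNReal.ofReal (Real.exp (c * l1 l) * (1 + 8 * l1 l * c)) := by
  have h1 : ∀ ω : Env d κ, ∫⁻ ξ in {ξ | failure l ζ L 0 ξ < ⊤},
      supTo (c * (κ : ℝ) ^ L) l (failure l ζ L 0 ξ) ξ ∂(walkKernel κ 0 ω) ≤ 1 := by
    intro ω
    have h2 : ∀ ξ : ℕ → Letter d, supTo (c * (κ : ℝ) ^ L) l (failure l ζ L 0 ξ) ξ ≤ 1 := by
      intro ξ
      refine supTo_le fun n hn => ?_
      have hn0 : n = 0 := by
        have : (n : ℕ∞) ≤ 0 := hn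
        exact_mod_cast nonpos_iff_eq_zero.1 this
      rw [hn0, lev_zero, ex_zero]
    calc _ ≤ ∫⁻ ξ, 1 ∂(walkKernel κ 0 ω) :=
          (setLIntegral_le_lintegral _ _).trans (lintegral_mono h2)
      _ = 1 := by simp
  calc attemptMoment P (c * (κ : ℝ) ^ L) l ζ L 0
      ≤ ∫⁻ _, ENNReal.ofReal (Real.exp (c * l1 l) * (1 + 8 * l1 l * c)) * 1 ∂P :=
        lintegral_mono fun ω => (setLIntegral_supTo_attempt_le ω hL hdvd hc hcb 0).trans
          (mul_le_mul' le_rfl (h1 ω))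
    _ = _ := by simp

/-- The path up to failure number `k + 1` splits at the start of attempt number `k` into two words,
the second of which is an excursion in the cone. -/
theorem setLIntegral_supTo_failure_le (ω : Env d κ) (θ : ℝ) (l : Site d) (ζ : ℝ) {L : ℕ}
    (hL : 0 < L) (k : ℕ) :
    ∫⁻ ξ in {ξ | failure l ζ L (k + 1) ξ < ⊤}, supTo θ l (failure l ζ L (k + 1) ξ) ξ
        ∂(walkKernel κ 0 ω) ≤
      ∑' w : stopWords (attempt l ζ L k), ∑' g : stopWords (coneTime l ζ),
        wordMax θ l w.1 * wordMax θ l g.1 * (wt ω 0 w.1 * wt ω (endpt 0 w.1) g.1) := by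
  have hfail := isStop_failure l ζ hL (k + 1)
  have hatt := isStop_attempt l ζ hL k
  have hcone := isStop_coneTime l ζ
  set F := {ξ | failure l ζ L (k + 1) ξ < ⊤}.indicator
    fun ξ => supTo θ l (failure l ζ L (k + 1) ξ) ξ with hF
  have hFm : Measurable F := (measurable_supTo θ l hfail).indicator hfail.measurableSet_lt_top
  have hsub : {ξ | failure l ζ L (k + 1) ξ < ⊤} ⊆ {ξ | attempt l ζ L k ξ < ⊤} := by
    intro ξ hξ
    rw [Set.mem_ofPred_eq, lt_top_iff_ne_top]
    intro htop
    exact hξ.ne (failure_succ_of_top htop)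
  have h1 : ∫⁻ ξ in {ξ | failure l ζ L (k + 1) ξ < ⊤},
      supTo θ l (failure l ζ L (k + 1) ξ) ξ ∂(walkKernel κ 0 ω) ≤
      ∫⁻ ξ in {ξ | attempt l ζ L k ξ < ⊤}, F ξ ∂(walkKernel κ 0 ω) := by
    rw [hF, setLIntegral_indicator hfail.measurableSet_lt_top, Set.inter_eq_left.2 hsub]
  refine h1.trans ?_
  rw [strong_markov ω 0 hatt F hFm]
  refine ENNReal.tsum_le_tsum fun w => ?_
  calc wt ω 0 w.1 * ∫⁻ ξ, F (cat w.1 ξ) ∂(walkKernel κ (endpt 0 w.1) ω)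
      ≤ wt ω 0 w.1 * ∫⁻ ξ in {ξ | coneTime l ζ ξ < ⊤},
          wordMax θ l w.1 * supTo θ l (coneTime l ζ ξ) ξ ∂(walkKernel κ (endpt 0 w.1) ω) := by
        refine mul_le_mul' le_rfl ?_
        rw [← lintegral_indicator hcone.measurableSet_lt_top]
        refine lintegral_mono fun ξ => ?_
        have h2 := failure_succ_cat (w.2 ξ)
        by_cases h3 : coneTime l ζ ξ < ⊤
        · rw [Set.indicator_of_mem (show ξ ∈ {ξ | coneTime l ζ ξ < ⊤} from h3)]
          refine le_trans (Set.indicator_le_self' (fun _ _ => zero_le) _) ?_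
          rw [h2]
          exact supTo_add_length_le l _ _ _
        · rw [hF, Set.indicator_of_notMem]
          · exact zero_le
          · rw [Set.mem_ofPred_eq, h2]
            rw [not_lt, top_le_iff] at h3
            simp [h3]
    _ = _ := by
        rw [strong_markov ω _ hcone _ ((measurable_supTo θ l hcone).const_mul _),
          ← ENNReal.tsum_mul_left]
        refine tsum_congr fun g => ?_
        have h2 : ∀ ξ, supTo θ l (coneTime l ζ (cat g.1 ξ)) (cat g.1 ξ) = wordMax θ l g.1 := by
          intro ξ; rw [g.2 ξ, supTo_length]
        simp_rw [h2]
        rw [lintegral_const, measure_univ, mul_one]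
        ring

theorem lintegral_tsum_const_mul {α ι : Type*} [MeasurableSpace α] [Countable ι] (μ : Measure α)
    (a : ι → ℝ≥0∞) {f : ι → α → ℝ≥0∞} (hf : ∀ i, Measurable (f i)) :
    ∫⁻ x, ∑' i, a i * f i x ∂μ = ∑' i, a i * ∫⁻ x, f i x ∂μ := by
  rw [lintegral_tsum fun i => ((hf i).const_mul _).aemeasurable]
  exact tsum_congr fun i => lintegral_const_mul _ (hf i)

theorem lintegral_tsum_tsum_const_mul {α ι ι' : Type*} [MeasurableSpace α] [Countable ι]
    [Countable ι'] (μ : Measure α) (a : ι → ι' → ℝ≥0∞) {f : ι → ι' → α → ℝ≥0∞}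
    (hf : ∀ i j, Measurable (f i j)) :
    ∫⁻ x, ∑' i, ∑' j, a i j * f i j x ∂μ = ∑' i, ∑' j, a i j * ∫⁻ x, f i j x ∂μ := by
  rw [lintegral_tsum fun i => (Measurable.tsum fun j => (hf i j).const_mul _).aemeasurable]
  exact tsum_congr fun i => lintegral_tsum_const_mul μ _ (hf i)

/-- The annealed weights of the words ending at an attempt, each multiplied by the largest
exponential along the word, add up to at most the moment of that attempt. -/
theorem tsum_wordMax_mul_le (P : Measure (Env d κ)) (θ : ℝ) (l : Site d) (ζ : ℝ) {L : ℕ}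
    (hL : 0 < L) (k : ℕ) :
    ∑' w : stopWords (attempt l ζ L k), wordMax θ l w.1 * ∫⁻ ω, wt ω 0 w.1 ∂P ≤
      attemptMoment P θ l ζ L k := by
  have hatt := isStop_attempt l ζ hL k
  calc ∑' w : stopWords (attempt l ζ L k), wordMax θ l w.1 * ∫⁻ ω, wt ω 0 w.1 ∂P
      = ∫⁻ ω, ∑' w : stopWords (attempt l ζ L k), wordMax θ l w.1 * wt ω 0 w.1 ∂P :=
        (lintegral_tsum_const_mul P (fun w : stopWords (attempt l ζ L k) => wordMax θ l w.1)
          fun w => measurable_wt 0 w.1).symm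
    _ = ∫⁻ ω, ∫⁻ ξ in {ξ | attempt l ζ L k ξ < ⊤}, supTo θ l (attempt l ζ L k ξ) ξ
          ∂(walkKernel κ 0 ω) ∂P := by
        refine lintegral_congr fun ω => ?_
        rw [strong_markov ω 0 hatt _ (measurable_supTo θ l hatt)]
        refine tsum_congr fun w => ?_
        have h2 : ∀ ξ, supTo θ l (attempt l ζ L k (cat w.1 ξ)) (cat w.1 ξ) =
            wordMax θ l w.1 := by
          intro ξ; rw [w.2 ξ, supTo_length]
        simp_rw [h2]
        rw [lintegral_const, measure_univ, mul_one, mul_comm]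
    _ ≤ _ := lintegral_mono fun ω =>
        lintegral_mono_set fun ξ hξ => failure_lt_top_of_attempt hL hξ

/-- One more failure multiplies the moment by a factor less than one: the cost of the excursion in
the cone, up to the errors due to the wait and to the mixing. -/
theorem attemptMoment_succ_le {P : Measure (Env d κ)} (hstat : IsStationary P) {l : Site d}
    {ζ : ℝ} {L : ℕ} (hL : 0 < L) (hdvd : l1 l ∣ L) {c : ℝ} (hc : 0 ≤ c)
    (hcb : 8 * l1 l * c ≤ 1) {S : ℝ}
    (hdec : ∀ (m : ℤ) (z : Site d) (Δ : Set (Site d)), Δ.Finite → Δ ⊆ cone l ζ z →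
      m + L ≤ z ⬝ᵥ l → ∀ f₁ f₂ : Env d κ → ℝ≥0∞,
        Measurable[cylinderEvents {y : Site d | y ⬝ᵥ l < m}] f₁ →
        Measurable[cylinderEvents Δ] f₂ → ∫⁻ ω, f₁ ω * f₂ ω ∂P ≤
          ENNReal.ofReal (Real.exp S) * ((∫⁻ ω, f₁ ω ∂P) * ∫⁻ ω, f₂ ω ∂P))
    {q : ℝ≥0∞} (hq : ∑' g : stopWords (coneTime l ζ), (∫⁻ ω, wt ω 0 g.1 ∂P) *
      wordMax (c * (κ : ℝ) ^ L) l g.1 ≤ q) (k : ℕ) :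
    attemptMoment P (c * (κ : ℝ) ^ L) l ζ L (k + 1) ≤
      ENNReal.ofReal (Real.exp (c * l1 l) * (1 + 8 * l1 l * c)) * (ENNReal.ofReal (Real.exp S) *
        q) * attemptMoment P (c * (κ : ℝ) ^ L) l ζ L k := by
  set θ := c * (κ : ℝ) ^ L with hθ
  set A := ENNReal.ofReal (Real.exp (c * l1 l) * (1 + 8 * l1 l * c)) with hA
  obtain ⟨ξ₀⟩ := exists_path (d := d)
  have hmeas : ∀ (w : stopWords (attempt l ζ L k)) (g : stopWords (coneTime l ζ)),
      Measurable fun ω : Env d κ => wt ω 0 w.1 * wt ω (endpt 0 w.1) g.1 := fun w g =>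
    (measurable_wt 0 w.1).mul (measurable_wt _ g.1)
  calc attemptMoment P θ l ζ L (k + 1)
      ≤ ∫⁻ ω, A * ∑' w : stopWords (attempt l ζ L k), ∑' g : stopWords (coneTime l ζ),
          wordMax θ l w.1 * wordMax θ l g.1 * (wt ω 0 w.1 * wt ω (endpt 0 w.1) g.1) ∂P :=
        lintegral_mono fun ω => (setLIntegral_supTo_attempt_le ω hL hdvd hc hcb (k + 1)).trans
          (mul_le_mul' le_rfl (setLIntegral_supTo_failure_le ω θ l ζ hL k))
    _ = A * ∑' w : stopWords (attempt l ζ L k), ∑' g : stopWords (coneTime l ζ),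
          wordMax θ l w.1 * wordMax θ l g.1 *
            ∫⁻ ω, wt ω 0 w.1 * wt ω (endpt 0 w.1) g.1 ∂P := by
        rw [lintegral_const_mul _ (Measurable.tsum fun w => Measurable.tsum fun g =>
          (hmeas w g).const_mul (wordMax θ l w.1 * wordMax θ l g.1)),
          lintegral_tsum_tsum_const_mul P _ hmeas]
    _ ≤ A * ∑' w : stopWords (attempt l ζ L k), ∑' g : stopWords (coneTime l ζ),
          wordMax θ l w.1 * wordMax θ l g.1 * (ENNReal.ofReal (Real.exp S) *
            ((∫⁻ ω, wt ω 0 w.1 ∂P) * ∫⁻ ω, wt ω 0 g.1 ∂P)) := by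
        gcongr with w g
        exact lintegral_wt_mul_wt_le hstat hL hdvd hdec ξ₀ w.2 g.2
    _ = A * (ENNReal.ofReal (Real.exp S) * (∑' g : stopWords (coneTime l ζ),
          (∫⁻ ω, wt ω 0 g.1 ∂P) * wordMax θ l g.1)) *
            ∑' w : stopWords (attempt l ζ L k), wordMax θ l w.1 * ∫⁻ ω, wt ω 0 w.1 ∂P := by
        rw [mul_assoc]
        congr 1
        rw [← ENNReal.tsum_mul_left]
        refine tsum_congr fun w => ?_
        rw [← ENNReal.tsum_mul_left, ← ENNReal.tsum_mul_right]
        refine tsum_congr fun g => ?_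
        ring
    _ ≤ _ := by
        gcongr
        exact tsum_wordMax_mul_le P θ l ζ hL k

theorem attemptMoment_le {P : Measure (Env d κ)} [IsProbabilityMeasure P] (hstat : IsStationary P)
    {l : Site d} {ζ : ℝ} {L : ℕ} (hL : 0 < L) (hdvd : l1 l ∣ L) {c : ℝ} (hc : 0 ≤ c)
    (hcb : 8 * l1 l * c ≤ 1) {S : ℝ}
    (hdec : ∀ (m : ℤ) (z : Site d) (Δ : Set (Site d)), Δ.Finite → Δ ⊆ cone l ζ z →
      m + L ≤ z ⬝ᵥ l → ∀ f₁ f₂ : Env d κ → ℝ≥0∞,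
        Measurable[cylinderEvents {y : Site d | y ⬝ᵥ l < m}] f₁ →
        Measurable[cylinderEvents Δ] f₂ → ∫⁻ ω, f₁ ω * f₂ ω ∂P ≤
          ENNReal.ofReal (Real.exp S) * ((∫⁻ ω, f₁ ω ∂P) * ∫⁻ ω, f₂ ω ∂P))
    {q : ℝ≥0∞} (hq : ∑' g : stopWords (coneTime l ζ), (∫⁻ ω, wt ω 0 g.1 ∂P) *
      wordMax (c * (κ : ℝ) ^ L) l g.1 ≤ q) (k : ℕ) :
    attemptMoment P (c * (κ : ℝ) ^ L) l ζ L k ≤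
      ENNReal.ofReal (Real.exp (c * l1 l) * (1 + 8 * l1 l * c)) *
        (ENNReal.ofReal (Real.exp (c * l1 l) * (1 + 8 * l1 l * c)) *
          (ENNReal.ofReal (Real.exp S) * q)) ^ k := by
  induction k with
  | zero => simpa using attemptMoment_zero_le P hL hdvd hc hcb
  | succ k ih =>
    refine (attemptMoment_succ_le hstat hL hdvd hc hcb hdec hq k).trans ?_
    refine (mul_le_mul' le_rfl ih).trans (le_of_eq ?_)
    ring

end Recursion

/-! ### The regeneration time -/

section Regeneration

variable {d : ℕ}

/-- The sum over the attempts of the largest exponential of a level up to the attempt. -/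
noncomputable def attemptSum (θ : ℝ) (l : Site d) (ζ : ℝ) (L : ℕ) (ξ : ℕ → Letter d) : ℝ≥0∞ :=
  ∑' k, {ξ | failure l ζ L k ξ < ⊤}.indicator (fun ξ => supTo θ l (attempt l ζ L k ξ) ξ) ξ

theorem measurable_supTo_attempt_indicator (θ : ℝ) (l : Site d) (ζ : ℝ) {L : ℕ} (hL : 0 < L)
    (k : ℕ) : Measurable ({ξ | failure l ζ L k ξ < ⊤}.indicator
      fun ξ => supTo θ l (attempt l ζ L k ξ) ξ) :=
  (measurable_supTo θ l (isStop_attempt l ζ hL k)).indicator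
    (isStop_failure l ζ hL k).measurableSet_lt_top

theorem measurable_attemptSum (θ : ℝ) (l : Site d) (ζ : ℝ) {L : ℕ} (hL : 0 < L) :
    Measurable (attemptSum θ l ζ L) :=
  Measurable.tsum fun k => measurable_supTo_attempt_indicator θ l ζ hL k

theorem supTo_attempt_le_attemptSum {θ : ℝ} {l : Site d} {ζ : ℝ} {L k : ℕ} {ξ : ℕ → Letter d}
    (h : failure l ζ L k ξ < ⊤) : supTo θ l (attempt l ζ L k ξ) ξ ≤ attemptSum θ l ζ L ξ := by
  refine le_trans ?_ (ENNReal.le_tsum k)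
  rw [Set.indicator_of_mem (show ξ ∈ {ξ | failure l ζ L k ξ < ⊤} from h)]

/-- If the levels are unbounded and the sum over the attempts is finite, then some attempt succeeds:
an endless wait would make one term infinite, and infinitely many failures would make infinitely
many terms at least one. -/
theorem exists_tau1_eq_attempt {θ : ℝ} {l : Site d} {ζ : ℝ} {L : ℕ} (hL : 0 < L)
    {ξ : ℕ → Letter d} (hunb : ∀ a : ℝ≥0∞, a < ⊤ → ∃ n, a < ex θ (lev l ξ n))
    (hfin : attemptSum θ l ζ L ξ < ⊤) :
    tau1 l ζ L (fun n => (ξ n).1) (pos 0 ξ) < ⊤ ∧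
      supTo θ l (tau1 l ζ L (fun n => (ξ n).1) (pos 0 ξ)) ξ ≤ attemptSum θ l ζ L ξ := by
  have hwait : ∀ k, failure l ζ L k ξ < ⊤ → attempt l ζ L k ξ < ⊤ := by
    intro k hk
    rw [lt_top_iff_ne_top]
    intro htop
    obtain ⟨n, hn⟩ := hunb _ hfin
    have h1 := supTo_attempt_le_attemptSum (θ := θ) hk
    rw [htop] at h1
    exact absurd hn (not_lt.2 ((le_supTo le_top).trans h1))
  have hsucc : ∃ k, failure l ζ L k ξ < ⊤ ∧ failure l ζ L (k + 1) ξ = ⊤ := by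
    by_contra! hcon
    have hall : ∀ k, failure l ζ L k ξ < ⊤ := by
      intro k
      induction k with
      | zero => exact ENat.natCast_lt_top 0
      | succ k ih => exact (hcon k ih).lt_top
    have h1 : (∑' _k : ℕ, (1 : ℝ≥0∞)) ≤ attemptSum θ l ζ L ξ := by
      refine ENNReal.tsum_le_tsum fun k => ?_
      rw [Set.indicator_of_mem (show ξ ∈ {ξ | failure l ζ L k ξ < ⊤} from hall k)]
      exact one_le_supTo _ _ _ _
    rw [ENNReal.tsum_const_eq_top_of_ne_zero one_ne_zero] at h1
    exact absurd hfin (not_lt.2 h1)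
  obtain ⟨k, hk1, hk2⟩ := hsucc
  obtain ⟨K, ⟨hK1, hK2, -⟩, hK⟩ := exists_firstTime_eq (s := {k | 1 ≤ k ∧
    timeS l ζ L (fun n => (ξ n).1) (pos 0 ξ) k < ⊤ ∧
      timeR l ζ L (fun n => (ξ n).1) (pos 0 ξ) k = ⊤}) ⟨k + 1, by omega, hwait k hk1, hk2⟩
  obtain ⟨j, rfl⟩ : ∃ j, K = j + 1 := ⟨K - 1, by omega⟩
  have htau : tau1 l ζ L (fun n => (ξ n).1) (pos 0 ξ) = attempt l ζ L j ξ := by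
    have h1 : indexK l ζ L (fun n => (ξ n).1) (pos 0 ξ) = ((j + 1 : ℕ) : ℕ∞) := hK
    rw [tau1, h1, if_neg (ENat.natCast_ne_top _), ENat.toNat_natCast]
    rfl
  rw [htau]
  exact ⟨hK2, supTo_attempt_le_attemptSum (failure_lt_top_of_attempt hL hK2)⟩

variable [NeZero d]

theorem Confined.exists_lt_ex {R : Space d ≃ₗᵢ[ℝ] Space d} {ℓ : Space d}
    (hR : ∀ i : Fin d, i.val = 0 → R (EuclideanSpace.single i 1) = ℓ) {h : ℝ} (hh : 0 < h)
    {l : Site d} (hl : toSpace l = h • ℓ) {ρ ζ : ℝ} {m₀ : ℕ} {ξ : ℕ → Letter d}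
    (hξ : Confined R ρ l ζ m₀ (pos 0 ξ)) {θ : ℝ} (hθ : 0 < θ) (a : ℝ≥0∞) (ha : a < ⊤) :
    ∃ n, a < ex θ (lev l ξ n) := by
  obtain ⟨M, hM⟩ := exists_nat_gt (a.toReal / (θ * h))
  obtain ⟨T, -, hT⟩ := hξ.1 (max M m₀) (le_max_right _ _)
  refine ⟨T, (ENNReal.lt_ofReal_iff_toReal_lt ha.ne).2 ?_⟩
  rw [div_lt_iff₀ (by positivity)] at hM
  have h1 : (M : ℝ) ≤ crd R (pos 0 ξ T) 0 := le_trans (by exact_mod_cast le_max_left M m₀) hT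
  rw [lev, dotProduct_eq_mul_crd hR hl]
  have h2 := Real.add_one_le_exp (θ * (h * crd R (pos 0 ξ T) 0))
  have h3 : M * (θ * h) ≤ crd R (pos 0 ξ T) 0 * (θ * h) := by gcongr
  linarith

/-- As long as the levels stay below `log W / θ`, the path has not left a box of a size given by
this bound and the scale of confinement. -/
theorem Confined.l2_le_of_supTo_le {R : Space d ≃ₗᵢ[ℝ] Space d} {ℓ : Space d}
    (hR : ∀ i : Fin d, i.val = 0 → R (EuclideanSpace.single i 1) = ℓ) {h : ℝ} (hh : 0 < h)
    {l : Site d} (hl : toSpace l = h • ℓ) {ρ ζ : ℝ} (hρ : 0 < ρ) {m₀ : ℕ} {ξ : ℕ → Letter d}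
    (hξ : Confined R ρ l ζ m₀ (pos 0 ξ)) {θ : ℝ} (hθ : 0 < θ) {t : ℕ∞} {W : ℝ} (hW : 1 ≤ W)
    (hsup : supTo θ l t ξ ≤ ENNReal.ofReal W) {n : ℕ} (hn : (n : ℕ∞) ≤ t) :
    l2 (pos 0 ξ n) ≤ (1 + d * ρ) * (m₀ + 1 + Real.log W / (θ * h)) := by
  have hlog : 0 ≤ Real.log W / (θ * h) := div_nonneg (Real.log_nonneg hW) (by positivity)
  set M := m₀ + ⌊Real.log W / (θ * h)⌋₊ + 1 with hM
  have hM1 : Real.log W / (θ * h) < M := by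
    refine (Nat.lt_floor_add_one _).trans_le ?_
    rw [hM]
    push_cast
    have : (0 : ℝ) ≤ m₀ := by positivity
    linarith
  have hM2 : (M : ℝ) ≤ m₀ + 1 + Real.log W / (θ * h) := by
    rw [hM]
    push_cast
    linarith [Nat.floor_le hlog]
  obtain ⟨T, hT1, hT2⟩ := hξ.1 M (by omega)
  have hnT : n < T := by
    by_contra hcon
    have h1 : ((T : ℕ) : ℕ∞) ≤ t := le_trans (by exact_mod_cast not_lt.1 hcon) hn
    have h2 := (le_supTo (θ := θ) (l := l) (ξ := ξ) h1).trans hsup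
    rw [ex, ENNReal.ofReal_le_ofReal_iff (by linarith), ← Real.le_log_iff_exp_le (by linarith),
      lev, dotProduct_eq_mul_crd hR hl] at h2
    rw [div_lt_iff₀ (by positivity)] at hM1
    have h3 : M * (θ * h) ≤ crd R (pos 0 ξ T) 0 * (θ * h) := by gcongr
    linarith
  have hbox := (mem_box_zero R).1 (hT1 n hnT)
  calc l2 (pos 0 ξ n) ≤ M + d * (ρ * M) :=
        l2_le_of_crd_le (by positivity) hbox.1.le fun i hi => (hbox.2 i hi).le
    _ = (1 + d * ρ) * M := by ring
    _ ≤ _ := by gcongr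

variable {κ : Ellipticity d}

theorem lintegral_attemptSum (P : Measure (Env d κ)) (θ : ℝ) (l : Site d) (ζ : ℝ) {L : ℕ}
    (hL : 0 < L) : ∫⁻ ω, ∫⁻ ξ, attemptSum θ l ζ L ξ ∂(walkKernel κ 0 ω) ∂P =
      ∑' k, attemptMoment P θ l ζ L k := by
  have hm := measurable_supTo_attempt_indicator θ l ζ hL
  have h1 : ∀ ω : Env d κ, ∫⁻ ξ, attemptSum θ l ζ L ξ ∂(walkKernel κ 0 ω) =
      ∑' k, ∫⁻ ξ, {ξ | failure l ζ L k ξ < ⊤}.indicator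
        (fun ξ => supTo θ l (attempt l ζ L k ξ) ξ) ξ ∂(walkKernel κ 0 ω) :=
    fun ω => lintegral_tsum fun k => (hm k).aemeasurable
  simp_rw [h1]
  rw [lintegral_tsum fun k => (hm k).lintegral_kernel.aemeasurable]
  refine tsum_congr fun k => lintegral_congr fun ω => ?_
  rw [lintegral_indicator (isStop_failure l ζ hL k).measurableSet_lt_top]

/-- The moments of the attempts decay geometrically, at a rate that does not depend on `L`. -/
theorem exists_tsum_attemptMoment_le {P : Measure (Env d κ)} [IsProbabilityMeasure P]
    (hstat : IsStationary P) {l : Site d} {ζ : ℝ} {S : ℕ → ℝ} (hS : Tendsto S atTop (nhds 0))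
    {L₁ : ℕ} (hdec : ∀ L ≥ L₁, ∀ (m : ℤ) (z : Site d) (Δ : Set (Site d)), Δ.Finite →
      Δ ⊆ cone l ζ z → m + L ≤ z ⬝ᵥ l → ∀ f₁ f₂ : Env d κ → ℝ≥0∞,
        Measurable[cylinderEvents {y : Site d | y ⬝ᵥ l < m}] f₁ →
        Measurable[cylinderEvents Δ] f₂ → ∫⁻ ω, f₁ ω * f₂ ω ∂P ≤
          ENNReal.ofReal (Real.exp (S L)) * ((∫⁻ ω, f₁ ω ∂P) * ∫⁻ ω, f₂ ω ∂P))
    {θ₁ : ℝ} (hθ₁ : 0 < θ₁) {q : ℝ≥0∞} (hq1 : q < 1)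
    (hq : ∀ θ : ℝ, 0 < θ → θ ≤ θ₁ → ∑' g : stopWords (coneTime l ζ),
      (∫⁻ ω, wt ω 0 g.1 ∂P) * wordMax θ l g.1 ≤ q) :
    ∃ c : ℝ, 0 < c ∧ ∃ B : ℝ≥0∞, B < ⊤ ∧ ∃ L₂ : ℕ, ∀ L, L₂ ≤ L → 0 < L → l1 l ∣ L →
      ∑' k, attemptMoment P (c * (κ : ℝ) ^ L) l ζ L k ≤ B := by
  have hκ0 : (0 : ℝ) < κ := κ.2.1
  have hκ1 : (κ : ℝ) ≤ 1 := by linarith [kappa_le_quarter κ]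
  obtain ⟨q', hq', hq'1⟩ := exists_between hq1
  have hqtop : q ≠ ⊤ := (hq1.trans ENNReal.one_lt_top).ne
  have hq'top : q' ≠ ⊤ := (hq'1.trans ENNReal.one_lt_top).ne
  have hqr : q.toReal < q'.toReal := (ENNReal.toReal_lt_toReal hqtop hq'top).2 hq'
  -- the factor due to the waits is close to `1` when `c` is small
  have hcont : Tendsto (fun c : ℝ => Real.exp (c * l1 l) * (1 + 8 * l1 l * c) * q.toReal)
      (nhdsWithin 0 (Set.Ioi 0)) (nhds q.toReal) := by
    have h1 : Continuous fun c : ℝ => Real.exp (c * l1 l) * (1 + 8 * l1 l * c) * q.toReal := by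
      fun_prop
    have h2 := h1.tendsto 0
    simp only [zero_mul, Real.exp_zero, mul_zero, add_zero, one_mul] at h2
    exact h2.mono_left nhdsWithin_le_nhds
  have hsmall : ∀ᶠ c : ℝ in nhdsWithin 0 (Set.Ioi 0), 8 * l1 l * c < 1 := by
    have h1 : Continuous fun c : ℝ => 8 * (l1 l : ℝ) * c := by fun_prop
    have h2 := h1.tendsto 0
    rw [mul_zero] at h2
    exact (h2.mono_left nhdsWithin_le_nhds).eventually_lt_const one_pos
  obtain ⟨c, ⟨⟨hc1, hc2⟩, hc3⟩, hc0⟩ := (((hcont.eventually_lt_const hqr).and hsmall).and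
    ((eventually_lt_nhds hθ₁).filter_mono nhdsWithin_le_nhds)).and
      (eventually_mem_nhdsWithin (a := (0 : ℝ)) (s := Set.Ioi 0)) |>.exists
  replace hc0 : 0 < c := hc0
  set A := Real.exp (c * l1 l) * (1 + 8 * l1 l * c) with hA
  have hA0 : 0 ≤ A := by positivity
  -- and so is the factor due to the mixing when `L` is large
  have hlim : Tendsto (fun L => A * (Real.exp (S L) * q.toReal)) atTop (nhds (A * q.toReal)) := by
    have h1 := (Real.continuous_exp.tendsto 0).comp hS
    rw [Real.exp_zero] at h1
    simpa using (h1.mul_const q.toReal).const_mul A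
  obtain ⟨L₂, hL₂⟩ := eventually_atTop.1 (hlim.eventually_lt_const hc1)
  refine ⟨c, hc0, ENNReal.ofReal A * (1 - q')⁻¹, ENNReal.mul_lt_top ENNReal.ofReal_lt_top ?_,
    max L₁ L₂, fun L hL hLpos hdvd => ?_⟩
  · rw [ENNReal.inv_lt_top]
    exact tsub_pos_of_lt hq'1
  have hθ0 : 0 < c * (κ : ℝ) ^ L := by positivity
  have hθle : c * (κ : ℝ) ^ L ≤ θ₁ := by
    have h1 : (κ : ℝ) ^ L ≤ 1 := pow_le_one₀ hκ0.le hκ1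
    have h2 : c * (κ : ℝ) ^ L ≤ c * 1 := by gcongr
    linarith
  have hrate : ENNReal.ofReal A * (ENNReal.ofReal (Real.exp (S L)) * q) ≤ q' := by
    rw [← ENNReal.ofReal_toReal hqtop, ← ENNReal.ofReal_mul (Real.exp_pos _).le,
      ← ENNReal.ofReal_mul hA0, ← ENNReal.ofReal_toReal hq'top]
    exact ENNReal.ofReal_le_ofReal (hL₂ L (le_of_max_le_right hL)).le
  rw [← ENNReal.tsum_geometric, ← ENNReal.tsum_mul_left]
  refine ENNReal.tsum_le_tsum fun k => ?_
  refine (attemptMoment_le hstat hLpos hdvd hc0.le hc2.le (hdec L (le_of_max_le_left hL))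
    (hq _ hθ0 hθle) k).trans ?_
  gcongr

end Regeneration

end RWRE

open RWRE

theorem mainTheorem6 {d : ℕ} (hd : 1 < d) (κ : RWRE.Ellipticity d)
    (P : Measure (RWRE.Env d κ)) [IsProbabilityMeasure P] (hstat : RWRE.IsStationary P)
    (r C g : ℝ) (hr : 1 < r) (hC : 0 < C) (hg : 0 < g)
    (hmix : RWRE.SM r C g P ∨ RWRE.SMG r C g P)
    -- the direction `ℓ` and the integer vector `l = h ℓ`
    (ℓ : RWRE.Space d) (hℓ : ‖ℓ‖ = 1) (h : ℝ) (hh : 0 < h)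
    (l : RWRE.Site d) (hl : RWRE.toSpace l = h • ℓ)
    -- condition (T) in direction `ℓ`, with aspect ratio `ρ` of the boxes
    (R : RWRE.Space d ≃ₗᵢ[ℝ] RWRE.Space d) (ρ : ℝ) (hT : RWRE.ConditionT P ℓ R ρ)
    -- the requirements on the cone angle
    (ζ : ℝ) (hζ : 0 < ζ)
    (hζ' : ζ < min (1 / (9 * (d : ℝ))) (min (1 / (3 * (d : ℝ) * ρ))
      (Real.cos (Real.pi / 2 - Real.arctan (3 * ρ)))))
    (hζl : ∀ m : ℕ, 1 ≤ m → m ≤ RWRE.l1 l →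
      (((RWRE.barSeq l).take m).map RWRE.Dir.vec).sum ∈ RWRE.cone l ζ 0) :
    (∃ c₂ c₃ L₀ : ℝ, 0 < c₂ ∧ 0 < c₃ ∧ 0 < L₀ ∧
      ∀ L : ℕ, L₀ ≤ (L : ℝ) → RWRE.l1 l ∣ L →
        (∀ᵐ z ∂(RWRE.enlargedLaw P), RWRE.tau1 l ζ L z.1.2 z.2 ≠ ⊤) ∧
        ∫⁻ z, ENNReal.ofReal (Real.exp (c₂ * (κ : ℝ) ^ L *
            ((z.2 (RWRE.tau1 l ζ L z.1.2 z.2).toNat ⬝ᵥ l : ℤ) : ℝ))) ∂(RWRE.enlargedLaw P)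
          < ENNReal.ofReal c₃) ∧
    (∃ c₆ c₇ L₀ : ℝ, 0 < c₆ ∧ 0 < c₇ ∧ 0 < L₀ ∧
      ∀ L : ℕ, L₀ ≤ (L : ℝ) → RWRE.l1 l ∣ L →
        ∫⁻ z, ENNReal.ofReal (Real.exp (c₆ * (κ : ℝ) ^ L *
            RWRE.maxExcursion l ζ L z.1.2 z.2)) ∂(RWRE.enlargedLaw P)
          ≤ ENNReal.ofReal c₇) := by
  have : NeZero d := ⟨by omega⟩
  have hd' : (2 : ℝ) ≤ d := by exact_mod_cast hd
  obtain ⟨hR, hρ, -⟩ := id hT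
  have hκ0 : (0 : ℝ) < κ := κ.2.1
  have hκ1 : (κ : ℝ) ≤ 1 := by linarith [kappa_le_quarter κ]
  have hζ1 : ζ * (9 * d) < 1 := (lt_div_iff₀ (by positivity)).1 (lt_min_iff.1 hζ').1
  have hζ2 : ζ * (3 * d * ρ) < 1 :=
    (lt_div_iff₀ (by positivity)).1 (lt_min_iff.1 (lt_min_iff.1 hζ').2).1
  have hζ3 : ζ ≤ 1 / 2 := by nlinarith
  have hl2 : 0 < l2 l := by rw [l2_eq_of_toSpace hℓ hh hl]; exact hh
  have hb : 0 < l1 l := by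
    have h1 := hl2.trans_le (l2_le_l1 l)
    exact_mod_cast h1
  obtain ⟨cZ, hcZ, Z, hZm, hZint, hZ⟩ :=
    hT.exists_scale hd hstat hℓ hh hl hζ hζ1 hζ2
  obtain ⟨θ₁, hθ₁, q, hq1, hq⟩ :=
    exists_coneMoment_le hstat hR hℓ hh hl hρ hζ hζ3 hζl hb hcZ hZm hZint hZ
  obtain ⟨S, hS, L₁, hdec⟩ := exists_decoupling (by omega) P hr hg hmix l hl2 hζ
  obtain ⟨c, hc, B, hB, L₂, hsum⟩ := exists_tsum_attemptMoment_le hstat hS hdec hθ₁ hq1 hq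
  -- almost every path is confined and has a finite sum over its attempts
  have hae : ∀ L : ℕ, ((L₂ + 1 : ℕ) : ℝ) ≤ L → l1 l ∣ L → ∀ᵐ z ∂(enlargedLaw P),
      ∃ ξ, ξ = letters (z.1.2, z.2) ∧ z.1.2 = (fun n => (ξ n).1) ∧ z.2 = pos 0 ξ ∧
        Z ξ < ⊤ ∧ tau1 l ζ L (fun n => (ξ n).1) (pos 0 ξ) < ⊤ ∧
        attemptSum (c * (κ : ℝ) ^ L) l ζ L ξ < ⊤ ∧
        supTo (c * (κ : ℝ) ^ L) l (tau1 l ζ L (fun n => (ξ n).1) (pos 0 ξ)) ξ ≤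
          attemptSum (c * (κ : ℝ) ^ L) l ζ L ξ := by
    intro L hL hdvd
    have hL' : L₂ + 1 ≤ L := by exact_mod_cast hL
    have hLpos : 0 < L := by omega
    have hlet : Measurable fun z : (Env d κ × (ℕ → Push d)) × (ℕ → Site d) =>
        letters (z.1.2, z.2) := measurable_letters.comp (by fun_prop)
    have hWm := measurable_attemptSum (c * (κ : ℝ) ^ L) l ζ hLpos
    have h1 : ∀ᵐ z ∂(enlargedLaw P), Z (letters (z.1.2, z.2)) < ⊤ := by
      refine ae_lt_top (hZm.comp hlet) ?_
      change ∫⁻ z, Z (letters (z.1.2, z.2)) ∂(enlargedLaw P) ≠ ⊤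
      rw [lintegral_enlargedLaw P Z hZm]
      exact hZint.ne
    have h2 : ∀ᵐ z ∂(enlargedLaw P),
        attemptSum (c * (κ : ℝ) ^ L) l ζ L (letters (z.1.2, z.2)) < ⊤ := by
      refine ae_lt_top (hWm.comp hlet) ?_
      change ∫⁻ z, attemptSum (c * (κ : ℝ) ^ L) l ζ L (letters (z.1.2, z.2)) ∂(enlargedLaw P) ≠ ⊤
      rw [lintegral_enlargedLaw P _ hWm, lintegral_attemptSum P _ l ζ hLpos]
      exact ((hsum L (by omega) hLpos hdvd).trans_lt hB).ne
    filter_upwards [h1, h2, ae_enlargedLaw P] with z hz1 hz2 hz3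
    obtain ⟨m₀, -, -, hconf⟩ := hZ _ hz1
    obtain ⟨h3, h4⟩ := exists_tau1_eq_attempt hLpos
      (hconf.exists_lt_ex hR hh hl (θ := c * (κ : ℝ) ^ L) (by positivity)) hz2
    exact ⟨_, rfl, rfl, hz3, hz1, h3, hz2, h4⟩
  have hint : ∀ L : ℕ, ((L₂ + 1 : ℕ) : ℝ) ≤ L → l1 l ∣ L →
      ∫⁻ z, attemptSum (c * (κ : ℝ) ^ L) l ζ L (letters (z.1.2, z.2)) ∂(enlargedLaw P) ≤ B := by
    intro L hL hdvd
    have hL' : L₂ + 1 ≤ L := by exact_mod_cast hL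
    rw [lintegral_enlargedLaw P _ (measurable_attemptSum _ l ζ (by omega)),
      lintegral_attemptSum P _ l ζ (by omega)]
    exact hsum L (by omega) (by omega) hdvd
  refine ⟨⟨c, B.toReal + 1, (L₂ + 1 : ℕ), hc, by positivity, by positivity,
    fun L hL hdvd => ⟨?_, ?_⟩⟩, ?_⟩
  · filter_upwards [hae L hL hdvd] with z hz
    obtain ⟨ξ, -, h1, h2, -, h3, -⟩ := hz
    rw [h1, h2]
    exact h3.ne
  · refine lt_of_le_of_lt (lintegral_mono_ae (g := fun z =>
      attemptSum (c * (κ : ℝ) ^ L) l ζ L (letters (z.1.2, z.2))) ?_)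
      ((hint L hL hdvd).trans_lt ?_)
    · filter_upwards [hae L hL hdvd] with z hz
      obtain ⟨ξ, h0, h1, h2, -, h3, -, h4⟩ := hz
      rw [← h0, h1, h2]
      refine le_trans ?_ h4
      exact le_supTo (by rw [ENat.natCast_toNat h3.ne])
    · rw [ENNReal.lt_ofReal_iff_toReal_lt hB.ne]
      linarith
  · have hIZ : ∫⁻ z, Z (letters (z.1.2, z.2)) ∂(enlargedLaw P) < ⊤ := by
      rw [lintegral_enlargedLaw P Z hZm]; exact hZint
    set I := ∫⁻ z, Z (letters (z.1.2, z.2)) ∂(enlargedLaw P) with hI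
    -- with this `c₆` the exponent is at most the mean of those of two integrable functions
    set D := 1 + d * ρ with hD
    have hD0 : 0 < D := by positivity
    set c₆ := min (c * h) cZ / (2 * D) with hc₆
    have hc₆0 : 0 < c₆ := by positivity
    set A := ENNReal.ofReal (Real.exp cZ) with hA
    have hfin : A * I + B < ⊤ :=
      ENNReal.add_lt_top.2 ⟨ENNReal.mul_lt_top ENNReal.ofReal_lt_top hIZ, hB⟩
    refine ⟨c₆, (A * I + B).toReal + 1, (L₂ + 1 : ℕ), hc₆0, by positivity, by positivity,
      fun L hL hdvd => ?_⟩
    have hL' : L₂ + 1 ≤ L := by exact_mod_cast hL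
    have hLpos : 0 < L := by omega
    have hlet : Measurable fun z : (Env d κ × (ℕ → Push d)) × (ℕ → Site d) =>
        letters (z.1.2, z.2) := measurable_letters.comp (by fun_prop)
    set θ := c * (κ : ℝ) ^ L with hθ
    have hκL0 : 0 < (κ : ℝ) ^ L := by positivity
    have hκL1 : (κ : ℝ) ^ L ≤ 1 := pow_le_one₀ hκ0.le hκ1
    have hθ0 : 0 < θ := by positivity
    calc ∫⁻ z, ENNReal.ofReal (Real.exp (c₆ * (κ : ℝ) ^ L *
            maxExcursion l ζ L z.1.2 z.2)) ∂(enlargedLaw P)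
        ≤ ∫⁻ z, (A * Z (letters (z.1.2, z.2)) + attemptSum θ l ζ L (letters (z.1.2, z.2)))
            ∂(enlargedLaw P) := by
          refine lintegral_mono_ae ?_
          filter_upwards [hae L hL hdvd] with z hz
          obtain ⟨ξ, h0, h1, h2, hz1, h3, hz2, h4⟩ := hz
          rw [← h0, h1, h2]
          obtain ⟨m₀, -, hm₀, hconf⟩ := hZ ξ hz1
          set W := (attemptSum θ l ζ L ξ).toReal with hW
          have hWof : ENNReal.ofReal W = attemptSum θ l ζ L ξ := ENNReal.ofReal_toReal hz2.ne
          have hW1 : 1 ≤ W := by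
            have h5 := (one_le_supTo _ _ _ _).trans h4
            rw [← hWof] at h5
            exact ENNReal.one_le_ofReal.1 h5
          rw [← hWof] at h4 ⊢
          have hY : maxExcursion l ζ L (fun n => (ξ n).1) (pos 0 ξ) ≤
              D * (m₀ + 1 + Real.log W / (θ * h)) := by
            have : Nonempty {n : ℕ // (n : ℕ∞) ≤
                tau1 l ζ L (fun n => (ξ n).1) (pos 0 ξ)} := ⟨⟨0, by simp⟩⟩
            exact ciSup_le fun n => hconf.l2_le_of_supTo_le hR hh hl hρ hθ0 hW1 h4 n.2
          have hlog := Real.log_nonneg hW1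
          have hexp : c₆ * (κ : ℝ) ^ L * maxExcursion l ζ L (fun n => (ξ n).1) (pos 0 ξ) ≤
              (cZ * (m₀ + 1) + Real.log W) / 2 := by
            have h6 : c₆ * D ≤ c * h / 2 := by
              rw [hc₆, div_mul_eq_mul_div, mul_div_mul_right _ _ hD0.ne']
              gcongr
              exact min_le_left _ _
            have h7 : c₆ * D ≤ cZ / 2 := by
              rw [hc₆, div_mul_eq_mul_div, mul_div_mul_right _ _ hD0.ne']
              gcongr
              exact min_le_right _ _
            calc c₆ * (κ : ℝ) ^ L * maxExcursion l ζ L (fun n => (ξ n).1) (pos 0 ξ)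
                ≤ c₆ * (κ : ℝ) ^ L * (D * (m₀ + 1 + Real.log W / (θ * h))) := by gcongr
              _ = (κ : ℝ) ^ L * ((c₆ * D) * (m₀ + 1)) +
                    (c₆ * D) * (Real.log W / (c * h)) := by
                  rw [hθ]; field_simp
              _ ≤ 1 * (cZ / 2 * (m₀ + 1)) + c * h / 2 * (Real.log W / (c * h)) := by gcongr
              _ = (cZ * (m₀ + 1) + Real.log W) / 2 := by field_simp
          have hsq : Real.exp ((cZ * (m₀ + 1) + Real.log W) / 2) ≤
              Real.exp cZ * Real.exp (cZ * m₀) + W := by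
            have h8 : Real.exp (cZ * (m₀ + 1)) = Real.exp cZ * Real.exp (cZ * m₀) := by
              rw [← Real.exp_add]; ring_nf
            rw [← h8]
            rcases le_total (cZ * ((m₀ : ℝ) + 1)) (Real.log W) with h9 | h9
            · refine le_trans (Real.exp_le_exp.2 (by linarith :
                (cZ * ((m₀ : ℝ) + 1) + Real.log W) / 2 ≤ Real.log W)) ?_
              rw [Real.exp_log (by linarith)]
              linarith [Real.exp_pos (cZ * ((m₀ : ℝ) + 1))]
            · refine le_trans (Real.exp_le_exp.2 (by linarith :
                (cZ * ((m₀ : ℝ) + 1) + Real.log W) / 2 ≤ cZ * ((m₀ : ℝ) + 1))) ?_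
              linarith
          calc ENNReal.ofReal (Real.exp (c₆ * (κ : ℝ) ^ L *
                maxExcursion l ζ L (fun n => (ξ n).1) (pos 0 ξ)))
              ≤ ENNReal.ofReal (Real.exp cZ * Real.exp (cZ * m₀) + W) :=
                ENNReal.ofReal_le_ofReal ((Real.exp_le_exp.2 hexp).trans hsq)
            _ = A * ENNReal.ofReal (Real.exp (cZ * m₀)) + ENNReal.ofReal W := by
                rw [ENNReal.ofReal_add (by positivity) (by linarith),
                  ENNReal.ofReal_mul (Real.exp_pos _).le]
            _ ≤ _ := by gcongr
      _ = A * I + ∫⁻ z, attemptSum θ l ζ L (letters (z.1.2, z.2)) ∂(enlargedLaw P) := by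
          have hm : Measurable fun z : (Env d κ × (ℕ → Push d)) × (ℕ → Site d) =>
            Z (letters (z.1.2, z.2)) := hZm.comp hlet
          rw [lintegral_add_left (hm.const_mul A), lintegral_const_mul _ hm]
      _ ≤ A * I + B := by
          gcongr
          exact hint L hL hdvd
      _ ≤ _ := by
          rw [← ENNReal.ofReal_toReal hfin.ne]
          exact ENNReal.ofReal_le_ofReal <| by
            rw [ENNReal.toReal_ofReal ENNReal.toReal_nonneg]; linarith
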